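/- **Theorem (Monneau-type monotonicity for the Baouendi--Grushin operator).** Let $n\ge 1$, $\alpha\ge 0$, $r_0>0$, and write points of $\mathbb R^{n+1}$ as $(x,z)$ with $x\in\mathbb R^n$, $z\in\mathbb R$. Put $$\mathcal B_\alpha u=D_{zz}u+|z|^{2\alpha}\Delta_x u,\qquad |\nabla_\alpha u|^2=|z|^{2\alpha}|\nabla_x u|^2+(D_zu)^2,\qquad Z_\alpha u=(\alpha+1)\langle x,\nabla_x u\rangle+z\,D_z u,\qquad Q=(\alpha+1)n+1,$$ $$\rho_\alpha(x,z)=\big((\alpha+1)^2|x|^2+|z|^{2(\alpha+1)}\big)^{\frac1{2(\alpha+1)}},\qquad \psi_\alpha=|\nabla_\alpha\rho_\alpha|^2,\qquad B(r)=\{\rho_\alpha<r\},\qquad S(r)=\partial B(r),$$ and let $H_n$ be the $n$-dimensional Hausdorff measure (surface measure). Let $u$ be a solution of the thin obstacle problem for $\mathcal B_\alpha$ in $B(r_0)$ with zero obstacle, that is: $u$ is continuous in $B(r_0)$, is of class $C^2$ in $B(r_0)\cap\{z\ne0\}$, satisfies $\int_{B(r)}|\nabla_\alpha u|^2\,dx\,dz<\infty$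 for $0<r<r_0$, the one-sided limits $D_z^{\pm}u$ of $D_zu$ from $\{\pm z>0\}$ exist and are finite at every point of $B(r_0)\cap\{z=0\}$, and $$\mathcal B_\alpha u=0\ \text{ in } B(r_0)\cap\{z\neq0\},\qquad u(x,-z)=u(x,z)\ \text{ in } B(r_0),$$ $$u\ge0,\qquad -D_z^+u+D_z^-u\ge0,\qquad u\,(-D_z^+u+D_z^-u)=0\quad\text{ in } B(r_0)\cap\{z=0\}.$$ Assume that $u$ does not vanish identically in any $B(r)$, $0<r<r_0$. For $0<r<r_0$ let $$D(u,r)=\int_{B(r)}|\nabla_\alpha u|^2\,dx\,dz,\qquad H(u,r)=\int_{S(r)}u^2\,\frac{\psi_\alpha}{|\nabla\rho_\alpha|}\,dH_n,\qquad N(u,r)=\frac{r\,D(u,r)}{H(u,r)}.$$ Then $H(u,r)>0$ for $0<r<r_0$, and the limit $\kappa=N(u,0^+)=\lim_{r\to0^+}N(u,r)$ exists and is finite. Put $$\mathcal W_\kappa(u,r)=\frac{1}{r^{Q-2+2\kappa}}D(u,r)-\frac{\kappa}{r^{Q-1+2\kappa}}H(u,r).$$ Let $P\in\mathfrak P^+_{\alpha,\kappa}(\mathbb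 R^{n+1})$, that is: with $X_j=|z|^\alpha\partial_{x_j}$ for $1\le j\le n$ and $X_{n+1}=\partial_z$, the function $P$ and its weak derivatives $X_jP$, $X_jX_jP$ ($1\le j\le n+1$) are continuous in $\mathbb R^{n+1}$, $\mathcal B_\alpha P=\sum_{j=1}^{n+1} X_jX_jP=0$ in $\mathbb R^{n+1}$, $P$ is differentiable and $Z_\alpha P=\kappa P$ in $\{z\neq0\}$, $P(x,0)\ge0$, and $P(x,-z)=P(x,z)$. Consider $$\mathcal M_\kappa(u,P,r)=\frac1{r^{Q-1+2\kappa}}\int_{S(r)}(u-P)^2\,\frac{\psi_\alpha}{|\nabla\rho_\alpha|}\,dH_n,\qquad 0<r<r_0.$$ Then $r\mapsto\mathcal M_\kappa(u,P,r)$ is differentiable in $(0,r_0)$, and for every $0<r<r_0$ $$\frac{d}{dr}\mathcal M_\kappa(u,P,r)\ \ge\ \frac2r\,\mathcal W_\kappa(u,r)\ \ge\ 0 .$$ In particular $r\mapsto\mathcal M_\kappa(u,P,r)$ is nondecreasing in $(0,r_0)$. -/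

import Mathlib

open Set Filter Topology MeasureTheory

namespace BaouendiGrushin

/-- The space `ℝⁿ × ℝ = ℝⁿ⁺¹` with its Euclidean structure: the first `n` coordinates form the
variable `x`, the last one is the variable `z`. -/
abbrev Space (n : ℕ) : Type := EuclideanSpace ℝ (Fin (n + 1))

noncomputable section

variable {n : ℕ}

/-- The last coordinate `z` of a point `(x, z)`. -/
def zCoord (p : Space n) : ℝ := p (Fin.last n)

/-- `|x|²` for a point `(x, z)`. -/
def xNormSq (p : Space n) : ℝ := ∑ i : Fin n, p i.castSucc ^ 2

/-- The classical partial derivative with respect to the `i`-th coordinate. -/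
def partialD (i : Fin (n + 1)) (f : Space n → ℝ) (p : Space n) : ℝ :=
  fderiv ℝ f p (EuclideanSpace.single i 1)

/-- The derivative `D_z`. -/
def Dz (f : Space n → ℝ) : Space n → ℝ := partialD (Fin.last n) f

/-- The reflection `(x, z) ↦ (x, -z)`. -/
def reflectZ (p : Space n) : Space n :=
  WithLp.toLp 2 (fun i => if i = Fin.last n then -p i else p i)

/-- The operator `B_α u = D_zz u + |z|^{2α} Δ_x u` (classical derivatives). -/
def baouendi (α : ℝ) (u : Space n → ℝ) (p : Space n) : ℝ :=
  Dz (Dz u) p +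
    |zCoord p| ^ (2 * α) * ∑ i : Fin n, partialD i.castSucc (partialD i.castSucc u) p

/-- `|∇_α f|² = |z|^{2α} |∇_x f|² + (D_z f)²`. -/
def alphaGradSq (α : ℝ) (f : Space n → ℝ) (p : Space n) : ℝ :=
  |zCoord p| ^ (2 * α) * ∑ i : Fin n, partialD i.castSucc f p ^ 2 + Dz f p ^ 2

/-- The generator of the dilations `(x, z) ↦ (λ^{α+1} x, λ z)`:
`Z_α f = (α + 1) ∑ x_i ∂_{x_i} f + z ∂_z f`. -/
def Zfield (α : ℝ) (f : Space n → ℝ) (p : Space n) : ℝ :=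
  (α + 1) * ∑ i : Fin n, p i.castSucc * partialD i.castSucc f p + zCoord p * Dz f p

/-- The homogeneous dimension `Q = (α + 1) n + 1`. -/
def homDim (n : ℕ) (α : ℝ) : ℝ := (α + 1) * n + 1

/-- The pseudo-gauge `ρ_α(x, z) = ((α+1)² |x|² + |z|^{2(α+1)})^{1/(2(α+1))}`. -/
def gauge (α : ℝ) (p : Space n) : ℝ :=
  ((α + 1) ^ 2 * xNormSq p + |zCoord p| ^ (2 * (α + 1))) ^ (1 / (2 * (α + 1)))

/-- The pseudo-ball `B_{ρ_α}(r)`. -/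
def pseudoBall (n : ℕ) (α r : ℝ) : Set (Space n) := {p | gauge α p < r}

/-- The pseudo-sphere `S_{ρ_α}(r) = ∂ B_{ρ_α}(r)`. -/
def pseudoSphere (n : ℕ) (α r : ℝ) : Set (Space n) := frontier (pseudoBall n α r)

/-- `ψ_α = |∇_α ρ_α|²`. -/
def psi (α : ℝ) (p : Space n) : ℝ := alphaGradSq α (gauge α) p

/-- The height `H(u, r) = ∫_{S(r)} u² ψ_α / |∇ρ_α| dH_n`; here `H_n` is the `n`-dimensional Hausdorff
measure with its usual normalization (surface measure). -/
def height (α : ℝ) (u : Space n → ℝ) (r : ℝ) : ℝ :=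
  ∫ p in pseudoSphere n α r, u p ^ 2 * (psi α p / ‖gradient (gauge α) p‖) ∂(μHE[n])

/-- The Dirichlet integral `D(u, r) = ∫_{B(r)} |∇_α u|²`. -/
def dirichlet (α : ℝ) (u : Space n → ℝ) (r : ℝ) : ℝ :=
  ∫ p in pseudoBall n α r, alphaGradSq α u p

/-- The frequency `N(u, r) = r D(u, r) / H(u, r)`. -/
def frequency (α : ℝ) (u : Space n → ℝ) (r : ℝ) : ℝ :=
  r * dirichlet α u r / height α u r

/-- The Weiss functional `W_κ(u, r)`. -/
def weiss (α κ : ℝ) (u : Space n → ℝ) (r : ℝ) : ℝ :=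
  1 / r ^ (homDim n α - 2 + 2 * κ) * dirichlet α u r -
    κ / r ^ (homDim n α - 1 + 2 * κ) * height α u r

/-- The Monneau functional `M_κ(u, P, r)`. -/
def monneau (α κ : ℝ) (u P : Space n → ℝ) (r : ℝ) : ℝ :=
  1 / r ^ (homDim n α - 1 + 2 * κ) *
    ∫ p in pseudoSphere n α r, (u p - P p) ^ 2 * (psi α p / ‖gradient (gauge α) p‖) ∂(μHE[n])

/-- `u` solves the thin obstacle problem for `B_α` in `B_{ρ_α}(r₀)` with zero obstacle.  The one-sided
normal derivatives `D_z^± u` on the thin ball are the limits of `D_z u` from `{z > 0}` and from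
`{z < 0}`. -/
structure IsThinObstacleSolution (α r₀ : ℝ) (u : Space n → ℝ) : Prop where
  continuousOn : ContinuousOn u (pseudoBall n α r₀)
  contDiffOn : ContDiffOn ℝ 2 u (pseudoBall n α r₀ ∩ {p | zCoord p ≠ 0})
  energy : ∀ r ∈ Ioo 0 r₀, IntegrableOn (alphaGradSq α u) (pseudoBall n α r)
  equation : ∀ p ∈ pseudoBall n α r₀, zCoord p ≠ 0 → baouendi α u p = 0
  obstacle : ∀ p ∈ pseudoBall n α r₀, zCoord p = 0 → 0 ≤ u p
  even : ∀ p ∈ pseudoBall n α r₀, u (reflectZ p) = u p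
  signorini : ∀ p ∈ pseudoBall n α r₀, zCoord p = 0 →
    ∃ dPlus dMinus : ℝ,
      Tendsto (Dz u) (𝓝[{q | 0 < zCoord q}] p) (𝓝 dPlus) ∧
      Tendsto (Dz u) (𝓝[{q | zCoord q < 0}] p) (𝓝 dMinus) ∧
      0 ≤ -dPlus + dMinus ∧
      u p * (-dPlus + dMinus) = 0

/-- The coefficient of the vector field `X_i`: `X_i = |z|^α ∂_{x_i}` for the `x`-directions, and
`X_{n+1} = ∂_z`. -/
def fieldCoeff (α : ℝ) (i : Fin (n + 1)) (p : Space n) : ℝ :=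
  if i = Fin.last n then 1 else |zCoord p| ^ α

/-- `g` is the weak derivative `X_i f` on the whole space (the formal adjoint of `X_i` is `-X_i`). -/
def IsWeakX (α : ℝ) (i : Fin (n + 1)) (f g : Space n → ℝ) : Prop :=
  ∀ φ : Space n → ℝ, ContDiff ℝ (⊤ : ℕ∞) φ → HasCompactSupport φ →
    ∫ p, f p * (fieldCoeff α i p * partialD i φ p) = -∫ p, g p * φ p

/-- `P` is a `B_α`-solid harmonic of degree `κ`: `P`, the weak derivatives `X_i P` and `X_i X_i P` are
continuous on `ℝⁿ⁺¹`, `B_α P = ∑ X_i X_i P = 0`, and `Z_α P = κ P` (off `{z = 0}`, where `P` is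
classically differentiable). -/
structure IsSolidHarmonic (α κ : ℝ) (P : Space n → ℝ) : Prop where
  continuous : Continuous P
  equation : ∃ g G : Fin (n + 1) → Space n → ℝ,
    (∀ i, Continuous (g i) ∧ Continuous (G i) ∧ IsWeakX α i P (g i) ∧ IsWeakX α i (g i) (G i)) ∧
    ∀ p, ∑ i, G i p = 0
  homogeneous : ∀ p, zCoord p ≠ 0 → DifferentiableAt ℝ P p ∧ Zfield α P p = κ * P p

/-- The class `𝔓⁺_{α,κ}(ℝⁿ⁺¹)`: solid harmonics of degree `κ` that are nonnegative on `{z = 0}` and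
even in `z`. -/
structure IsPosSolidHarmonic (α κ : ℝ) (P : Space n → ℝ) : Prop where
  isSolidHarmonic : IsSolidHarmonic α κ P
  nonneg : ∀ p, zCoord p = 0 → 0 ≤ P p
  even : ∀ p, P (reflectZ p) = P p

end

end BaouendiGrushin

/-! Everything is written in the logarithmic radius `t = log r`. The polar map `(y, t) ↦ δ_{e^t}
Θ(y)`, with `Θ(y)` on the upper unit pseudo-sphere, carries one fixed finite measure `σ = sphMeas`
on the sphere times `e^{Qt} dt` to `ψ_α` times Lebesgue measure on the upper half-space
(`map_polar`), and along its rays `Z_α` is `d/dt`. Write `⟨v, w⟩(t) = ∫ v w dσ` over the sphere of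
radius `e^t` (`sphProd`), `h = ⟨u, u⟩`, and let `E` be the rescaled energy over the upper half-ball
(`radEnergy`). By evenness `H = 2 r^{Q-1} h`, `D = 2 r^{Q-2} E`, `N = E / h` and `W_κ = 2 r^{-2κ} (E
- κ h)`.

The engine is the first variation identity `HalfSolution.slice_identity`: for almost every `t`, the
energy pairing of `v` and `f` over the upper half-ball of radius `e^t`, plus the pairing of `f` with
the one-sided trace of `D_z v` over the thin ball, equals `e^{(Q-2)t} ∫ f Z_α v dσ`. It comes from
`HalfSolution.weak_identity`, that is, from testing the equation with `f` times a radial weight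
times a cutoff in `z`. The structure `HalfSolution` asks only for coordinate-wise second
derivatives, so it covers `u` as well as `P`. With `v = f = u` the Signorini conditions remove the
thin term and give `h' = 2E`.

Monotonicity of `N` is obtained without a second variation identity, hence without regularity of
second derivatives near the thin set. The function `u` is compared with its own dilates. The
identity is tested with `f = u ∘ δ_{e^τ}`. On the thin ball `f ≥ 0` and the trace of `D_z u` is
nonpositive, so the thin term has a sign, and `2ab ≤ a² + b²` with scaling gives `∫ u(t) Z_α u(s) dσ
≤ (E(s) + E(t)) / 2` for `s < t`. Integration in `s` gives `h(t) - ⟨u(s), u(t)⟩ ≤ (h(t) - h(s)) / 4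
+ (t - s) E(t) / 2`. After Cauchy-Schwarz this says that `F = (log h) / 2`, whose derivative is `N`,
lies below its tangents from the left up to a cubic error; such a function is convex
(`monotoneOn_of_secant_le`), so `N` is nondecreasing. Its limit `κ` at `t → -∞` exists and lies
below all its values, which is `W_κ ≥ 0`.

For the Monneau functional one expands `(u - P)²`. The square of `P` contributes a constant by
homogeneity. The square of `u` contributes `(2 / r) W_κ` to the derivative. In the mixed term
Euler's relation `Z_α P = κ P` and the vanishing of `D_z P` on `{z = 0}`, which follows from
evenness, leave only the pairing of `P ≥ 0` with the trace of `D_z u`. That pairing is nonpositive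
and enters with the coefficient `-4 / r` times positive powers of `r`. -/

namespace BaouendiGrushin

noncomputable section

variable {n : ℕ} {α : ℝ}

/-! ### Coordinates, dilations and the gauge -/

/-- The space `ℝⁿ` of the variable `x`. -/
abbrev Horiz (n : ℕ) : Type := EuclideanSpace ℝ (Fin n)

/-- The point `(x, z)`. -/
def pt (x : Horiz n) (z : ℝ) : Space n :=
  WithLp.toLp 2 (Fin.snoc (α := fun _ => ℝ) (fun i => x i) z)

/-- The component `x` of `(x, z)`. -/
def horiz (p : Space n) : Horiz n := WithLp.toLp 2 fun i => p i.castSucc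

/-- The homogeneity weights of the coordinates. -/
def weight (α : ℝ) (i : Fin (n + 1)) : ℝ := if i = Fin.last n then 1 else α + 1

/-- The dilations `(x, z) ↦ (l^{α+1} x, l z)`. -/
def dil (α l : ℝ) : Space n →L[ℝ] Space n :=
  LinearMap.toContinuousLinearMap
    { toFun := fun p => WithLp.toLp 2 fun i => l ^ weight α i * p i
      map_add' := fun p q => by ext i; simp [mul_add]
      map_smul' := fun c p => by ext i; simp; ring }

@[simp] lemma pt_castSucc (x : Horiz n) (z : ℝ) (i : Fin n) : pt x z i.castSucc = x i := by
  simp [pt]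

@[simp] lemma pt_last (x : Horiz n) (z : ℝ) : pt x z (Fin.last n) = z := by simp [pt]

@[simp] lemma zCoord_pt (x : Horiz n) (z : ℝ) : zCoord (pt x z) = z := by simp [zCoord]

@[simp] lemma horiz_pt (x : Horiz n) (z : ℝ) : horiz (pt x z) = x := by ext i; simp [horiz]

@[simp] lemma pt_horiz_zCoord (p : Space n) : pt (horiz p) (zCoord p) = p := by
  ext i
  refine Fin.lastCases ?_ (fun i => ?_) i <;> simp [horiz, zCoord]

lemma xNormSq_eq (p : Space n) : xNormSq p = ‖horiz p‖ ^ 2 := by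
  simp [xNormSq, horiz, EuclideanSpace.norm_sq_eq]

@[simp] lemma xNormSq_pt (x : Horiz n) (z : ℝ) : xNormSq (pt x z) = ‖x‖ ^ 2 := by
  simp [xNormSq_eq]

@[simp] lemma weight_last : weight α (Fin.last n) = 1 := by simp [weight]

@[simp] lemma weight_castSucc (i : Fin n) : weight α i.castSucc = α + 1 := by
  simp [weight, (Fin.castSucc_lt_last i).ne]

@[simp] lemma dil_apply (l : ℝ) (p : Space n) (i : Fin (n + 1)) :
    dil α l p i = l ^ weight α i * p i := by
  simp [dil]

@[simp] lemma zCoord_dil (l : ℝ) (p : Space n) : zCoord (dil α l p) = l * zCoord p := by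
  simp [zCoord]

lemma dil_pt (l : ℝ) (x : Horiz n) (z : ℝ) :
    dil α l (pt x z) = pt (l ^ (α + 1) • x) (l * z) := by
  ext i
  refine Fin.lastCases ?_ (fun i => ?_) i <;> simp

lemma dil_dil {l m : ℝ} (hl : 0 ≤ l) (hm : 0 ≤ m) (p : Space n) :
    dil α l (dil α m p) = dil α (l * m) p := by
  ext i
  simp [Real.mul_rpow hl hm, mul_assoc]

@[simp] lemma dil_one (p : Space n) : dil α 1 p = p := by ext i; simp

lemma continuous_pt : Continuous fun q : Horiz n × ℝ => pt q.1 q.2 := by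
  refine (PiLp.continuous_toLp 2 _).comp (continuous_pi fun i => ?_)
  refine Fin.lastCases ?_ (fun i => ?_) i
  · simpa using continuous_snd
  · simp only [Fin.snoc_castSucc]; fun_prop

lemma continuous_zCoord : Continuous (zCoord : Space n → ℝ) := by
  unfold zCoord; fun_prop

lemma continuous_horiz : Continuous (horiz : Space n → Horiz n) :=
  (PiLp.continuous_toLp 2 _).comp (continuous_pi fun i => by fun_prop)

lemma continuous_xNormSq : Continuous (xNormSq : Space n → ℝ) := by
  unfold xNormSq; fun_prop

/-- The quantity `ρ^{2(α+1)}`. -/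
def gaugePow (α : ℝ) (p : Space n) : ℝ :=
  (α + 1) ^ 2 * xNormSq p + |zCoord p| ^ (2 * (α + 1))

lemma xNormSq_nonneg (p : Space n) : 0 ≤ xNormSq p := by rw [xNormSq_eq]; positivity

lemma gaugePow_nonneg (p : Space n) : 0 ≤ gaugePow α p := by
  have := xNormSq_nonneg p
  unfold gaugePow; positivity

lemma gauge_eq (p : Space n) : gauge α p = gaugePow α p ^ (1 / (2 * (α + 1))) := rfl

lemma gauge_nonneg (p : Space n) : 0 ≤ gauge α p := Real.rpow_nonneg (gaugePow_nonneg p) _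

lemma gauge_rpow (hα : 0 ≤ α) (p : Space n) : gauge α p ^ (2 * (α + 1)) = gaugePow α p := by
  rw [gauge_eq, ← Real.rpow_mul (gaugePow_nonneg p), one_div_mul_cancel (by positivity),
    Real.rpow_one]

lemma gauge_rpow_succ_sq (hα : 0 ≤ α) (p : Space n) :
    (gauge α p ^ (α + 1)) ^ 2 = (α + 1) ^ 2 * ‖horiz p‖ ^ 2 + |zCoord p| ^ (2 * (α + 1)) := by
  rw [← Real.rpow_natCast, ← Real.rpow_mul (gauge_nonneg p), mul_comm, Nat.cast_ofNat,
    gauge_rpow hα, gaugePow, xNormSq_eq]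

lemma continuous_gaugePow (hα : 0 ≤ α) : Continuous (gaugePow α : Space n → ℝ) := by
  unfold gaugePow
  refine (continuous_const.mul continuous_xNormSq).add ?_
  exact (Real.continuous_rpow_const (by positivity)).comp continuous_zCoord.abs

lemma continuous_gauge (hα : 0 ≤ α) : Continuous (gauge α : Space n → ℝ) :=
  (Real.continuous_rpow_const (by positivity)).comp (continuous_gaugePow hα)

lemma abs_zCoord_le_gauge (hα : 0 ≤ α) (p : Space n) : |zCoord p| ≤ gauge α p := by
  refine (Real.rpow_le_rpow_iff (abs_nonneg _) (gauge_nonneg p)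
    (by positivity : 0 < 2 * (α + 1))).1 ?_
  rw [gauge_rpow hα, gaugePow]
  have := xNormSq_nonneg p
  have : 0 ≤ (α + 1) ^ 2 * xNormSq p := by positivity
  linarith

lemma norm_horiz_le_gauge (hα : 0 ≤ α) (p : Space n) :
    (α + 1) * ‖horiz p‖ ≤ gauge α p ^ (α + 1) := by
  refine (pow_le_pow_iff_left₀ (by positivity) (Real.rpow_nonneg (gauge_nonneg p) _)
    two_ne_zero).1 ?_
  rw [gauge_rpow_succ_sq hα, mul_pow]
  have := Real.rpow_nonneg (abs_nonneg (zCoord p)) (2 * (α + 1))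
  linarith

lemma gauge_pos_of_zCoord_ne_zero (hα : 0 ≤ α) {p : Space n} (hp : zCoord p ≠ 0) :
    0 < gauge α p :=
  (abs_pos.2 hp).trans_le (abs_zCoord_le_gauge hα p)

lemma gauge_dil (hα : 0 ≤ α) {l : ℝ} (hl : 0 ≤ l) (p : Space n) :
    gauge α (dil α l p) = l * gauge α p := by
  have h : gaugePow α (dil α l p) = l ^ (2 * (α + 1)) * gaugePow α p := by
    have h1 : xNormSq (dil α l p) = l ^ (2 * (α + 1)) * xNormSq p := by
      simp only [xNormSq, dil_apply, weight_castSucc, Finset.mul_sum, mul_pow]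
      refine Finset.sum_congr rfl fun i _ => ?_
      rw [← Real.rpow_natCast, ← Real.rpow_mul hl, mul_comm (α + 1)]
      norm_num
    rw [gaugePow, h1, zCoord_dil, abs_mul, abs_of_nonneg hl, Real.mul_rpow hl (abs_nonneg _),
      gaugePow]
    ring
  rw [gauge_eq, h, Real.mul_rpow (by positivity) (gaugePow_nonneg p), ← Real.rpow_mul hl,
    mul_one_div_cancel (by positivity), Real.rpow_one, gauge_eq]

lemma isCompact_gauge_le (hα : 0 ≤ α) (r : ℝ) : IsCompact {p : Space n | gauge α p ≤ r} := by
  have hcl : IsClosed {p : Space n | gauge α p ≤ r} :=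
    isClosed_le (continuous_gauge hα) continuous_const
  have hc : IsCompact ((fun q : Horiz n × ℝ => pt q.1 q.2) ''
      (Metric.closedBall (0 : Horiz n) (r ^ (α + 1)) ×ˢ Icc (-r) r)) :=
    ((isCompact_closedBall _ _).prod isCompact_Icc).image continuous_pt
  refine hc.of_isClosed_subset hcl fun p hp => ⟨(horiz p, zCoord p), ⟨?_, ?_⟩, by simp⟩
  · have h1 := norm_horiz_le_gauge hα p
    have h2 : gauge α p ^ (α + 1) ≤ r ^ (α + 1) :=
      Real.rpow_le_rpow (gauge_nonneg p) hp (by positivity)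
    simp only [Metric.mem_closedBall, dist_zero_right]
    nlinarith [norm_nonneg (horiz p)]
  · exact abs_le.1 ((abs_zCoord_le_gauge hα p).trans hp)

/-! ### Horizontal derivatives -/

lemma fieldCoeff_last (p : Space n) : fieldCoeff α (Fin.last n) p = 1 := by simp [fieldCoeff]

lemma fieldCoeff_castSucc (i : Fin n) (p : Space n) :
    fieldCoeff α i.castSucc p = |zCoord p| ^ α := by
  simp [fieldCoeff, (Fin.castSucc_lt_last i).ne]

lemma sq_abs_rpow (z : ℝ) : (|z| ^ α) ^ 2 = |z| ^ (2 * α) := by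
  rw [← Real.rpow_natCast, ← Real.rpow_mul (abs_nonneg z), mul_comm]; norm_num

lemma alphaGradSq_eq_sum (f : Space n → ℝ) (p : Space n) :
    alphaGradSq α f p = ∑ i, (fieldCoeff α i p * partialD i f p) ^ 2 := by
  rw [Fin.sum_univ_castSucc]
  simp [alphaGradSq, fieldCoeff_last, fieldCoeff_castSucc, mul_pow, sq_abs_rpow, Finset.mul_sum,
    Dz]

lemma baouendi_eq_sum (f : Space n → ℝ) (p : Space n) :
    baouendi α f p = ∑ i, fieldCoeff α i p ^ 2 * partialD i (partialD i f) p := by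
  rw [Fin.sum_univ_castSucc]
  simp [baouendi, fieldCoeff_last, fieldCoeff_castSucc, sq_abs_rpow, Finset.mul_sum, Dz, add_comm]

lemma Zfield_eq_sum (f : Space n → ℝ) (p : Space n) :
    Zfield α f p = ∑ i, weight α i * p i * partialD i f p := by
  rw [Fin.sum_univ_castSucc]
  simp [Zfield, Finset.mul_sum, Dz, zCoord, mul_assoc]

/-- The pairing `⟨∇_α v, ∇_α f⟩`. -/
def gradPair (α : ℝ) (v f : Space n → ℝ) (p : Space n) : ℝ :=
  ∑ i, fieldCoeff α i p ^ 2 * partialD i v p * partialD i f p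

lemma gradPair_self (v : Space n → ℝ) (p : Space n) : gradPair α v v p = alphaGradSq α v p := by
  rw [alphaGradSq_eq_sum, gradPair]
  exact Finset.sum_congr rfl fun i _ => by ring

lemma gradPair_comm (v f : Space n → ℝ) (p : Space n) :
    gradPair α v f p = gradPair α f v p :=
  Finset.sum_congr rfl fun i _ => by ring

lemma two_mul_abs_gradPair_le (v f : Space n → ℝ) (p : Space n) :
    2 * |gradPair α v f p| ≤ alphaGradSq α v p + alphaGradSq α f p := by
  rw [alphaGradSq_eq_sum, alphaGradSq_eq_sum, gradPair, ← Finset.sum_add_distrib]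
  refine (mul_le_mul_of_nonneg_left (Finset.abs_sum_le_sum_abs _ _) zero_le_two).trans ?_
  rw [Finset.mul_sum]
  refine Finset.sum_le_sum fun i _ => ?_
  have h : fieldCoeff α i p ^ 2 * partialD i v p * partialD i f p
    = (fieldCoeff α i p * partialD i v p) * (fieldCoeff α i p * partialD i f p) := by ring
  rw [h, abs_mul, ← sq_abs (fieldCoeff α i p * partialD i v p),
    ← sq_abs (fieldCoeff α i p * partialD i f p)]
  nlinarith [sq_nonneg (|fieldCoeff α i p * partialD i v p| - |fieldCoeff α i p * partialD i f p|)]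

lemma alphaGradSq_nonneg (f : Space n → ℝ) (p : Space n) : 0 ≤ alphaGradSq α f p := by
  rw [alphaGradSq_eq_sum]; positivity

/-! ### Derivatives of the gauge -/

/-- The differential of `gaugePow`. -/
def gaugePowDeriv (α : ℝ) (p : Space n) : Space n →L[ℝ] ℝ :=
  (α + 1) ^ 2 • ∑ i : Fin n, (2 * p i.castSucc) • (EuclideanSpace.proj i.castSucc : Space n →L[ℝ] ℝ)
    + (2 * (α + 1) * |zCoord p| ^ (2 * (α + 1) - 2) * zCoord p) •
      (EuclideanSpace.proj (Fin.last n) : Space n →L[ℝ] ℝ)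

lemma hasFDerivAt_gaugePow (hα : 0 ≤ α) (p : Space n) :
    HasFDerivAt (gaugePow α) (gaugePowDeriv α p) p := by
  have h1 (i : Fin (n + 1)) : HasFDerivAt (fun q : Space n => q i)
      (EuclideanSpace.proj i : Space n →L[ℝ] ℝ) p :=
    (EuclideanSpace.proj i : Space n →L[ℝ] ℝ).hasFDerivAt
  have h2 : HasFDerivAt (fun q : Space n => xNormSq q)
      (∑ i : Fin n, (2 * p i.castSucc) • (EuclideanSpace.proj i.castSucc : Space n →L[ℝ] ℝ)) p := by
    unfold xNormSq
    refine HasFDerivAt.fun_sum fun i _ => ?_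
    simpa using (h1 i.castSucc).pow 2
  have h3 : HasDerivAt (fun z : ℝ => |z| ^ (2 * (α + 1)))
      (2 * (α + 1) * |zCoord p| ^ (2 * (α + 1) - 2) * zCoord p) (zCoord p) := by
    rcases hα.eq_or_lt with rfl | h
    · have : (fun z : ℝ => |z| ^ (2 * ((0 : ℝ) + 1))) = fun z => z ^ 2 := by
        ext z; norm_num
      rw [this]
      simpa using hasDerivAt_pow 2 (zCoord p)
    · exact hasDerivAt_abs_rpow _ (by linarith)
  exact (h2.const_mul _).add (h3.comp_hasFDerivAt p (h1 (Fin.last n)))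

lemma hasFDerivAt_gauge (hα : 0 ≤ α) {p : Space n} (hp : zCoord p ≠ 0) :
    HasFDerivAt (gauge α) ((1 / (2 * (α + 1)) * gauge α p ^ (-(2 * α + 1))) • gaugePowDeriv α p)
      p := by
  have h0 : 0 < gaugePow α p := by
    rw [← gauge_rpow hα]; exact Real.rpow_pos_of_pos (gauge_pos_of_zCoord_ne_zero hα hp) _
  have h := (hasFDerivAt_gaugePow hα p).rpow_const (p := 1 / (2 * (α + 1))) (Or.inl h0.ne')
  have he : gaugePow α p ^ (1 / (2 * (α + 1)) - 1) = gauge α p ^ (-(2 * α + 1)) := by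
    rw [gauge_eq, ← Real.rpow_mul h0.le]
    congr 1
    field_simp
    ring
  rwa [he] at h

lemma gaugePowDeriv_last (p : Space n) :
    gaugePowDeriv α p (EuclideanSpace.single (Fin.last n) 1)
      = 2 * (α + 1) * |zCoord p| ^ (2 * α) * zCoord p := by
  have h : ∀ i : Fin n, i.castSucc ≠ Fin.last n := fun i => (Fin.castSucc_lt_last i).ne
  simp [gaugePowDeriv, h]
  left; left
  ring_nf

lemma gaugePowDeriv_castSucc (p : Space n) (j : Fin n) :
    gaugePowDeriv α p (EuclideanSpace.single j.castSucc 1) = 2 * (α + 1) ^ 2 * p j.castSucc := by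
  have h : Fin.last n ≠ j.castSucc := (Fin.castSucc_lt_last j).ne'
  simp [gaugePowDeriv, h]
  ring

lemma partialD_gauge_last (hα : 0 ≤ α) {p : Space n} (hp : zCoord p ≠ 0) :
    partialD (Fin.last n) (gauge α) p =
      gauge α p ^ (-(2 * α + 1)) * (|zCoord p| ^ (2 * α) * zCoord p) := by
  rw [partialD, (hasFDerivAt_gauge hα hp).fderiv, smul_apply,
    gaugePowDeriv_last, smul_eq_mul]
  field_simp

lemma partialD_gauge_castSucc (hα : 0 ≤ α) {p : Space n} (hp : zCoord p ≠ 0) (i : Fin n) :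
    partialD i.castSucc (gauge α) p =
      gauge α p ^ (-(2 * α + 1)) * ((α + 1) * p i.castSucc) := by
  rw [partialD, (hasFDerivAt_gauge hα hp).fderiv, smul_apply,
    gaugePowDeriv_castSucc, smul_eq_mul]
  field_simp

/-- Up to a common scalar factor, the squared coefficients of the fields turn the gradient of the
gauge into the generator of the dilations. This is why `Z_α` plays the part of the conormal
derivative on pseudo-spheres. -/
lemma fieldCoeff_sq_mul_partialD_gauge (hα : 0 ≤ α) {p : Space n} (hp : zCoord p ≠ 0)
    (i : Fin (n + 1)) :
    fieldCoeff α i p ^ 2 * partialD i (gauge α) p =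
      |zCoord p| ^ (2 * α) * gauge α p ^ (-(2 * α + 1)) * (weight α i * p i) := by
  refine Fin.lastCases ?_ (fun i => ?_) i
  · rw [partialD_gauge_last hα hp, fieldCoeff_last, weight_last, zCoord]; ring
  · rw [partialD_gauge_castSucc hα hp, fieldCoeff_castSucc, weight_castSucc, sq_abs_rpow]; ring

/-- The two contributions to `|∇_α ρ|²` share the factor `|z|^{2α}`, and what remains adds up to
`ρ^{2(α+1)}`. -/
lemma psi_eq (hα : 0 ≤ α) {p : Space n} (hp : zCoord p ≠ 0) :
    psi α p = |zCoord p| ^ (2 * α) * gauge α p ^ (-(2 * α)) := by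
  have hρ := gauge_pos_of_zCoord_ne_zero hα hp
  have hz : 0 < |zCoord p| := abs_pos.2 hp
  rw [psi, alphaGradSq]
  simp only [Dz, partialD_gauge_castSucc hα hp, partialD_gauge_last hα hp, mul_pow,
    ← Finset.mul_sum]
  have h1 : (α + 1) ^ 2 * ∑ i : Fin n, p i.castSucc ^ 2 =
      gauge α p ^ (2 * (α + 1)) - |zCoord p| ^ (2 * (α + 1)) := by
    rw [gauge_rpow hα, gaugePow, xNormSq]; ring
  have h2 : (gauge α p ^ (-(2 * α + 1))) ^ 2 = gauge α p ^ (-(2 * α)) *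
      gauge α p ^ (-(2 * (α + 1))) := by
    rw [← Real.rpow_natCast, ← Real.rpow_mul hρ.le, ← Real.rpow_add hρ]
    congr 1; push_cast; ring
  have h3 : |zCoord p| ^ (2 * (α + 1)) = |zCoord p| ^ (2 * α) * zCoord p ^ 2 := by
    rw [← sq_abs (zCoord p), ← Real.rpow_natCast |zCoord p| 2, ← Real.rpow_add hz]
    congr 1; push_cast; ring
  have h4 : gauge α p ^ (-(2 * (α + 1))) * gauge α p ^ (2 * (α + 1)) = 1 := by
    rw [← Real.rpow_add hρ]; simp
  rw [h1, h2, h3]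
  linear_combination |zCoord p| ^ (2 * α) * gauge α p ^ (-(2 * α)) * h4

lemma psi_pos (hα : 0 ≤ α) {p : Space n} (hp : zCoord p ≠ 0) : 0 < psi α p := by
  rw [psi_eq hα hp]
  exact mul_pos (Real.rpow_pos_of_pos (abs_pos.2 hp) _)
    (Real.rpow_pos_of_pos (gauge_pos_of_zCoord_ne_zero hα hp) _)

lemma psi_le_one (hα : 0 ≤ α) {p : Space n} (hp : zCoord p ≠ 0) : psi α p ≤ 1 := by
  have hρ := gauge_pos_of_zCoord_ne_zero hα hp
  rw [psi_eq hα hp, Real.rpow_neg hρ.le, ← div_eq_mul_inv, div_le_one (by positivity)]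
  exact Real.rpow_le_rpow (abs_nonneg _) (abs_zCoord_le_gauge hα p) (by positivity)

/-- Converts the radial term of an integration by parts into `Z_α v`, with the factor `ψ_α / ρ` that
polar coordinates absorb. -/
lemma gradPair_gauge (hα : 0 ≤ α) (v : Space n → ℝ) {p : Space n} (hp : zCoord p ≠ 0) :
    gradPair α v (gauge α) p = psi α p / gauge α p * Zfield α v p := by
  have hρ := gauge_pos_of_zCoord_ne_zero hα hp
  have h : gauge α p ^ (-(2 * α + 1)) = gauge α p ^ (-(2 * α)) / gauge α p := by
    rw [neg_add, Real.rpow_add hρ, Real.rpow_neg_one]; rfl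
  rw [gradPair, Zfield_eq_sum, Finset.mul_sum, psi_eq hα hp]
  refine Finset.sum_congr rfl fun i _ => ?_
  rw [mul_right_comm, fieldCoeff_sq_mul_partialD_gauge hα hp, h]
  ring

end

end BaouendiGrushin

namespace BaouendiGrushin

noncomputable section

variable {n : ℕ} {α : ℝ}

/-! ### The area formula for graphs -/

lemma euclideanHausdorffMeasure_image_le {X Y : Type*} [EMetricSpace X] [EMetricSpace Y]
    [MeasurableSpace X] [BorelSpace X] [MeasurableSpace Y] [BorelSpace Y] {K : NNReal}
    {f : X → Y} {s : Set X} (hf : LipschitzOnWith K f s) (d : ℕ) :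
    μHE[d] (f '' s) ≤ (K : ENNReal) ^ d * μHE[d] s := by
  have h := hf.hausdorffMeasure_image_le (d := d) (by positivity)
  rw [ENNReal.rpow_natCast] at h
  simp only [Measure.euclideanHausdorffMeasure_def, Measure.smul_apply, ENNReal.smul_def,
    smul_eq_mul]
  calc _ ≤ _ := mul_le_mul_right h _
    _ = _ := by ring

lemma norm_sq_eq_pt (p : Space n) : ‖p‖ ^ 2 = ‖horiz p‖ ^ 2 + zCoord p ^ 2 := by
  simp [EuclideanSpace.norm_sq_eq, Fin.sum_univ_castSucc, horiz, zCoord]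

/-- The linear map `x ↦ (x, ℓ x)`. -/
def graphLin (l : Horiz n →L[ℝ] ℝ) : Horiz n →ₗ[ℝ] Space n where
  toFun x := pt x (l x)
  map_add' x y := by
    ext i; refine Fin.lastCases ?_ (fun i => ?_) i <;> simp
  map_smul' c x := by
    ext i; refine Fin.lastCases ?_ (fun i => ?_) i <;> simp

lemma graphLin_apply (l : Horiz n →L[ℝ] ℝ) (x : Horiz n) : graphLin l x = pt x (l x) := rfl

lemma inner_pt (x y : Horiz n) (a b : ℝ) :
    inner ℝ (pt x a) (pt y b) = inner ℝ x y + a * b := by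
  simp [PiLp.inner_apply, Fin.sum_univ_castSucc, mul_comm]

/-- In an orthonormal frame of its range the map becomes an endomorphism `B` of `ℝⁿ`, and the
Hausdorff measure becomes Lebesgue measure scaled by `|det B|`. Since `⟨Bx, By⟩ = ⟨x, y⟩ + l x · l
y`, the Gram matrix is a rank-one perturbation of the identity with determinant `1 + ‖l‖²`. -/
lemma euclideanHausdorffMeasure_graphLin_image (l : Horiz n →L[ℝ] ℝ) (s : Set (Horiz n)) :
    μHE[n] (graphLin l '' s) = ENNReal.ofReal (√(1 + ‖l‖ ^ 2)) * volume s := by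
  set A := graphLin l with hA
  have hinj : Function.Injective A := fun x y hxy => by
    have := congrArg horiz hxy
    simpa [hA, graphLin_apply] using this
  set R := LinearMap.range A
  have hR : Module.finrank ℝ R = n := by
    rw [LinearMap.finrank_range_of_inj hinj]; simp
  let b : OrthonormalBasis (Fin n) ℝ R := (stdOrthonormalBasis ℝ R).reindex (finCongr hR)
  let B : Horiz n →ₗ[ℝ] Horiz n := b.repr.toLinearEquiv.toLinearMap ∘ₗ A.rangeRestrict
  have hB (x y : Horiz n) : inner ℝ (B x) (B y) = inner ℝ x y + l x * l y := by
    simp only [B, LinearMap.comp_apply]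
    have : inner ℝ (b.repr (A.rangeRestrict x)) (b.repr (A.rangeRestrict y))
        = inner ℝ (A x) (A y) := by
      rw [LinearIsometryEquiv.inner_map_map]; rfl
    refine this.trans ?_
    change inner ℝ (graphLin l x) (graphLin l y) = _
    rw [graphLin_apply, graphLin_apply, inner_pt]
  have himg : A '' s = (fun x : Horiz n => ((b.repr.symm x : R) : Space n)) '' (B '' s) := by
    rw [image_image]
    refine image_congr fun x _ => ?_
    simp [B]
  have hiso : Isometry (fun x : Horiz n => ((b.repr.symm x : R) : Space n)) :=
    isometry_subtype_coe.comp b.repr.symm.isometry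
  rw [himg, hiso.euclideanHausdorffMeasure_image, EuclideanSpace.euclideanHausdorffMeasure_eq_volume,
    Measure.addHaar_image_linearMap]
  congr 2
  rw [eq_comm, Real.sqrt_eq_iff_mul_self_eq (by positivity) (abs_nonneg _), abs_mul_abs_self]
  let e := EuclideanSpace.basisFun (Fin n) ℝ
  set M := LinearMap.toMatrix e.toBasis e.toBasis B
  have hM : LinearMap.det B = M.det := (LinearMap.det_toMatrix e.toBasis B).symm
  let a : Fin n → ℝ := fun i => l (e i)
  have hMM : M.transpose * M = 1 + Matrix.replicateCol Unit a * Matrix.replicateRow Unit a := by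
    ext i j
    have h1 : (M.transpose * M) i j = inner ℝ (B (e i)) (B (e j)) := by
      rw [Matrix.mul_apply, ← e.sum_inner_mul_inner]
      refine Finset.sum_congr rfl fun k _ => ?_
      simp only [M, Matrix.transpose_apply, LinearMap.toMatrix_apply,
        OrthonormalBasis.coe_toBasis, OrthonormalBasis.coe_toBasis_repr_apply,
        OrthonormalBasis.repr_apply_apply]
      rw [real_inner_comm]
    rw [h1, hB, orthonormal_iff_ite.1 e.orthonormal]
    simp [Matrix.add_apply, Matrix.mul_apply, Matrix.one_apply, a]
  have hdet := congrArg Matrix.det hMM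
  rw [Matrix.det_mul, Matrix.det_transpose, Matrix.det_one_add_replicateCol_mul_replicateRow]
    at hdet
  rw [hM, hdet]
  congr 1
  obtain ⟨v, rfl⟩ := (InnerProductSpace.toDual ℝ (Horiz n)).surjective l
  rw [LinearIsometryEquiv.norm_map, EuclideanSpace.norm_sq_eq]
  simp [dotProduct, a, e, sq, InnerProductSpace.toDual_apply_apply, PiLp.inner_apply]

/-- Countably many of the neighbourhoods cover `U`. Making them disjoint keeps the constant `c`,
since overlaps would otherwise be counted several times on the right. -/
lemma measure_le_mul_of_local {X : Type*} [TopologicalSpace X] [SecondCountableTopology X]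
    [MeasurableSpace X] [OpensMeasurableSpace X] {μ ν : Measure X} {c : ENNReal} {U : Set X}
    (h : ∀ x ∈ U, ∃ V ∈ 𝓝 x, ∀ s ⊆ V ∩ U, MeasurableSet s → μ s ≤ c * ν s)
    {s : Set X} (hsU : s ⊆ U) (hs : MeasurableSet s) : μ s ≤ c * ν s := by
  choose! V hV hVs using h
  have hcov : ∀ x ∈ U, interior (V x) ∈ 𝓝[U] x := fun x hx =>
    mem_nhdsWithin_of_mem_nhds (interior_mem_nhds.2 (hV x hx))
  obtain ⟨t, htU, htc, ht⟩ := TopologicalSpace.countable_cover_nhdsWithin hcov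
  rcases t.eq_empty_or_nonempty with rfl | hne
  · have : s = ∅ := subset_empty_iff.1 (by simpa using hsU.trans ht)
    simp [this]
  obtain ⟨x, rfl⟩ := htc.exists_eq_range hne
  let D := disjointed fun k => interior (V (x k))
  have hD : ∀ k, MeasurableSet (D k) := fun k =>
    MeasurableSet.disjointed (fun k => isOpen_interior.measurableSet) k
  have hsD : s = ⋃ k, s ∩ D k := by
    rw [← inter_iUnion, iUnion_disjointed, eq_comm, inter_eq_left]
    refine (hsU.trans ht).trans ?_
    simp
  have hdisj : Pairwise (Function.onFun Disjoint fun k => s ∩ D k) := fun i j hij =>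
    (disjoint_disjointed _ hij).mono inter_subset_right inter_subset_right
  calc μ s = μ (⋃ k, s ∩ D k) := by rw [← hsD]
    _ ≤ ∑' k, μ (s ∩ D k) := measure_iUnion_le _
    _ ≤ ∑' k, c * ν (s ∩ D k) := by
        refine ENNReal.tsum_le_tsum fun k => hVs (x k) (htU ⟨k, rfl⟩) _ ?_ (hs.inter (hD k))
        refine fun y hy => ⟨interior_subset (disjointed_subset _ k hy.2), hsU hy.1⟩
    _ = c * ν s := by
        rw [ENNReal.tsum_mul_left, ← measure_iUnion hdisj fun k => hs.inter (hD k), ← hsD]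

/-- The parametrization `x ↦ (x, g x)` of a graph. -/
def graphMap (g : Horiz n → ℝ) (x : Horiz n) : Space n := pt x (g x)

lemma pt_sub_pt (x y : Horiz n) (a b : ℝ) : pt x a - pt y b = pt (x - y) (a - b) := by
  ext i; refine Fin.lastCases ?_ (fun i => ?_) i <;> simp

lemma norm_pt_zero (a : ℝ) : ‖(pt 0 a : Space n)‖ = |a| := by
  rw [← sq_eq_sq₀ (norm_nonneg _) (abs_nonneg _), norm_sq_eq_pt]; simp

lemma norm_le_norm_pt (x : Horiz n) (a : ℝ) : ‖x‖ ≤ ‖(pt x a : Space n)‖ := by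
  rw [← sq_le_sq₀ (norm_nonneg _) (norm_nonneg _), norm_sq_eq_pt]; simp [sq_nonneg]

lemma norm_graphMap_sub {g : Horiz n → ℝ} {l : Horiz n →L[ℝ] ℝ} {V : Set (Horiz n)} {δ : NNReal}
    (h : ApproximatesLinearOn g l V δ) {x y : Horiz n} (hx : x ∈ V) (hy : y ∈ V) :
    ‖(graphMap g x - graphMap g y) - graphLin l (x - y)‖ ≤ δ * ‖graphLin l (x - y)‖ := by
  rw [graphMap, graphMap, graphLin_apply, pt_sub_pt, pt_sub_pt, sub_self, norm_pt_zero]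
  exact (h x hx y hy).trans (mul_le_mul_of_nonneg_left (norm_le_norm_pt _ _) δ.2)

lemma graphLin_sub (l : Horiz n →L[ℝ] ℝ) (x y : Horiz n) :
    graphLin l (x - y) = graphLin l x - graphLin l y := map_sub _ _ _

/-- The projection from the tangent plane to the graph is Lipschitz with constant `1 + δ`; the
weaker `1 + 2δ` is kept so that both directions share one constant. -/
lemma euclideanHausdorffMeasure_graphMap_image_le {g : Horiz n → ℝ} {l : Horiz n →L[ℝ] ℝ}
    {V : Set (Horiz n)} {δ : NNReal} (h : ApproximatesLinearOn g l V δ) :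
    μHE[n] (graphMap g '' V) ≤
      ((1 + 2 * δ : NNReal) : ENNReal) ^ n * μHE[n] (graphLin l '' V) := by
  have him : graphMap g '' V = (fun p => graphMap g (horiz p)) '' (graphLin l '' V) := by
    rw [image_image]; simp [graphLin_apply]
  rw [him]
  refine euclideanHausdorffMeasure_image_le (LipschitzOnWith.of_dist_le_mul ?_) n
  rintro _ ⟨x, hx, rfl⟩ _ ⟨y, hy, rfl⟩
  have h1 := norm_graphMap_sub h hx hy
  rw [graphLin_sub] at h1
  simp only [dist_eq_norm, graphLin_apply, horiz_pt] at h1 ⊢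
  have h2 := norm_le_norm_add_norm_sub' (graphMap g x - graphMap g y) (pt x (l x) - pt y (l y))
  push_cast
  have := δ.2
  nlinarith [norm_nonneg (pt x (l x) - pt y (l y)), NNReal.coe_nonneg δ,
    mul_nonneg (NNReal.coe_nonneg δ) (norm_nonneg (pt x (l x) - pt y (l y)))]

/-- The inverse projection is Lipschitz with constant `1 / (1 - δ)`, which is at most `1 + 2δ`
exactly because `δ ≤ 1 / 2`. -/
lemma euclideanHausdorffMeasure_graphLin_image_le {g : Horiz n → ℝ} {l : Horiz n →L[ℝ] ℝ}
    {V : Set (Horiz n)} {δ : NNReal} (hδ : δ ≤ 1 / 2) (h : ApproximatesLinearOn g l V δ) :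
    μHE[n] (graphLin l '' V) ≤
      ((1 + 2 * δ : NNReal) : ENNReal) ^ n * μHE[n] (graphMap g '' V) := by
  have him : graphLin l '' V = (fun p => graphLin l (horiz p)) '' (graphMap g '' V) := by
    rw [image_image]; simp [graphMap]
  rw [him]
  refine euclideanHausdorffMeasure_image_le (LipschitzOnWith.of_dist_le_mul ?_) n
  rintro _ ⟨x, hx, rfl⟩ _ ⟨y, hy, rfl⟩
  have h1 := norm_graphMap_sub h hx hy
  rw [graphLin_sub] at h1
  simp only [dist_eq_norm, graphMap, horiz_pt] at h1 ⊢
  have h2 := norm_le_norm_add_norm_sub (graphMap g x - graphMap g y) (graphLin l x - graphLin l y)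
  simp only [graphMap] at h2
  push_cast
  have hδ' : (δ : ℝ) ≤ 1 / 2 := by exact_mod_cast hδ
  have hδ0 := NNReal.coe_nonneg δ
  set a := ‖graphLin l x - graphLin l y‖
  set b := ‖pt x (g x) - pt y (g y)‖
  have ha : 0 ≤ a := norm_nonneg _
  have h3 : (1 - (δ : ℝ)) * a ≤ b := by linarith
  have h4 : (1 + 2 * (δ : ℝ)) * ((1 - (δ : ℝ)) * a) ≤ (1 + 2 * (δ : ℝ)) * b :=
    mul_le_mul_of_nonneg_left h3 (by positivity)
  have h5 : a ≤ (1 + 2 * (δ : ℝ)) * ((1 - (δ : ℝ)) * a) := by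
    have : 0 ≤ (δ : ℝ) * (1 - 2 * (δ : ℝ)) * a := by
      have : 0 ≤ 1 - 2 * (δ : ℝ) := by linarith
      positivity
    nlinarith
  linarith

lemma measurableEmbedding_graphMap {g : Horiz n → ℝ} (hg : Continuous g) :
    MeasurableEmbedding (graphMap g) := by
  have hc : Continuous (graphMap g) := continuous_pt.comp (continuous_id.prodMk hg)
  refine (Topology.IsClosedEmbedding.of_continuous_injective_isClosedMap hc ?_ ?_).measurableEmbedding
  · intro x y h
    simpa [graphMap] using congrArg horiz h
  · intro s hs
    have : graphMap g '' s = {p | horiz p ∈ s} ∩ {p | zCoord p = g (horiz p)} := by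
      ext p
      constructor
      · rintro ⟨x, hx, rfl⟩
        simpa [graphMap] using hx
      · rintro ⟨h1, h2⟩
        refine ⟨horiz p, h1, ?_⟩
        simp only [mem_ofPred_eq] at h2
        rw [graphMap, ← h2, pt_horiz_zCoord]
    rw [this]
    exact (hs.preimage continuous_horiz).inter
      (isClosed_eq continuous_zCoord (hg.comp continuous_horiz))

/-- The area element of a graph. -/
def graphJac (g : Horiz n → ℝ) (x : Horiz n) : ℝ := √(1 + ‖fderiv ℝ g x‖ ^ 2)

lemma one_le_graphJac (g : Horiz n → ℝ) (x : Horiz n) : 1 ≤ graphJac g x := by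
  rw [graphJac, Real.one_le_sqrt]; linarith [sq_nonneg ‖fderiv ℝ g x‖]

lemma measurable_graphJac (g : Horiz n → ℝ) : Measurable (graphJac g) := by
  unfold graphJac
  have := measurable_fderiv ℝ g
  fun_prop

/-- Of the `n + 1` factors, `n` come from the Lipschitz comparison with the tangent plane and one
from freezing the area element at `x₀`. -/
lemma exists_nhds_graph_comparison {g : Horiz n → ℝ} {U : Set (Horiz n)} (hU : IsOpen U)
    (hgU : ContDiffOn ℝ 1 g U) {δ : NNReal} (hδ0 : 0 < δ) (hδ : δ ≤ 1 / 2) {x₀ : Horiz n}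
    (hx₀ : x₀ ∈ U) :
    ∃ V ∈ 𝓝 x₀, ∀ s ⊆ V ∩ U, MeasurableSet s →
      μHE[n] (graphMap g '' s) ≤ ((1 + 2 * δ : NNReal) : ENNReal) ^ (n + 1) *
        volume.withDensity (fun x => ENNReal.ofReal (graphJac g x)) s ∧
      volume.withDensity (fun x => ENNReal.ofReal (graphJac g x)) s ≤
        ((1 + 2 * δ : NNReal) : ENNReal) ^ (n + 1) * μHE[n] (graphMap g '' s) := by
  have hcd : ContDiffAt ℝ 1 g x₀ := hgU.contDiffAt (hU.mem_nhds hx₀)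
  have hst : HasStrictFDerivAt g (fderiv ℝ g x₀) x₀ := hcd.hasStrictFDerivAt one_ne_zero
  obtain ⟨V₁, hV₁, hV₁a⟩ := hst.approximates_deriv_on_nhds (Or.inr hδ0)
  have hJc : ContinuousAt (graphJac g) x₀ := by
    have : ContinuousAt (fderiv ℝ g) x₀ := hcd.continuousAt_fderiv one_ne_zero
    unfold graphJac
    exact (continuousAt_const.add (this.norm.pow 2)).sqrt
  have hV₂ : {x | |graphJac g x - graphJac g x₀| < δ} ∈ 𝓝 x₀ := by
    have := Metric.continuousAt_iff'.1 hJc δ hδ0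
    filter_upwards [this] with x hx
    simpa [Real.dist_eq] using hx
  refine ⟨V₁ ∩ _, inter_mem hV₁ hV₂, fun s hs hsm => ?_⟩
  have hap : ApproximatesLinearOn g (fderiv ℝ g x₀) s δ :=
    hV₁a.mono_set fun x hx => (hs hx).1.1
  have hlin := euclideanHausdorffMeasure_graphLin_image (fderiv ℝ g x₀) s
  change _ = ENNReal.ofReal (graphJac g x₀) * volume s at hlin
  -- The area element is at least `1`, so an additive error `δ` is also a multiplicative one.
  have hclose (x) (hx : x ∈ s) : graphJac g x ≤ (1 + 2 * δ) * graphJac g x₀ ∧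
      graphJac g x₀ ≤ (1 + 2 * δ) * graphJac g x := by
    have h1 : |graphJac g x - graphJac g x₀| < δ := (hs hx).1.2
    have h2 := abs_lt.1 h1
    have h3 := one_le_graphJac g x
    have h4 := one_le_graphJac g x₀
    have h5 := NNReal.coe_nonneg δ
    constructor <;> nlinarith
  have hK : ENNReal.ofReal (1 + 2 * (δ : ℝ)) = ((1 + 2 * δ : NNReal) : ENNReal) := by
    rw [← ENNReal.ofReal_coe_nnreal]; push_cast; rfl
  rw [withDensity_apply _ hsm]
  constructor
  · refine (euclideanHausdorffMeasure_graphMap_image_le hap).trans ?_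
    rw [hlin, pow_succ, mul_assoc]
    refine mul_le_mul_right ?_ _
    rw [← setLIntegral_const, ← lintegral_const_mul' _ _ ENNReal.coe_ne_top]
    refine setLIntegral_mono' hsm fun x hx => ?_
    rw [← hK, ← ENNReal.ofReal_mul (by positivity)]
    exact ENNReal.ofReal_le_ofReal (hclose x hx).2
  · calc ∫⁻ x in s, ENNReal.ofReal (graphJac g x)
        ≤ ∫⁻ x in s, ((1 + 2 * δ : NNReal) : ENNReal) * ENNReal.ofReal (graphJac g x₀) := by
          refine setLIntegral_mono' hsm fun x hx => ?_
          rw [← hK, ← ENNReal.ofReal_mul (by positivity)]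
          exact ENNReal.ofReal_le_ofReal (hclose x hx).1
      _ = ((1 + 2 * δ : NNReal) : ENNReal) * μHE[n] (graphLin (fderiv ℝ g x₀) '' s) := by
          rw [setLIntegral_const, hlin, mul_assoc]
      _ ≤ ((1 + 2 * δ : NNReal) : ENNReal) * (((1 + 2 * δ : NNReal) : ENNReal) ^ n *
            μHE[n] (graphMap g '' s)) := by
          gcongr; exact euclideanHausdorffMeasure_graphLin_image_le hδ hap
      _ = _ := by rw [pow_succ]; ring

lemma le_of_forall_le_one_add_pow_mul {a b : ENNReal} {k : ℕ}
    (h : ∀ δ : NNReal, 0 < δ → δ ≤ 1 / 2 → a ≤ ((1 + 2 * δ : NNReal) : ENNReal) ^ k * b) :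
    a ≤ b := by
  have hlim : Tendsto (fun δ : NNReal => ((1 + 2 * δ : NNReal) : ENNReal) ^ k * b) (𝓝[>] 0)
      (𝓝 (((1 + 2 * (0 : NNReal) : NNReal) : ENNReal) ^ k * b)) := by
    refine ENNReal.Tendsto.mul_const ?_ (Or.inl ?_)
    · refine Tendsto.mono_left ?_ nhdsWithin_le_nhds
      refine Continuous.tendsto ?_ 0
      fun_prop
    · simp
  rw [mul_zero, add_zero, ENNReal.coe_one, one_pow, one_mul] at hlim
  refine ge_of_tendsto hlim ?_
  filter_upwards [Ioc_mem_nhdsGT (show (0 : NNReal) < 1 / 2 by norm_num)] with δ hδ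
  exact h δ hδ.1 hδ.2

/-- The area formula for the graph of a `C¹` function over an open set. -/
theorem euclideanHausdorffMeasure_graphMap_image {g : Horiz n → ℝ} (hg : Continuous g)
    {U : Set (Horiz n)} (hU : IsOpen U) (hgU : ContDiffOn ℝ 1 g U) {s : Set (Horiz n)}
    (hsU : s ⊆ U) (hs : MeasurableSet s) :
    μHE[n] (graphMap g '' s) = volume.withDensity (fun x => ENNReal.ofReal (graphJac g x)) s := by
  have hemb := measurableEmbedding_graphMap hg
  have hcom (t : Set (Horiz n)) : (Measure.comap (graphMap g) μHE[n]) t = μHE[n] (graphMap g '' t) :=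
    hemb.comap_apply _ _
  -- Pulling the Hausdorff measure back to the base makes both sides measures on `ℝⁿ`, so each
  -- inequality localizes with a factor that tends to `1` as `δ → 0`.
  rw [← hcom]
  refine le_antisymm ?_ ?_
  · refine le_of_forall_le_one_add_pow_mul (k := n + 1) fun δ h0 h1 => ?_
    refine measure_le_mul_of_local (U := U) (fun x hx => ?_) hsU hs
    obtain ⟨V, hV, h⟩ := exists_nhds_graph_comparison hU hgU h0 h1 hx
    exact ⟨V, hV, fun t ht htm => by rw [hcom]; exact (h t ht htm).1⟩
  · refine le_of_forall_le_one_add_pow_mul (k := n + 1) fun δ h0 h1 => ?_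
    refine measure_le_mul_of_local (U := U) (fun x hx => ?_) hsU hs
    obtain ⟨V, hV, h⟩ := exists_nhds_graph_comparison hU hgU h0 h1 hx
    exact ⟨V, hV, fun t ht htm => by rw [hcom]; exact (h t ht htm).2⟩

theorem setIntegral_graphMap_image {g : Horiz n → ℝ} (hg : Continuous g)
    {U : Set (Horiz n)} (hU : IsOpen U) (hgU : ContDiffOn ℝ 1 g U) (F : Space n → ℝ) :
    ∫ p in graphMap g '' U, F p ∂(μHE[n]) = ∫ x in U, graphJac g x * F (graphMap g x) := by
  have hemb := measurableEmbedding_graphMap hg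
  have hmeas : (μHE[n] : Measure (Space n)).restrict (graphMap g '' U) =
      Measure.map (graphMap g)
        ((volume.restrict U).withDensity fun x => ENNReal.ofReal (graphJac g x)) := by
    ext t ht
    rw [Measure.map_apply hemb.measurable ht, Measure.restrict_apply ht,
      ← restrict_withDensity hU.measurableSet,
      Measure.restrict_apply (hemb.measurable ht),
      ← euclideanHausdorffMeasure_graphMap_image hg hU hgU inter_subset_right
        ((hemb.measurable ht).inter hU.measurableSet), image_preimage_inter]
  rw [hmeas, hemb.integral_map,
    integral_withDensity_eq_integral_toReal_smul (measurable_graphJac g).ennreal_ofReal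
      (by simp)]
  refine integral_congr_ae (Eventually.of_forall fun x => ?_)
  simp only [smul_eq_mul]
  rw [ENNReal.toReal_ofReal (zero_le_one.trans (one_le_graphJac g x))]

end

end BaouendiGrushin

namespace BaouendiGrushin

noncomputable section

variable {n : ℕ} {α : ℝ}

/-! ### The pseudo-spheres as graphs -/

/-- The half pseudo-sphere of radius `r` is the graph of this function. -/
def prof (α r : ℝ) (x : Horiz n) : ℝ :=
  (r ^ (2 * (α + 1)) - (α + 1) ^ 2 * ‖x‖ ^ 2) ^ (1 / (2 * (α + 1)))

/-- The projection of the open half pseudo-sphere of radius `r`. -/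
def profDom (n : ℕ) (α r : ℝ) : Set (Horiz n) := {x | (α + 1) * ‖x‖ < r ^ (α + 1)}

lemma isOpen_profDom (r : ℝ) : IsOpen (profDom n α r) :=
  isOpen_lt (by fun_prop) continuous_const

lemma rpow_succ_sq {r : ℝ} (hr : 0 ≤ r) : (r ^ (α + 1)) ^ 2 = r ^ (2 * (α + 1)) := by
  rw [← Real.rpow_natCast, ← Real.rpow_mul hr, mul_comm]; norm_num

lemma prof_base_pos (hα : 0 ≤ α) {r : ℝ} (hr : 0 ≤ r) {x : Horiz n} (hx : x ∈ profDom n α r) :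
    0 < r ^ (2 * (α + 1)) - (α + 1) ^ 2 * ‖x‖ ^ 2 := by
  have h : ((α + 1) * ‖x‖) ^ 2 < (r ^ (α + 1)) ^ 2 :=
    pow_lt_pow_left₀ hx (by positivity) two_ne_zero
  rw [rpow_succ_sq hr, mul_pow] at h
  linarith

lemma prof_pos (hα : 0 ≤ α) {r : ℝ} (hr : 0 ≤ r) {x : Horiz n} (hx : x ∈ profDom n α r) :
    0 < prof α r x := Real.rpow_pos_of_pos (prof_base_pos hα hr hx) _

lemma prof_rpow (hα : 0 ≤ α) {r : ℝ} (hr : 0 ≤ r) {x : Horiz n} (hx : x ∈ profDom n α r) :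
    prof α r x ^ (2 * (α + 1)) = r ^ (2 * (α + 1)) - (α + 1) ^ 2 * ‖x‖ ^ 2 := by
  rw [prof, ← Real.rpow_mul (prof_base_pos hα hr hx).le, one_div_mul_cancel (by positivity),
    Real.rpow_one]

lemma gauge_pt_rpow (hα : 0 ≤ α) (x : Horiz n) (z : ℝ) :
    gauge α (pt x z) ^ (2 * (α + 1)) = (α + 1) ^ 2 * ‖x‖ ^ 2 + |z| ^ (2 * (α + 1)) := by
  rw [gauge_rpow hα, gaugePow]; simp

lemma gauge_prof (hα : 0 ≤ α) {r : ℝ} (hr : 0 ≤ r) {x : Horiz n} (hx : x ∈ profDom n α r) :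
    gauge α (pt x (prof α r x)) = r := by
  refine (Real.rpow_left_inj (gauge_nonneg _) hr (by positivity : 2 * (α + 1) ≠ 0)).1 ?_
  rw [gauge_pt_rpow hα, abs_of_pos (prof_pos hα hr hx), prof_rpow hα hr hx]
  ring

lemma mem_profDom_gauge (hα : 0 ≤ α) {x : Horiz n} {z : ℝ} (hz : 0 < z) :
    x ∈ profDom n α (gauge α (pt x z)) := by
  refine (pow_lt_pow_iff_left₀ (by positivity) (Real.rpow_nonneg (gauge_nonneg _) _)
    two_ne_zero).1 ?_
  rw [rpow_succ_sq (gauge_nonneg _), gauge_pt_rpow hα, mul_pow, abs_of_pos hz]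
  have := Real.rpow_pos_of_pos hz (2 * (α + 1))
  linarith

lemma prof_gauge (hα : 0 ≤ α) (x : Horiz n) {z : ℝ} (hz : 0 < z) :
    prof α (gauge α (pt x z)) x = z := by
  refine (Real.rpow_left_inj (prof_pos hα (gauge_nonneg _) (mem_profDom_gauge hα hz)).le hz.le
    (by positivity : 2 * (α + 1) ≠ 0)).1 ?_
  rw [prof_rpow hα (gauge_nonneg _) (mem_profDom_gauge hα hz), gauge_pt_rpow hα, abs_of_pos hz]
  ring

/-- Beyond the rim of `profDom` the base is negative and the value of `rpow` has no geometric
meaning, but it is still continuous. Global continuity is what makes `graphMap` a closed embedding.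
-/
lemma continuous_prof_uncurry (hα : 0 ≤ α) :
    Continuous fun q : ℝ × Horiz n => prof α q.1 q.2 := by
  unfold prof
  refine (Real.continuous_rpow_const (by positivity)).comp ?_
  have : Continuous fun q : ℝ × Horiz n => q.1 ^ (2 * (α + 1)) :=
    (Real.continuous_rpow_const (by positivity)).comp continuous_fst
  fun_prop

lemma continuous_prof (hα : 0 ≤ α) (r : ℝ) : Continuous (prof α r : Horiz n → ℝ) :=
  (continuous_prof_uncurry hα).comp (by fun_prop : Continuous fun x : Horiz n => (r, x))

lemma smul_mem_profDom {r : ℝ} (hr : 0 < r) {y : Horiz n} :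
    r ^ (α + 1) • y ∈ profDom n α r ↔ y ∈ profDom n α 1 := by
  have h : 0 < r ^ (α + 1) := Real.rpow_pos_of_pos hr _
  simp only [profDom, mem_ofPred_eq, norm_smul, Real.norm_eq_abs, abs_of_pos h, Real.one_rpow]
  rw [mul_left_comm, mul_lt_iff_lt_one_right h]

lemma prof_smul (hα : 0 ≤ α) {r : ℝ} (hr : 0 < r) {y : Horiz n} (hy : y ∈ profDom n α 1) :
    prof α r (r ^ (α + 1) • y) = r * prof α 1 y := by
  have hb := prof_base_pos hα zero_le_one hy
  have h : r ^ (2 * (α + 1)) - (α + 1) ^ 2 * ‖r ^ (α + 1) • y‖ ^ 2 =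
      r ^ (2 * (α + 1)) * (1 ^ (2 * (α + 1)) - (α + 1) ^ 2 * ‖y‖ ^ 2) := by
    rw [norm_smul, Real.norm_eq_abs, abs_of_pos (Real.rpow_pos_of_pos hr _), mul_pow,
      rpow_succ_sq hr.le, Real.one_rpow]
    ring
  rw [prof, h, Real.mul_rpow (by positivity) hb.le, ← Real.rpow_mul hr.le,
    mul_one_div_cancel (by positivity), Real.rpow_one, prof]

/-- The point of the upper unit pseudo-sphere over `y`. -/
def sphPt (α : ℝ) (y : Horiz n) : Space n := pt y (prof α 1 y)

lemma graphMap_prof_smul (hα : 0 ≤ α) {r : ℝ} (hr : 0 < r) {y : Horiz n}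
    (hy : y ∈ profDom n α 1) :
    graphMap (prof α r) (r ^ (α + 1) • y) = dil α r (sphPt α y) := by
  rw [graphMap, prof_smul hα hr hy, sphPt, dil_pt]

lemma continuous_sphPt (hα : 0 ≤ α) : Continuous (sphPt α : Horiz n → Space n) :=
  continuous_pt.comp (continuous_id.prodMk (continuous_prof hα 1))

lemma zCoord_sphPt_pos (hα : 0 ≤ α) {y : Horiz n} (hy : y ∈ profDom n α 1) :
    0 < zCoord (sphPt α y) := by
  simpa [sphPt] using prof_pos hα zero_le_one hy

lemma gauge_sphPt (hα : 0 ≤ α) {y : Horiz n} (hy : y ∈ profDom n α 1) :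
    gauge α (sphPt α y) = 1 := gauge_prof hα zero_le_one hy

lemma gauge_dil_sphPt (hα : 0 ≤ α) {l : ℝ} (hl : 0 ≤ l) {y : Horiz n} (hy : y ∈ profDom n α 1) :
    gauge α (dil α l (sphPt α y)) = l := by
  rw [gauge_dil hα hl, gauge_sphPt hα hy, mul_one]

lemma graphMap_prof_image (hα : 0 ≤ α) {r : ℝ} (hr : 0 ≤ r) :
    graphMap (prof α r) '' profDom n α r = {p | gauge α p = r ∧ 0 < zCoord p} := by
  ext p
  constructor
  · rintro ⟨x, hx, rfl⟩
    exact ⟨gauge_prof hα hr hx, by simpa [graphMap] using prof_pos hα hr hx⟩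
  · rintro ⟨rfl, hz⟩
    have h1 := mem_profDom_gauge hα (x := horiz p) hz
    have h2 := prof_gauge hα (horiz p) hz
    rw [pt_horiz_zCoord] at h1 h2
    exact ⟨horiz p, h1, by rw [graphMap, h2, pt_horiz_zCoord]⟩

lemma hasFDerivAt_prof (hα : 0 ≤ α) {r : ℝ} (hr : 0 ≤ r) {x : Horiz n} (hx : x ∈ profDom n α r) :
    HasFDerivAt (prof α r)
      ((-(α + 1) * prof α r x ^ (-(2 * α + 1))) • (innerSL ℝ x : Horiz n →L[ℝ] ℝ)) x := by
  have hb := prof_base_pos hα hr hx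
  have h1 : HasFDerivAt (fun y : Horiz n => r ^ (2 * (α + 1)) - (α + 1) ^ 2 * ‖y‖ ^ 2)
      (-((α + 1) ^ 2 • (2 • (innerSL ℝ x : Horiz n →L[ℝ] ℝ)))) x :=
    ((hasStrictFDerivAt_norm_sq x).hasFDerivAt.const_mul _).const_sub _
  have h2 := h1.rpow_const (p := 1 / (2 * (α + 1))) (Or.inl hb.ne')
  have h3 : (r ^ (2 * (α + 1)) - (α + 1) ^ 2 * ‖x‖ ^ 2) ^ (1 / (2 * (α + 1)) - 1) =
      prof α r x ^ (-(2 * α + 1)) := by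
    rw [prof, ← Real.rpow_mul hb.le]
    congr 1; field_simp; ring
  rw [h3] at h2
  refine h2.congr_fderiv ?_
  ext y
  simp only [smul_apply, neg_apply, smul_eq_mul, nsmul_eq_mul]
  push_cast
  field_simp

lemma contDiffOn_prof (hα : 0 ≤ α) {r : ℝ} (hr : 0 ≤ r) :
    ContDiffOn ℝ 1 (prof α r) (profDom n α r) := by
  unfold prof
  refine ContDiffOn.rpow_const_of_ne ?_ fun x hx => (prof_base_pos hα hr hx).ne'
  exact (contDiff_const.sub (contDiff_const.mul (contDiff_norm_sq ℝ))).contDiffOn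

lemma norm_gradient_sq (f : Space n → ℝ) (p : Space n) :
    ‖gradient f p‖ ^ 2 = ∑ i, partialD i f p ^ 2 := by
  rw [EuclideanSpace.norm_sq_eq]
  refine Finset.sum_congr rfl fun i _ => ?_
  have : inner ℝ (gradient f p) (EuclideanSpace.single i (1 : ℝ)) = partialD i f p := by
    rw [gradient, InnerProductSpace.toDual_symm_apply]; rfl
  rw [EuclideanSpace.inner_single_right] at this
  simp at this
  rw [Real.norm_eq_abs, sq_abs, this]

lemma norm_gradient_gauge_sq (hα : 0 ≤ α) {p : Space n} (hp : zCoord p ≠ 0) :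
    ‖gradient (gauge α) p‖ ^ 2 = (gauge α p ^ (-(2 * α + 1))) ^ 2 *
      ((α + 1) ^ 2 * ‖horiz p‖ ^ 2 + (|zCoord p| ^ (2 * α) * zCoord p) ^ 2) := by
  rw [norm_gradient_sq, Fin.sum_univ_castSucc, ← xNormSq_eq, xNormSq]
  simp only [partialD_gauge_castSucc hα hp, partialD_gauge_last hα hp, mul_pow, Finset.mul_sum]
  rw [mul_add, Finset.mul_sum]

/-- The Euclidean length of `∇ρ` contains the area element of the graph as a factor, so the two
cancel and the weighted surface measure has the explicit density `r / z`. -/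
lemma graphJac_prof_mul (hα : 0 ≤ α) {r : ℝ} (hr : 0 < r) {x : Horiz n}
    (hx : x ∈ profDom n α r) :
    graphJac (prof α r) x * (psi α (graphMap (prof α r) x) /
      ‖gradient (gauge α) (graphMap (prof α r) x)‖) = r / prof α r x := by
  set w := prof α r x with hw
  have hw0 : 0 < w := prof_pos hα hr.le hx
  have hz : zCoord (graphMap (prof α r) x) = w := by simp [graphMap, hw]
  have hh : horiz (graphMap (prof α r) x) = x := by simp [graphMap]
  have hg : gauge α (graphMap (prof α r) x) = r := gauge_prof hα hr.le hx
  have hz0 : zCoord (graphMap (prof α r) x) ≠ 0 := by rw [hz]; exact hw0.ne'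
  have hJ : graphJac (prof α r) x ^ 2 = 1 + (α + 1) ^ 2 * ‖x‖ ^ 2 * (w ^ (-(2 * α + 1))) ^ 2 := by
    rw [graphJac, Real.sq_sqrt (by positivity), (hasFDerivAt_prof hα hr.le hx).fderiv, norm_smul,
      innerSL_apply_norm, mul_pow, Real.norm_eq_abs, sq_abs]
    ring
  have hG := norm_gradient_gauge_sq hα hz0
  rw [hg, hz, hh, abs_of_pos hw0] at hG
  have hw1 : w ^ (2 * α) * w = w ^ (2 * α + 1) := by
    rw [Real.rpow_add hw0, Real.rpow_one]
  have hwi : w ^ (-(2 * α + 1)) * w ^ (2 * α + 1) = 1 := by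
    rw [← Real.rpow_add hw0]; simp
  have hG2 : ‖gradient (gauge α) (graphMap (prof α r) x)‖ =
      r ^ (-(2 * α + 1)) * w ^ (2 * α + 1) * graphJac (prof α r) x := by
    have hJ0 : 0 ≤ graphJac (prof α r) x := zero_le_one.trans (one_le_graphJac _ _)
    rw [← sq_eq_sq₀ (norm_nonneg _) (by positivity), hG, hw1, mul_pow, mul_pow, hJ]
    linear_combination (-(r ^ (-(2 * α + 1))) ^ 2 * (α + 1) ^ 2 * ‖x‖ ^ 2 *
      (w ^ (-(2 * α + 1)) * w ^ (2 * α + 1) + 1)) * hwi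
  have hJ1 : 0 < graphJac (prof α r) x := zero_lt_one.trans_le (one_le_graphJac _ _)
  rw [hG2, psi_eq hα hz0, hz, hg, abs_of_pos hw0]
  have hr1 : r ^ (-(2 * α)) = r ^ (-(2 * α + 1)) * r := by
    rw [← Real.rpow_add_one hr.ne']; ring_nf
  have hr2 : 0 < r ^ (-(2 * α + 1)) := Real.rpow_pos_of_pos hr _
  have hw2 : 0 < w ^ (2 * α) := Real.rpow_pos_of_pos hw0 _
  rw [hr1, ← hw1]
  field_simp

/-! ### Reflection -/

/-- The reflection in the plane `z = 0`. -/
def reflIso (n : ℕ) : Space n ≃ₗᵢ[ℝ] Space n where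
  toFun := reflectZ
  invFun := reflectZ
  map_add' p q := by ext i; by_cases h : i = Fin.last n <;> simp [reflectZ, h]; ring
  map_smul' c p := by ext i; by_cases h : i = Fin.last n <;> simp [reflectZ, h]
  left_inv p := by ext i; by_cases h : i = Fin.last n <;> simp [reflectZ, h]
  right_inv p := by ext i; by_cases h : i = Fin.last n <;> simp [reflectZ, h]
  norm_map' p := by
    simp only [LinearEquiv.coe_mk, LinearMap.coe_mk, AddHom.coe_mk, EuclideanSpace.norm_eq]
    congr 1
    refine Finset.sum_congr rfl fun i _ => ?_
    by_cases h : i = Fin.last n <;> simp [reflectZ, h]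

lemma reflIso_apply (p : Space n) : reflIso n p = reflectZ p := rfl

@[simp] lemma zCoord_reflectZ (p : Space n) : zCoord (reflectZ p) = -zCoord p := by
  simp [zCoord, reflectZ]

@[simp] lemma horiz_reflectZ (p : Space n) : horiz (reflectZ p) = horiz p := by
  ext i; simp [horiz, reflectZ]

@[simp] lemma gauge_reflectZ (p : Space n) : gauge α (reflectZ p) = gauge α p := by
  simp [gauge, xNormSq_eq]

lemma psi_reflectZ (hα : 0 ≤ α) {p : Space n} (hp : zCoord p ≠ 0) :
    psi α (reflectZ p) = psi α p := by
  rw [psi_eq hα hp, psi_eq hα (by simpa using hp)]; simp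

lemma norm_gradient_gauge_reflectZ (hα : 0 ≤ α) {p : Space n} (hp : zCoord p ≠ 0) :
    ‖gradient (gauge α) (reflectZ p)‖ = ‖gradient (gauge α) p‖ := by
  rw [← sq_eq_sq₀ (norm_nonneg _) (norm_nonneg _), norm_gradient_gauge_sq hα hp,
    norm_gradient_gauge_sq hα (by simpa using hp)]
  simp

lemma continuous_dil_param (hα : 0 ≤ α) :
    Continuous fun q : ℝ × Space n => dil α q.1 q.2 := by
  refine (PiLp.continuous_toLp 2 _).comp (continuous_pi fun i => ?_)
  have : 0 ≤ weight α i := by unfold weight; split_ifs <;> linarith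
  have h : Continuous fun q : ℝ × Space n => q.1 ^ weight α i :=
    (Real.continuous_rpow_const this).comp continuous_fst
  exact h.mul (by fun_prop)

lemma isOpen_pseudoBall (hα : 0 ≤ α) (r : ℝ) : IsOpen (pseudoBall n α r) :=
  isOpen_lt (continuous_gauge hα) continuous_const

lemma pseudoSphere_eq (hα : 0 ≤ α) {r : ℝ} (hr : 0 < r) :
    pseudoSphere n α r = {p | gauge α p = r} := by
  refine (frontier_lt_subset_eq (continuous_gauge hα) continuous_const).antisymm fun p hp => ?_
  have hp' : gauge α p = r := hp
  change p ∈ frontier (pseudoBall n α r)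
  rw [(isOpen_pseudoBall hα r).frontier_eq]
  refine ⟨?_, fun h => (lt_irrefl r (hp' ▸ h : r < r))⟩
  -- Shrinking dilations approach a point of the level set from inside the pseudo-ball.
  have h1 : Tendsto (fun l : ℝ => dil α l p) (𝓝[<] 1) (𝓝 p) := by
    have := ((continuous_dil_param hα).comp
      (by fun_prop : Continuous fun l : ℝ => (l, p))).tendsto 1
    simp only [Function.comp_def, dil_one] at this
    exact this.mono_left nhdsWithin_le_nhds
  refine mem_closure_of_tendsto h1 ?_
  filter_upwards [Ioo_mem_nhdsLT (show (0 : ℝ) < 1 by norm_num)] with l hl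
  change gauge α (dil α l p) < r
  rw [gauge_dil hα hl.1.le, hp']
  nlinarith [hl.2]

/-- The equator lies in the flat copy of a Euclidean sphere of `ℝⁿ`, which is Lebesgue null there.
The weight need not be understood at points with `z = 0`. -/
lemma euclideanHausdorffMeasure_equator (hα : 0 ≤ α) {r : ℝ} (hr : 0 < r) :
    μHE[n] {p : Space n | gauge α p = r ∧ zCoord p = 0} = 0 := by
  have hc : 0 < r ^ (α + 1) / (α + 1) := div_pos (Real.rpow_pos_of_pos hr _) (by positivity)
  have hsub : {p : Space n | gauge α p = r ∧ zCoord p = 0} ⊆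
      graphMap (fun _ => 0) '' Metric.sphere (0 : Horiz n) (r ^ (α + 1) / (α + 1)) := by
    rintro p ⟨hp, hz⟩
    refine ⟨horiz p, ?_, by rw [graphMap, ← hz, pt_horiz_zCoord]⟩
    have h := gauge_rpow_succ_sq hα p
    rw [hp, hz, abs_zero, Real.zero_rpow (by positivity), add_zero, ← mul_pow] at h
    have h2 := (pow_left_inj₀ (Real.rpow_nonneg hr.le _) (by positivity) two_ne_zero).1 h
    simp only [mem_sphere_iff_norm, sub_zero]
    rw [h2]; field_simp
  refine measure_mono_null hsub ?_
  rw [euclideanHausdorffMeasure_graphMap_image continuous_const isOpen_univ contDiffOn_const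
    (subset_univ _) Metric.isClosed_sphere.measurableSet]
  exact withDensity_absolutelyContinuous _ _ (Measure.addHaar_sphere_of_ne_zero _ _ hc.ne')

/-- The measure `ψ_α / |∇ρ_α| dH_n` on the upper unit pseudo-sphere, in the coordinates `x`. -/
def sphMeas (n : ℕ) (α : ℝ) : Measure (Horiz n) :=
  (volume.restrict (profDom n α 1)).withDensity fun y => ENNReal.ofReal (1 / prof α 1 y)

lemma measurable_prof (hα : 0 ≤ α) (r : ℝ) : Measurable (prof α r : Horiz n → ℝ) :=
  (continuous_prof hα r).measurable

lemma integral_sphMeas (hα : 0 ≤ α) (F : Horiz n → ℝ) :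
    ∫ y, F y ∂sphMeas n α = ∫ y in profDom n α 1, F y / prof α 1 y := by
  rw [sphMeas, integral_withDensity_eq_integral_toReal_smul
    (by have := measurable_prof (n := n) hα 1; fun_prop) (by simp)]
  refine setIntegral_congr_fun (isOpen_profDom 1).measurableSet fun y hy => ?_
  have := prof_pos hα zero_le_one hy
  simp only [smul_eq_mul]
  rw [ENNReal.toReal_ofReal (by positivity)]
  ring

/-- The substitution `x = r^{α+1} y` moves all radii to one domain. Its Jacobian is `r^{(α+1)n} =
r^{Q-1}`, and the density `r / prof α r` becomes `1 / prof α 1`, which does not depend on `r`. -/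
lemma setIntegral_upper_sphere (hα : 0 ≤ α) {r : ℝ} (hr : 0 < r) (F : Space n → ℝ) :
    ∫ p in {p | gauge α p = r ∧ 0 < zCoord p},
      F p * (psi α p / ‖gradient (gauge α) p‖) ∂(μHE[n]) =
      r ^ (homDim n α - 1) * ∫ y, F (dil α r (sphPt α y)) ∂sphMeas n α := by
  rw [← graphMap_prof_image hα hr.le, setIntegral_graphMap_image (continuous_prof hα r)
    (isOpen_profDom r) (contDiffOn_prof hα hr.le), integral_sphMeas hα]
  have hR : 0 < r ^ (α + 1) := Real.rpow_pos_of_pos hr _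
  rw [← integral_indicator (isOpen_profDom r).measurableSet,
    ← integral_indicator (isOpen_profDom 1).measurableSet]
  have hs := Measure.integral_comp_smul (volume : Measure (Horiz n)) ((profDom n α r).indicator
    fun x => graphJac (prof α r) x * (F (graphMap (prof α r) x) *
      (psi α (graphMap (prof α r) x) / ‖gradient (gauge α) (graphMap (prof α r) x)‖)))
      (r ^ (α + 1))
  have hQ : r ^ (homDim n α - 1) = (r ^ (α + 1)) ^ n := by
    rw [← Real.rpow_natCast, ← Real.rpow_mul hr.le, homDim]; congr 1; ring
  rw [finrank_euclideanSpace_fin, abs_of_pos (by positivity), smul_eq_mul] at hs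
  rw [hQ, ← inv_mul_eq_iff_eq_mul₀ (by positivity), ← hs]
  refine integral_congr_ae (Eventually.of_forall fun y => ?_)
  by_cases hy : y ∈ profDom n α 1
  · have hy' := (smul_mem_profDom (α := α) hr).2 hy
    have hw := prof_pos hα zero_le_one hy
    simp only [indicator_of_mem hy, indicator_of_mem hy']
    rw [mul_left_comm, graphJac_prof_mul hα hr hy', prof_smul hα hr hy,
      graphMap_prof_smul hα hr hy]
    field_simp
  · simp [indicator_of_notMem hy,
      indicator_of_notMem (fun h => hy ((smul_mem_profDom (α := α) hr).1 h))]

/-- Integration of an even function over a pseudo-sphere. -/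
theorem setIntegral_pseudoSphere (hα : 0 ≤ α) {r : ℝ} (hr : 0 < r) {F : Space n → ℝ}
    (hF : ∀ p, gauge α p = r → F (reflectZ p) = F p) :
    ∫ p in pseudoSphere n α r, F p * (psi α p / ‖gradient (gauge α) p‖) ∂(μHE[n]) =
      r ^ (homDim n α - 1) * (2 * ∫ y, F (dil α r (sphPt α y)) ∂sphMeas n α) := by
  set G : Space n → ℝ := fun p => F p * (psi α p / ‖gradient (gauge α) p‖) with hG
  set S : Set (Space n) := {p | gauge α p = r ∧ 0 < zCoord p} with hS
  have hρ : IsClosed {p : Space n | gauge α p = r} :=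
    isClosed_eq (continuous_gauge hα) continuous_const
  have hSm : MeasurableSet S :=
    hρ.measurableSet.inter (isOpen_lt continuous_const continuous_zCoord).measurableSet
  have hmp : MeasurePreserving (reflIso n) (μHE[n]) (μHE[n]) :=
    (reflIso n).toIsometryEquiv.measurePreserving_euclideanHausdorffMeasure n
  have hemb : MeasurableEmbedding (reflIso n) :=
    (reflIso n).toHomeomorph.measurableEmbedding
  set S' : Set (Space n) := reflIso n ⁻¹' S with hS'
  have hS'm : MeasurableSet S' := hemb.measurable hSm
  have hmem (p : Space n) : p ∈ S' ↔ gauge α p = r ∧ zCoord p < 0 := by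
    simp [hS', hS, reflIso_apply]
  have hGS (p : Space n) (hp : p ∈ S') : G (reflIso n p) = G p := by
    obtain ⟨h1, h2⟩ := (hmem p).1 hp
    simp only [hG, reflIso_apply]
    rw [hF p h1, psi_reflectZ hα h2.ne, norm_gradient_gauge_reflectZ hα h2.ne]
  have hae : pseudoSphere n α r =ᵐ[μHE[n]] (S ∪ S' : Set (Space n)) := by
    rw [pseudoSphere_eq hα hr]
    refine Filter.EventuallyLE.antisymm ?_ (LE.le.eventuallyLE ?_)
    · refine ae_le_set.2 (measure_mono_null ?_ (euclideanHausdorffMeasure_equator hα hr))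
      rintro p ⟨hp, hp'⟩
      refine ⟨hp, ?_⟩
      by_contra h
      rcases lt_or_gt_of_ne h with h | h
      · exact hp' (Or.inr ((hmem p).2 ⟨hp, h⟩))
      · exact hp' (Or.inl ⟨hp, h⟩)
    · rintro p (hp | hp)
      · exact hp.1
      · exact ((hmem p).1 hp).1
  have hlow : ∫ p in S', G p ∂(μHE[n]) = ∫ p in S, G p ∂(μHE[n]) := by
    rw [← hmp.setIntegral_preimage_emb hemb G S]
    exact setIntegral_congr_fun hS'm fun p hp => (hGS p hp).symm
  rw [setIntegral_congr_set hae]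
  have hup := setIntegral_upper_sphere hα hr F
  have hdisj : Disjoint S S' := Set.disjoint_left.2 fun p h1 h2 =>
    lt_asymm h1.2 ((hmem p).1 h2).2
  by_cases hi : IntegrableOn G S (μHE[n])
  · have hi' : IntegrableOn G S' (μHE[n]) := by
      refine (integrableOn_congr_fun (fun p hp => ?_) hS'm).1
        ((hmp.integrableOn_comp_preimage hemb).2 hi)
      exact hGS p hp
    rw [setIntegral_union hdisj hS'm hi hi', hlow, hup]
    ring
  -- Without integrability both Bochner integrals take the value zero, so no integrability
  -- hypothesis is needed.
  · have hi2 : ¬ IntegrableOn G (S ∪ S') (μHE[n]) := fun h => hi (h.mono_set subset_union_left)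
    rw [integral_undef hi] at hup
    rw [integral_undef hi2]
    linarith

end

end BaouendiGrushin

namespace BaouendiGrushin

noncomputable section

variable {n : ℕ} {α : ℝ}

/-! ### Polar coordinates -/

lemma measurePreserving_pt :
    MeasurePreserving (fun q : Horiz n × ℝ => pt q.1 q.2) (volume.prod volume) volume := by
  have h1 := (volume_preserving_piFinSuccAbove (fun _ : Fin (n + 1) => ℝ) (Fin.last n)).symm
  have h2 : MeasurePreserving (fun q : Horiz n × ℝ => (q.2, WithLp.ofLp q.1))
      (volume.prod volume) (volume.prod volume) :=
    Measure.measurePreserving_swap.comp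
      ((PiLp.volume_preserving_ofLp (Fin n)).prod (MeasurePreserving.id volume))
  have h3 := (PiLp.volume_preserving_toLp (Fin (n + 1))).comp (h1.comp h2)
  have he : (fun q : Horiz n × ℝ => pt q.1 q.2) = WithLp.toLp 2 ∘
      (MeasurableEquiv.piFinSuccAbove (fun _ : Fin (n + 1) => ℝ) (Fin.last n)).symm ∘
        fun q => (q.2, WithLp.ofLp q.1) := by
    funext q
    simp [pt, MeasurableEquiv.piFinSuccAbove, Fin.snocEquiv]
  rw [he]
  exact h3

lemma measurable_psi : Measurable (psi α : Space n → ℝ) := by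
  unfold psi alphaGradSq Dz partialD
  have h (v : Space n) : Measurable fun p : Space n => fderiv ℝ (gauge α) p v :=
    measurable_fderiv_apply_const ℝ _ v
  have hz : Measurable (zCoord : Space n → ℝ) := continuous_zCoord.measurable
  refine Measurable.add (Measurable.mul (by fun_prop) ?_) ((h _).pow_const 2)
  exact Finset.measurable_sum _ fun i _ => (h _).pow_const 2

/-- For fixed `x`, the map `t ↦ z` onto the half-line over `x`, where `e^t` is the gauge. -/
lemma hasDerivAt_prof_exp (hα : 0 ≤ α) {x : Horiz n} {t : ℝ}
    (hx : x ∈ profDom n α (Real.exp t)) :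
    HasDerivAt (fun s => prof α (Real.exp s) x)
      (Real.exp t ^ (2 * (α + 1)) * prof α (Real.exp t) x ^ (-(2 * α + 1))) t := by
  have hb := prof_base_pos hα (Real.exp_pos t).le hx
  have h1 : HasDerivAt (fun s => Real.exp s ^ (2 * (α + 1)) - (α + 1) ^ 2 * ‖x‖ ^ 2)
      (Real.exp t * (2 * (α + 1)) * Real.exp t ^ (2 * (α + 1) - 1)) t :=
    ((Real.hasDerivAt_exp t).rpow_const (Or.inl (Real.exp_pos t).ne')).sub_const _
  have h2 := h1.rpow_const (p := 1 / (2 * (α + 1))) (Or.inl hb.ne')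
  have h3 : (Real.exp t ^ (2 * (α + 1)) - (α + 1) ^ 2 * ‖x‖ ^ 2) ^ (1 / (2 * (α + 1)) - 1) =
      prof α (Real.exp t) x ^ (-(2 * α + 1)) := by
    rw [prof, ← Real.rpow_mul hb.le]
    congr 1; field_simp; ring
  rw [h3] at h2
  refine h2.congr_deriv ?_
  have h4 : Real.exp t * Real.exp t ^ (2 * (α + 1) - 1) = Real.exp t ^ (2 * (α + 1)) := by
    rw [mul_comm, ← Real.rpow_add_one (Real.exp_pos t).ne']; ring_nf
  rw [← h4]
  field_simp

/-- For fixed `x` the gauge is strictly increasing in `z > 0`, so polar coordinates need only a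
one-variable substitution on each vertical line, followed by Fubini. -/
lemma lintegral_Ioi_eq_lintegral_prof (hα : 0 ≤ α) (x : Horiz n) (G : ℝ → ENNReal) :
    ∫⁻ z in Ioi 0, G z = ∫⁻ t in {t | x ∈ profDom n α (Real.exp t)},
      ENNReal.ofReal (Real.exp t ^ (2 * (α + 1)) * prof α (Real.exp t) x ^ (-(2 * α + 1))) *
        G (prof α (Real.exp t) x) := by
  have himg : (fun t => prof α (Real.exp t) x) '' {t | x ∈ profDom n α (Real.exp t)} = Ioi 0 := by
    ext z
    constructor
    · rintro ⟨t, ht, rfl⟩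
      exact prof_pos hα (Real.exp_pos t).le ht
    · intro hz
      have hz' : 0 < z := hz
      have hg : 0 < gauge α (pt x z) := gauge_pos_of_zCoord_ne_zero hα (by simpa using hz'.ne')
      refine ⟨Real.log (gauge α (pt x z)), ?_, ?_⟩
      · simp only [mem_ofPred_eq, Real.exp_log hg]; exact mem_profDom_gauge hα hz'
      · simp only [Real.exp_log hg]; exact prof_gauge hα x hz'
  have hm : MeasurableSet {t | x ∈ profDom n α (Real.exp t)} := by
    have : Continuous fun t : ℝ => Real.exp t ^ (α + 1) :=
      (Real.continuous_rpow_const (by positivity)).comp Real.continuous_exp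
    exact (isOpen_lt continuous_const this).measurableSet
  rw [← himg, lintegral_image_eq_lintegral_abs_deriv_mul hm
    (fun t ht => (hasDerivAt_prof_exp hα ht).hasDerivWithinAt) ?_]
  · refine setLIntegral_congr_fun hm fun t ht => ?_
    have h := prof_pos hα (Real.exp_pos t).le ht
    rw [abs_of_pos (by positivity)]
  · intro s hs t ht hst
    have h1 := gauge_prof hα (Real.exp_pos s).le hs
    have h2 := gauge_prof hα (Real.exp_pos t).le ht
    simp only at hst
    rw [hst, h2] at h1
    exact (Real.exp_injective h1).symm

lemma psi_dil (hα : 0 ≤ α) {l : ℝ} (hl : 0 < l) {p : Space n} (hp : zCoord p ≠ 0) :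
    psi α (dil α l p) = psi α p := by
  have hz : zCoord (dil α l p) ≠ 0 := by rw [zCoord_dil]; exact mul_ne_zero hl.ne' hp
  have hρ := gauge_pos_of_zCoord_ne_zero hα hp
  rw [psi_eq hα hp, psi_eq hα hz, zCoord_dil, gauge_dil hα hl.le, abs_mul, abs_of_pos hl,
    Real.mul_rpow hl.le (abs_nonneg _), Real.mul_rpow hl.le hρ.le, Real.rpow_neg hl.le]
  have := Real.rpow_pos_of_pos hl (2 * α)
  field_simp

lemma psi_sphPt (hα : 0 ≤ α) {y : Horiz n} (hy : y ∈ profDom n α 1) :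
    psi α (sphPt α y) = prof α 1 y ^ (2 * α) := by
  have h := zCoord_sphPt_pos hα hy
  rw [psi_eq hα h.ne', gauge_sphPt hα hy, Real.one_rpow, mul_one, abs_of_pos h, sphPt, zCoord_pt]

/-- After the order of integration is exchanged, `x` is rescaled at fixed `t`. The power of `e^t` is
`(α+1)n + 2(α+1) - (2α+1) = Q`. -/
lemma lintegral_upper_eq (hα : 0 ≤ α) {F : Space n → ENNReal} (hF : Measurable F) :
    ∫⁻ p in {p | 0 < zCoord p}, F p = ∫⁻ t : ℝ, ∫⁻ y in profDom n α 1,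
      ENNReal.ofReal (Real.exp (homDim n α * t) * prof α 1 y ^ (-(2 * α + 1))) *
        F (dil α (Real.exp t) (sphPt α y)) := by
  have hU : MeasurableSet {p : Space n | 0 < zCoord p} :=
    (isOpen_lt continuous_const continuous_zCoord).measurableSet
  have hFm : Measurable fun q : Horiz n × ℝ => F (pt q.1 q.2) :=
    hF.comp continuous_pt.measurable
  set D : Set (Horiz n × ℝ) := {q | q.1 ∈ profDom n α (Real.exp q.2)} with hD
  have hexp : Continuous fun t : ℝ => Real.exp t ^ (α + 1) :=
    (Real.continuous_rpow_const (by positivity)).comp Real.continuous_exp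
  have hDm : MeasurableSet D :=
    (isOpen_lt (by fun_prop) (hexp.comp continuous_snd)).measurableSet
  have hprof : Measurable fun q : Horiz n × ℝ => prof α (Real.exp q.2) q.1 :=
    ((continuous_prof_uncurry hα).comp
      (by fun_prop : Continuous fun q : Horiz n × ℝ => (Real.exp q.2, q.1))).measurable
  set K : Horiz n × ℝ → ENNReal := D.indicator fun q =>
    ENNReal.ofReal (Real.exp q.2 ^ (2 * (α + 1)) * prof α (Real.exp q.2) q.1 ^ (-(2 * α + 1))) *
        F (pt q.1 (prof α (Real.exp q.2) q.1)) with hK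
  have hKm : Measurable K := by
    refine Measurable.indicator ?_ hDm
    refine Measurable.mul (by fun_prop) (hFm.comp (measurable_fst.prodMk hprof))
  calc ∫⁻ p in {p | 0 < zCoord p}, F p
      = ∫⁻ q : Horiz n × ℝ in univ ×ˢ Ioi 0, F (pt q.1 q.2) ∂(volume.prod volume) := by
        rw [← measurePreserving_pt.setLIntegral_comp_preimage hU hF]
        congr 2
        ext q; simp
    _ = ∫⁻ x : Horiz n, ∫⁻ z in Ioi 0, F (pt x z) := by
        rw [← Measure.prod_restrict, lintegral_prod _ hFm.aemeasurable, Measure.restrict_univ]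
    _ = ∫⁻ x : Horiz n, ∫⁻ t : ℝ, K (x, t) := by
        refine lintegral_congr fun x => ?_
        rw [lintegral_Ioi_eq_lintegral_prof hα x, ← lintegral_indicator]
        · rfl
        · exact (measurable_prodMk_left hDm : MeasurableSet {t | (x, t) ∈ D})
    _ = ∫⁻ t : ℝ, ∫⁻ x : Horiz n, K (x, t) :=
        lintegral_lintegral_swap hKm.aemeasurable
    _ = _ := by
        refine lintegral_congr fun t => ?_
        set r := Real.exp t with hr
        have hr0 : 0 < r := Real.exp_pos t
        have hR : 0 < r ^ (α + 1) := Real.rpow_pos_of_pos hr0 _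
        have hmap := Measure.map_addHaar_smul (volume : Measure (Horiz n)) hR.ne'
        have hKt : Measurable fun x => K (x, t) := hKm.comp measurable_prodMk_right
        have h1 : ∫⁻ y : Horiz n, K (r ^ (α + 1) • y, t) =
            ENNReal.ofReal (((r ^ (α + 1)) ^ n)⁻¹) * ∫⁻ x : Horiz n, K (x, t) := by
          rw [← lintegral_map hKt (measurable_const_smul (r ^ (α + 1))), hmap,
            lintegral_smul_measure, finrank_euclideanSpace_fin, abs_of_pos (by positivity),
            smul_eq_mul]
        have h2 : ∫⁻ x : Horiz n, K (x, t) = ENNReal.ofReal ((r ^ (α + 1)) ^ n) *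
            ∫⁻ y : Horiz n, K (r ^ (α + 1) • y, t) := by
          rw [h1, ← mul_assoc, ← ENNReal.ofReal_mul (by positivity),
            mul_inv_cancel₀ (by positivity), ENNReal.ofReal_one, one_mul]
        rw [h2, ← lintegral_const_mul' _ _ ENNReal.ofReal_ne_top, ← lintegral_indicator (isOpen_profDom 1).measurableSet]
        refine lintegral_congr fun y => ?_
        by_cases hy : y ∈ profDom n α 1
        · have hy' := (smul_mem_profDom (α := α) hr0).2 hy
          have hw := prof_pos hα zero_le_one hy
          have hmem : (r ^ (α + 1) • y, t) ∈ D := hy'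
          simp only [hK, indicator_of_mem hmem, indicator_of_mem hy]
          rw [← hr, prof_smul hα hr0 hy, ← dil_pt, ← mul_assoc,
            ← ENNReal.ofReal_mul (by positivity), sphPt]
          congr 2
          have e1 : (r ^ (α + 1)) ^ n = Real.exp ((α + 1) * n * t) := by
            rw [← Real.rpow_natCast, ← Real.rpow_mul hr0.le, hr, ← Real.exp_mul]
            congr 1; ring
          rw [e1, Real.mul_rpow hr0.le hw.le, ← mul_assoc, ← mul_assoc, mul_assoc (Real.exp _),
            ← Real.rpow_add hr0, hr, ← Real.exp_mul, ← Real.exp_add, homDim]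
          congr 2; ring
        · have hmem : (r ^ (α + 1) • y, t) ∉ D :=
            fun h => hy ((smul_mem_profDom (α := α) hr0).1 h)
          simp [hK, indicator_of_notMem hmem, indicator_of_notMem hy]

/-- The polar coordinate map `(y, t) ↦ δ_{e^t} Θ(y)`. -/
def polar (α : ℝ) (q : Horiz n × ℝ) : Space n := dil α (Real.exp q.2) (sphPt α q.1)

lemma continuous_polar (hα : 0 ≤ α) : Continuous (polar α : Horiz n × ℝ → Space n) :=
  (continuous_dil_param hα).comp
    ((Real.continuous_exp.comp continuous_snd).prodMk ((continuous_sphPt hα).comp continuous_fst))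

lemma lintegral_sphMeas (hα : 0 ≤ α) {F : Horiz n → ENNReal} (hF : Measurable F) :
    ∫⁻ y, F y ∂sphMeas n α =
      ∫⁻ y in profDom n α 1, ENNReal.ofReal (1 / prof α 1 y) * F y := by
  have := measurable_prof (n := n) hα 1
  rw [sphMeas, lintegral_withDensity_eq_lintegral_mul _ (by fun_prop) hF]
  rfl

instance : SFinite (sphMeas n α) := by unfold sphMeas; infer_instance

/-- The measure `e^{Qt} dt`. -/
def radMeas (n : ℕ) (α : ℝ) : Measure ℝ :=
  volume.withDensity fun t => ENNReal.ofReal (Real.exp (homDim n α * t))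

instance : SFinite (radMeas n α) := by unfold radMeas; infer_instance

/-- On the unit sphere `ψ_α` is `prof^{2α}`. It reduces the density `prof^{-(2α+1)}` to the density
`prof^{-1}` of `sphMeas`, and it is constant along the rays. -/
theorem lintegral_upper_psi (hα : 0 ≤ α) {F : Space n → ENNReal} (hF : Measurable F) :
    ∫⁻ p in {p | 0 < zCoord p}, ENNReal.ofReal (psi α p) * F p =
      ∫⁻ t, ∫⁻ y, F (polar α (y, t)) ∂sphMeas n α ∂radMeas n α := by
  rw [lintegral_upper_eq hα (by have := measurable_psi (n := n) (α := α); fun_prop)]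
  have hFp : Measurable fun q : Horiz n × ℝ => F (polar α q) :=
    hF.comp (continuous_polar hα).measurable
  rw [radMeas, lintegral_withDensity_eq_lintegral_mul _ (by fun_prop)
    (Measurable.lintegral_prod_left' hFp)]
  refine lintegral_congr fun t => ?_
  have hFt : Measurable fun y : Horiz n => F (polar α (y, t)) := hFp.comp measurable_prodMk_right
  rw [Pi.mul_apply, lintegral_sphMeas hα hFt, ← lintegral_const_mul' _ _ ENNReal.ofReal_ne_top]
  refine setLIntegral_congr_fun (isOpen_profDom 1).measurableSet fun y hy => ?_
  have hw := prof_pos hα zero_le_one hy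
  simp only [polar]
  rw [psi_dil hα (Real.exp_pos t) (zCoord_sphPt_pos hα hy).ne', psi_sphPt hα hy, ← mul_assoc,
    ← mul_assoc, ← ENNReal.ofReal_mul (by positivity), ← ENNReal.ofReal_mul (by positivity)]
  congr 2
  rw [mul_assoc, ← Real.rpow_add hw, one_div, ← Real.rpow_neg_one]
  congr 2; ring

theorem map_polar (hα : 0 ≤ α) :
    Measure.map (polar α) ((sphMeas n α).prod (radMeas n α)) =
      (volume.restrict {p : Space n | 0 < zCoord p}).withDensity
        fun p => ENNReal.ofReal (psi α p) := by
  have hm := (continuous_polar (n := n) hα).measurable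
  ext s hs
  have hind : Measurable (s.indicator (1 : Space n → ENNReal)) := measurable_one.indicator hs
  have h := lintegral_upper_psi hα hind
  rw [withDensity_apply _ hs, Measure.map_apply hm hs, ← lintegral_indicator hs,
    ← lintegral_indicator_one (hm hs), lintegral_prod_symm _ (by
      exact (measurable_one.indicator (hm hs)).aemeasurable)]
  refine Eq.trans ?_ (h.symm.trans ?_)
  · rfl
  · refine lintegral_congr fun p => ?_
    by_cases hp : p ∈ s <;> simp [hp]

/-- Polar coordinates for the Bochner integral. -/
theorem setIntegral_upper_polar (hα : 0 ≤ α) {F : Space n → ℝ}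
    (hF : IntegrableOn (fun p => psi α p * F p) {p | 0 < zCoord p})
    (hFm : AEStronglyMeasurable F (volume.restrict {p | 0 < zCoord p})) :
    Integrable (fun q => F (polar α q)) ((sphMeas n α).prod (radMeas n α)) ∧
    ∫ p in {p | 0 < zCoord p}, psi α p * F p =
      ∫ q, F (polar α q) ∂((sphMeas n α).prod (radMeas n α)) := by
  have hU : MeasurableSet {p : Space n | 0 < zCoord p} :=
    (isOpen_lt continuous_const continuous_zCoord).measurableSet
  have hpsi := measurable_psi (n := n) (α := α)
  have hpm : Measurable fun p : Space n => ENNReal.ofReal (psi α p) := hpsi.ennreal_ofReal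
  have hac := withDensity_absolutelyContinuous (volume.restrict {p : Space n | 0 < zCoord p})
    (fun p => ENNReal.ofReal (psi α p))
  have hF2 : AEStronglyMeasurable F
      (Measure.map (polar α) ((sphMeas n α).prod (radMeas n α))) := by
    rw [map_polar hα]; exact hFm.mono_ac hac
  have hm := (continuous_polar (n := n) hα).measurable.aemeasurable
    (μ := (sphMeas n α).prod (radMeas n α))
  have hsm : (fun p : Space n => (ENNReal.ofReal (psi α p)).toReal • F p) =ᵐ[
      volume.restrict {p | 0 < zCoord p}] fun p => psi α p * F p := by
    filter_upwards [ae_restrict_mem hU] with p hp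
    have hp' : 0 < zCoord p := hp
    rw [ENNReal.toReal_ofReal (psi_pos hα hp'.ne').le, smul_eq_mul]
  constructor
  · refine (integrable_map_measure hF2 hm).1 ?_
    rw [map_polar hα, integrable_withDensity_iff_integrable_smul' hpm (by simp)]
    exact hF.congr hsm.symm
  · rw [← integral_map hm hF2, map_polar hα,
      integral_withDensity_eq_integral_toReal_smul hpm (by simp)]
    exact (integral_congr_ae hsm).symm

/-- The density blows up at the rim, but infinite mass would give the unit half-ball infinite
`ψ_α`-weighted volume by polar coordinates, while `ψ_α ≤ 1` and the closed ball is compact. -/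
theorem isFiniteMeasure_sphMeas (hα : 0 ≤ α) : IsFiniteMeasure (sphMeas n α) := by
  refine ⟨lt_of_not_ge fun htop => ?_⟩
  rw [top_le_iff] at htop
  have hB : MeasurableSet {p : Space n | gauge α p ≤ 1} :=
    (isCompact_gauge_le hα 1).measurableSet
  have h := lintegral_upper_psi hα (measurable_one.indicator hB)
  have h1 : ∫⁻ p in {p : Space n | 0 < zCoord p}, ENNReal.ofReal (psi α p) *
      {p : Space n | gauge α p ≤ 1}.indicator 1 p ≤ volume {p : Space n | gauge α p ≤ 1} := by
    rw [← lintegral_indicator_one hB]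
    refine (setLIntegral_mono' (isOpen_lt continuous_const continuous_zCoord).measurableSet
      fun p hp => ?_).trans (setLIntegral_le_lintegral _ _)
    have hp' : 0 < zCoord p := hp
    exact mul_le_of_le_one_left' (ENNReal.ofReal_le_one.2 (psi_le_one hα hp'.ne'))
  have h2 : ∫⁻ t in Iic (0 : ℝ), ∫⁻ _ : Horiz n, 1 ∂sphMeas n α ∂radMeas n α ≤
      ∫⁻ t, ∫⁻ y, {p : Space n | gauge α p ≤ 1}.indicator 1 (polar α (y, t))
        ∂sphMeas n α ∂radMeas n α := by
    rw [← lintegral_indicator measurableSet_Iic]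
    refine lintegral_mono fun t => ?_
    by_cases ht : t ≤ 0
    · rw [indicator_of_mem (by exact ht)]
      refine lintegral_mono_ae ?_
      have : ∀ᵐ y ∂sphMeas n α, y ∈ profDom n α 1 :=
        (withDensity_absolutelyContinuous _ _).ae_le
          (ae_restrict_mem (isOpen_profDom 1).measurableSet)
      filter_upwards [this] with y hy
      rw [indicator_of_mem]
      · rfl
      · change gauge α (polar α (y, t)) ≤ 1
        rw [polar, gauge_dil_sphPt hα (Real.exp_pos t).le hy]
        exact Real.exp_le_one_iff.2 ht
    · rw [indicator_of_notMem (by exact ht)]; exact zero_le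
  rw [← h] at h2
  have h3 := (h2.trans h1).trans_lt (isCompact_gauge_le (n := n) hα 1).measure_lt_top
  simp only [lintegral_const, one_mul, htop, Measure.restrict_apply MeasurableSet.univ,
    univ_inter] at h3
  have h4 : radMeas n α (Iic 0) ≠ 0 := by
    intro h0
    rw [radMeas, withDensity_apply _ measurableSet_Iic, lintegral_eq_zero_iff (by fun_prop)] at h0
    have h5 : ∀ᵐ t : ℝ ∂volume.restrict (Iic 0), False := by
      filter_upwards [h0] with t ht
      have := Real.exp_pos (homDim n α * t)
      simp at ht
      linarith
    rw [ae_iff] at h5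
    simp at h5
  rw [ENNReal.top_mul h4] at h3
  exact lt_irrefl _ h3

end

end BaouendiGrushin

namespace BaouendiGrushin

noncomputable section

variable {n : ℕ} {α : ℝ}

/-! ### Functions on the upper half of a pseudo-ball -/

/-- The upper half of the pseudo-ball. -/
def upBall (n : ℕ) (α R : ℝ) : Set (Space n) := {p | gauge α p < R ∧ 0 < zCoord p}

/-- The upper half of the pseudo-ball together with the thin ball. -/
def upBallClosed (n : ℕ) (α R : ℝ) : Set (Space n) := {p | gauge α p < R ∧ 0 ≤ zCoord p}

/-- Functions of finite energy, `C¹` in the upper half-ball and continuous up to the thin ball. -/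
structure HalfRegular (α R : ℝ) (f : Space n → ℝ) : Prop where
  cont : ContinuousOn f (upBallClosed n α R)
  diff : ∀ p ∈ upBall n α R, DifferentiableAt ℝ f p
  contD : ∀ i, ContinuousOn (partialD i f) (upBall n α R)
  energy : ∀ r < R, IntegrableOn (alphaGradSq α f) (upBall n α r)

/-- Solutions of `B_α v = 0` in the upper half-ball whose derivative `D_z v` has a trace on the
thin ball. -/
structure HalfSolution (α R : ℝ) (v : Space n → ℝ) : Prop extends HalfRegular α R v where
  equation : ∃ G : Fin (n + 1) → Space n → ℝ, (∀ i, ContinuousOn (G i) (upBall n α R)) ∧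
    (∀ i, ∀ p ∈ upBall n α R,
      HasLineDerivAt ℝ (partialD i v) (G i p) p (EuclideanSpace.single i 1)) ∧
    ∀ p ∈ upBall n α R, ∑ i, fieldCoeff α i p ^ 2 * G i p = 0
  trace : ∀ p, gauge α p < R → zCoord p = 0 →
    ∃ b, Tendsto (Dz v) (𝓝[{q | 0 < zCoord q}] p) (𝓝 b)

/-- The continuous extension of `D_z v` to the thin ball. -/
def dzTrace (v : Space n → ℝ) : Space n → ℝ := extendFrom {q | 0 < zCoord q} (Dz v)

lemma isOpen_zCoord_pos : IsOpen {p : Space n | 0 < zCoord p} :=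
  isOpen_lt continuous_const continuous_zCoord

lemma isOpen_upBall (hα : 0 ≤ α) (R : ℝ) : IsOpen (upBall n α R) :=
  (isOpen_lt (continuous_gauge hα) continuous_const).inter isOpen_zCoord_pos

lemma upBall_subset_closed (R : ℝ) : upBall n α R ⊆ upBallClosed n α R :=
  fun _ hp => ⟨hp.1, hp.2.le⟩

lemma upBall_mono {r R : ℝ} (h : r ≤ R) : upBall n α r ⊆ upBall n α R :=
  fun _ hp => ⟨hp.1.trans_le h, hp.2⟩

lemma mem_closure_zCoord_pos {p : Space n} (hp : 0 ≤ zCoord p) :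
    p ∈ closure {q : Space n | 0 < zCoord q} := by
  have h : Tendsto (fun s : ℝ => pt (horiz p) (zCoord p + s)) (𝓝[>] 0) (𝓝 p) := by
    have := (continuous_pt.comp (by fun_prop : Continuous fun s : ℝ =>
      (horiz p, zCoord p + s))).tendsto 0
    simp only [Function.comp_def, add_zero, pt_horiz_zCoord] at this
    exact this.mono_left nhdsWithin_le_nhds
  refine mem_closure_of_tendsto h ?_
  filter_upwards [self_mem_nhdsWithin] with s hs
  have : 0 < s := hs
  simp only [zCoord_pt]
  linarith

lemma continuous_fieldCoeff (hα : 0 ≤ α) (i : Fin (n + 1)) :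
    Continuous (fieldCoeff α i : Space n → ℝ) := by
  unfold fieldCoeff
  by_cases h : i = Fin.last n
  · simp only [h, if_true]; exact continuous_const
  · simp only [h, if_false]
    exact (Real.continuous_rpow_const hα).comp continuous_zCoord.abs

lemma continuousOn_gauge_rpow (hα : 0 ≤ α) (s : ℝ) :
    ContinuousOn (fun p : Space n => gauge α p ^ s) {p | 0 < zCoord p} :=
  (continuous_gauge hα).continuousOn.rpow_const fun _ hp =>
    Or.inl (gauge_pos_of_zCoord_ne_zero hα (ne_of_gt hp)).ne'

lemma continuousOn_partialD_gauge (hα : 0 ≤ α) (i : Fin (n + 1)) :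
    ContinuousOn (partialD i (gauge α)) {p : Space n | 0 < zCoord p} := by
  have h := continuousOn_gauge_rpow (n := n) hα (-(2 * α + 1))
  refine Fin.lastCases ?_ (fun i => ?_) i
  · refine ContinuousOn.congr (f := fun p : Space n => gauge α p ^ (-(2 * α + 1)) *
      (|zCoord p| ^ (2 * α) * zCoord p)) ?_ fun p hp => partialD_gauge_last hα (ne_of_gt hp)
    have h2 : Continuous fun p : Space n => |zCoord p| ^ (2 * α) * zCoord p :=
      ((Real.continuous_rpow_const (by positivity)).comp continuous_zCoord.abs).mul
        continuous_zCoord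
    exact h.mul h2.continuousOn
  · refine ContinuousOn.congr (f := fun p : Space n => gauge α p ^ (-(2 * α + 1)) *
      ((α + 1) * p i.castSucc)) ?_ fun p hp => partialD_gauge_castSucc hα (ne_of_gt hp) i
    exact h.mul (by fun_prop)

lemma continuousOn_gradPair (hα : 0 ≤ α) {v f : Space n → ℝ} {U : Set (Space n)}
    (hv : ∀ i, ContinuousOn (partialD i v) U) (hf : ∀ i, ContinuousOn (partialD i f) U) :
    ContinuousOn (gradPair α v f) U := by
  unfold gradPair
  refine continuousOn_finsetSum _ fun i _ => ?_
  exact (((continuous_fieldCoeff hα i).pow 2).continuousOn.mul (hv i)).mul (hf i)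

lemma continuousOn_Zfield {v : Space n → ℝ} {U : Set (Space n)}
    (hv : ∀ i, ContinuousOn (partialD i v) U) : ContinuousOn (Zfield α v) U := by
  have : Zfield α v = fun p => ∑ i, weight α i * p i * partialD i v p := by
    ext p; exact Zfield_eq_sum v p
  rw [this]
  exact continuousOn_finsetSum _ fun i _ => ContinuousOn.mul (by fun_prop) (hv i)

namespace HalfRegular

variable {R : ℝ} {v f : Space n → ℝ}

lemma integrableOn_gradPair (hα : 0 ≤ α) (hv : HalfRegular α R v) (hf : HalfRegular α R f)
    {r : ℝ} (hr : r < R) : IntegrableOn (gradPair α v f) (upBall n α r) := by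
  have hc := (continuousOn_gradPair hα hv.contD hf.contD).mono (upBall_mono hr.le)
  refine Integrable.mono' ((hv.energy r hr).add (hf.energy r hr))
    (hc.aestronglyMeasurable (isOpen_upBall hα r).measurableSet)
    (Eventually.of_forall fun p => ?_)
  have h1 := two_mul_abs_gradPair_le (α := α) v f p
  rw [Real.norm_eq_abs]
  have := abs_nonneg (gradPair α v f p)
  simp only [Pi.add_apply]
  linarith

lemma mono {r : ℝ} (hr : r ≤ R) (hv : HalfRegular α R v) : HalfRegular α r v where
  cont := hv.cont.mono fun _ hp => ⟨hp.1.trans_le hr, hp.2⟩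
  diff p hp := hv.diff p (upBall_mono hr hp)
  contD i := (hv.contD i).mono (upBall_mono hr)
  energy s hs := hv.energy s (hs.trans_le hr)

lemma exists_bound (hα : 0 ≤ α) {k : Space n → ℝ} (hk : ContinuousOn k (upBallClosed n α R))
    {r : ℝ} (hr : r < R) : ∃ M, 0 ≤ M ∧ ∀ p, gauge α p ≤ r → 0 ≤ zCoord p → |k p| ≤ M := by
  have hK : IsCompact ({p : Space n | gauge α p ≤ r} ∩ {p | 0 ≤ zCoord p}) :=
    (isCompact_gauge_le hα r).inter_right (isClosed_le continuous_const continuous_zCoord)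
  obtain ⟨M, hM⟩ := hK.exists_bound_of_continuousOn
    (hk.mono fun p hp => ⟨lt_of_le_of_lt hp.1 hr, hp.2⟩)
  exact ⟨max M 0, le_max_right _ _, fun p h1 h2 => (hM p ⟨h1, h2⟩).trans (le_max_left _ _)⟩

end HalfRegular

namespace HalfSolution

variable {R : ℝ} {v : Space n → ℝ}

lemma mono {r : ℝ} (hr : r ≤ R) (hv : HalfSolution α R v) : HalfSolution α r v where
  toHalfRegular := hv.toHalfRegular.mono hr
  equation := by
    obtain ⟨G, h1, h2, h3⟩ := hv.equation
    exact ⟨G, fun i => (h1 i).mono (upBall_mono hr), fun i p hp => h2 i p (upBall_mono hr hp),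
      fun p hp => h3 p (upBall_mono hr hp)⟩
  trace p hp := hv.trace p (hp.trans_le hr)

lemma tendsto_Dz (hα : 0 ≤ α) (hv : HalfSolution α R v) {p : Space n} (hp : p ∈ upBall n α R) :
    Tendsto (Dz v) (𝓝[{q | 0 < zCoord q}] p) (𝓝 (Dz v p)) :=
  ((hv.contD (Fin.last n)).continuousAt ((isOpen_upBall hα R).mem_nhds hp)).tendsto.mono_left
    nhdsWithin_le_nhds

lemma dzTrace_eq (hα : 0 ≤ α) (hv : HalfSolution α R v) {p : Space n} (hp : p ∈ upBall n α R) :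
    dzTrace v p = Dz v p :=
  extendFrom_eq (mem_closure_zCoord_pos hp.2.le) (hv.tendsto_Dz hα hp)

/-- Each limit at a thin point is taken over all of the open half-space, not only along the vertical
line. This forces the extension to be continuous up to the thin ball and along it. -/
lemma continuousOn_dzTrace (hα : 0 ≤ α) (hv : HalfSolution α R v) :
    ContinuousOn (dzTrace v) (upBallClosed n α R) := by
  refine continuousOn_extendFrom (fun p hp => mem_closure_zCoord_pos hp.2) fun p hp => ?_
  rcases hp.2.eq_or_lt with h | h
  · exact hv.trace p hp.1 h.symm
  · exact ⟨_, hv.tendsto_Dz hα ⟨hp.1, h⟩⟩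

end HalfSolution

lemma dzTrace_eq_of_tendsto {v : Space n → ℝ} {p : Space n} (hp : zCoord p = 0) {b : ℝ}
    (h : Tendsto (Dz v) (𝓝[{q | 0 < zCoord q}] p) (𝓝 b)) : dzTrace v p = b :=
  extendFrom_eq (mem_closure_zCoord_pos hp.ge) h

/-! ### Integration by parts -/

lemma zCoord_add_smul_single (p : Space n) (t : ℝ) (i : Fin n) :
    zCoord (p + t • EuclideanSpace.single i.castSucc (1 : ℝ)) = zCoord p := by
  simp [zCoord, (Fin.castSucc_lt_last i).ne']

/-- The coefficient of `X_i` is constant along the `i`-th coordinate direction, so it passes through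
the derivative. -/
lemma hasLineDerivAt_fieldCoeff_mul {w : Space n → ℝ} {p : Space n} (hw : DifferentiableAt ℝ w p)
    (i : Fin (n + 1)) :
    HasLineDerivAt ℝ (fun q => fieldCoeff α i q ^ 2 * w q) (fieldCoeff α i p ^ 2 * partialD i w p)
      p (EuclideanSpace.single i 1) := by
  have h : HasLineDerivAt ℝ w (partialD i w p) p (EuclideanSpace.single i 1) :=
    hw.hasFDerivAt.hasLineDerivAt _
  have hc (t : ℝ) : fieldCoeff α i (p + t • EuclideanSpace.single i (1 : ℝ)) = fieldCoeff α i p := by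
    refine Fin.lastCases ?_ (fun i => ?_) i
    · rw [fieldCoeff_last, fieldCoeff_last]
    · rw [fieldCoeff_castSucc, fieldCoeff_castSucc, zCoord_add_smul_single]
  unfold HasLineDerivAt at h ⊢
  simp only [hc]
  exact h.const_mul _

lemma integrable_of_continuousOn_compact {K : Set (Space n)} (hK : IsCompact K) {k : Space n → ℝ}
    (hk : ContinuousOn k K) (h0 : ∀ p ∉ K, k p = 0) : Integrable k :=
  (integrableOn_iff_integrable_of_support_subset
    (fun p hp => by_contra fun h => hp (h0 p h))).1 (hk.integrableOn_compact hK)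

/-- For `w` supported in a compact subset of the open half-ball each coordinate can be integrated by
parts separately without boundary terms. The squared coefficient stays with `w`, and the sum
reproduces the equation. -/
theorem HalfSolution.integral_gradPair_eq_zero (hα : 0 ≤ α) {R : ℝ} {v : Space n → ℝ}
    (hv : HalfSolution α R v) {w : Space n → ℝ} {K : Set (Space n)} (hK : IsCompact K)
    (hKU : K ⊆ upBall n α R) (hw : ∀ p ∈ upBall n α R, DifferentiableAt ℝ w p)
    (hwc : ∀ i, ContinuousOn (partialD i w) (upBall n α R)) (hw0 : ∀ p ∉ K, w p = 0) :
    ∫ p, gradPair α v w p = 0 := by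
  obtain ⟨G, hG1, hG2, hG3⟩ := hv.equation
  have hloc (p : Space n) (hp : p ∉ K) : w =ᶠ[𝓝 p] fun _ => 0 := by
    filter_upwards [hK.isClosed.isOpen_compl.mem_nhds hp] with q hq using hw0 q hq
  have hdiff (p : Space n) : DifferentiableAt ℝ w p := by
    by_cases hp : p ∈ K
    · exact hw p (hKU hp)
    · exact (differentiableAt_const _).congr_of_eventuallyEq (hloc p hp)
  have hD0 (i : Fin (n + 1)) (p : Space n) (hp : p ∉ K) : partialD i w p = 0 := by
    rw [partialD, (hloc p hp).fderiv_eq]; simp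
  have hwK : ContinuousOn w K := fun p _ => (hdiff p).continuousAt.continuousWithinAt
  have hcK (i : Fin (n + 1)) : ContinuousOn (fun p => fieldCoeff α i p ^ 2) K :=
    ((continuous_fieldCoeff hα i).pow 2).continuousOn
  have h1 (i : Fin (n + 1)) : Integrable fun p =>
      partialD i v p * (fieldCoeff α i p ^ 2 * partialD i w p) :=
    integrable_of_continuousOn_compact hK (((hv.contD i).mono hKU).mul
      ((hcK i).mul ((hwc i).mono hKU))) fun p hp => by rw [hD0 i p hp]; ring
  have h2 (i : Fin (n + 1)) : Integrable fun p => G i p * (fieldCoeff α i p ^ 2 * w p) :=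
    integrable_of_continuousOn_compact hK (((hG1 i).mono hKU).mul ((hcK i).mul hwK))
      fun p hp => by rw [hw0 p hp]; ring
  have h3 (i : Fin (n + 1)) : Integrable fun p => partialD i v p * (fieldCoeff α i p ^ 2 * w p) :=
    integrable_of_continuousOn_compact hK (((hv.contD i).mono hKU).mul ((hcK i).mul hwK))
      fun p hp => by rw [hw0 p hp]; ring
  have hparts (i : Fin (n + 1)) : ∫ p, partialD i v p * (fieldCoeff α i p ^ 2 * partialD i w p) =
      -∫ p, G i p * (fieldCoeff α i p ^ 2 * w p) := by
    refine integral_bilinear_hasLineDerivAt_right_eq_neg_left_of_integrable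
      (B := ContinuousLinearMap.mul ℝ ℝ) (v := EuclideanSpace.single i (1 : ℝ))
      (h2 i) (h1 i) (h3 i) (fun p hp => hG2 i p (hKU ?_))
      (fun p _ => hasLineDerivAt_fieldCoeff_mul (hdiff p) i)
    have : tsupport (fun p => fieldCoeff α i p ^ 2 * w p) ⊆ K :=
      closure_minimal (fun q hq => by_contra fun h => hq (by simp [hw0 q h])) hK.isClosed
    exact this hp
  have e1 : ∀ p, gradPair α v w p =
      ∑ i, partialD i v p * (fieldCoeff α i p ^ 2 * partialD i w p) := fun p =>
    Finset.sum_congr rfl fun i _ => by ring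
  simp only [e1]
  rw [integral_finsetSum _ fun i _ => h1 i]
  simp only [hparts]
  rw [Finset.sum_neg_distrib, ← integral_finsetSum _ fun i _ => h2 i, neg_eq_zero]
  refine integral_eq_zero_of_ae (Eventually.of_forall fun p => ?_)
  by_cases hp : p ∈ K
  · have := hG3 p (hKU hp)
    simp only [Pi.zero_apply]
    calc ∑ i, G i p * (fieldCoeff α i p ^ 2 * w p)
        = (∑ i, fieldCoeff α i p ^ 2 * G i p) * w p := by
          rw [Finset.sum_mul]; exact Finset.sum_congr rfl fun i _ => by ring
      _ = 0 := by rw [this, zero_mul]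
  · simp [hw0 p hp]

/-! ### Product rules -/

lemma partialD_mul {f g : Space n → ℝ} {p : Space n} (hf : DifferentiableAt ℝ f p)
    (hg : DifferentiableAt ℝ g p) (i : Fin (n + 1)) :
    partialD i (fun q => f q * g q) p = f p * partialD i g p + g p * partialD i f p := by
  rw [partialD, fderiv_fun_mul hf hg]; simp [partialD]

lemma gradPair_mul (v : Space n → ℝ) {f g : Space n → ℝ} {p : Space n}
    (hf : DifferentiableAt ℝ f p) (hg : DifferentiableAt ℝ g p) :
    gradPair α v (fun q => f q * g q) p = f p * gradPair α v g p + g p * gradPair α v f p := by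
  simp only [gradPair, partialD_mul hf hg, Finset.mul_sum, ← Finset.sum_add_distrib]
  exact Finset.sum_congr rfl fun i _ => by ring

lemma partialD_comp {g : Space n → ℝ} {p : Space n} {η : ℝ → ℝ} {η' : ℝ}
    (hη : HasDerivAt η η' (g p)) (hg : DifferentiableAt ℝ g p) (i : Fin (n + 1)) :
    partialD i (fun q => η (g q)) p = η' * partialD i g p := by
  have := hη.comp_hasFDerivAt p hg.hasFDerivAt
  rw [partialD]
  erw [this.fderiv]
  simp [partialD]

lemma gradPair_comp (v : Space n → ℝ) {g : Space n → ℝ} {p : Space n} {η : ℝ → ℝ} {η' : ℝ}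
    (hη : HasDerivAt η η' (g p)) (hg : DifferentiableAt ℝ g p) :
    gradPair α v (fun q => η (g q)) p = η' * gradPair α v g p := by
  simp only [gradPair, partialD_comp hη hg, Finset.mul_sum]
  exact Finset.sum_congr rfl fun i _ => by ring

lemma differentiableAt_zCoord (p : Space n) : DifferentiableAt ℝ zCoord p :=
  (EuclideanSpace.proj (Fin.last n) : Space n →L[ℝ] ℝ).differentiableAt

lemma partialD_zCoord (p : Space n) (i : Fin (n + 1)) :
    partialD i zCoord p = if i = Fin.last n then 1 else 0 := by
  have : fderiv ℝ zCoord p = (EuclideanSpace.proj (Fin.last n) : Space n →L[ℝ] ℝ) :=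
    (EuclideanSpace.proj (Fin.last n) : Space n →L[ℝ] ℝ).fderiv
  rw [partialD, this]
  simp [eq_comm]

lemma gradPair_zCoord (v : Space n → ℝ) (p : Space n) : gradPair α v zCoord p = Dz v p := by
  simp [gradPair, partialD_zCoord, fieldCoeff_last, Dz]

lemma differentiableAt_gauge (hα : 0 ≤ α) {p : Space n} (hp : 0 < zCoord p) :
    DifferentiableAt ℝ (gauge α) p := (hasFDerivAt_gauge hα hp.ne').differentiableAt

end

end BaouendiGrushin

namespace BaouendiGrushin

noncomputable section

variable {n : ℕ} {α : ℝ}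

/-! ### Cutoffs -/

/-- A smooth cutoff that vanishes on `(-∞, 1]` and equals `1` on `[2, ∞)`. -/
def cutoff (s : ℝ) : ℝ := Real.smoothTransition (s - 1)

lemma contDiff_cutoff : ContDiff ℝ 1 cutoff := by
  unfold cutoff
  exact Real.smoothTransition.contDiff.comp (contDiff_id.sub contDiff_const)

lemma hasDerivAt_cutoff (s : ℝ) : HasDerivAt cutoff (deriv cutoff s) s :=
  (contDiff_cutoff.differentiable one_ne_zero s).hasDerivAt

lemma continuous_deriv_cutoff : Continuous (deriv cutoff) := contDiff_cutoff.continuous_deriv_one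

lemma cutoff_eq_zero {s : ℝ} (hs : s ≤ 1) : cutoff s = 0 :=
  Real.smoothTransition.zero_of_nonpos (by linarith)

lemma cutoff_eq_one {s : ℝ} (hs : 2 ≤ s) : cutoff s = 1 :=
  Real.smoothTransition.one_of_one_le (by linarith)

lemma abs_cutoff_le (s : ℝ) : |cutoff s| ≤ 1 := by
  rw [cutoff, abs_of_nonneg (Real.smoothTransition.nonneg _)]
  exact Real.smoothTransition.le_one _

lemma deriv_cutoff_eq_zero {s : ℝ} (hs : s < 1 ∨ 2 < s) : deriv cutoff s = 0 := by
  rcases hs with h | h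
  · have : cutoff =ᶠ[𝓝 s] fun _ => 0 := by
      filter_upwards [Iio_mem_nhds h] with t ht using cutoff_eq_zero (le_of_lt ht)
    rw [this.deriv_eq]; simp
  · have : cutoff =ᶠ[𝓝 s] fun _ => 1 := by
      filter_upwards [Ioi_mem_nhds h] with t ht using cutoff_eq_one (le_of_lt ht)
    rw [this.deriv_eq]; simp

lemma hasCompactSupport_deriv_cutoff : HasCompactSupport (deriv cutoff) := by
  refine HasCompactSupport.intro (isCompact_Icc (a := (1 : ℝ)) (b := 2)) fun s hs => ?_
  refine deriv_cutoff_eq_zero ?_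
  by_contra h
  push Not at h
  exact hs h

lemma integral_deriv_cutoff : ∫ s, deriv cutoff s = 1 := by
  have h1 : ∫ s in (1 : ℝ)..2, deriv cutoff s = cutoff 2 - cutoff 1 :=
    intervalIntegral.integral_deriv_eq_sub
      (fun s _ => contDiff_cutoff.differentiable one_ne_zero s)
      (continuous_deriv_cutoff.intervalIntegrable _ _)
  rw [cutoff_eq_one le_rfl, cutoff_eq_zero le_rfl, sub_zero,
    intervalIntegral.integral_of_le one_le_two, ← integral_Icc_eq_integral_Ioc,
    setIntegral_eq_integral_of_forall_compl_eq_zero] at h1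
  · exact h1
  · intro s hs
    refine deriv_cutoff_eq_zero ?_
    by_contra h
    push Not at h
    exact hs h

lemma deriv_cutoff_div_eq_zero {ε z : ℝ} (hε : 0 < ε) (hz : z < ε) :
    deriv cutoff (z / ε) = 0 :=
  deriv_cutoff_eq_zero (Or.inl ((div_lt_one hε).2 hz))

lemma isCompact_gauge_le_inter (hα : 0 ≤ α) (r ε : ℝ) :
    IsCompact {p : Space n | gauge α p ≤ r ∧ ε ≤ zCoord p} :=
  (isCompact_gauge_le hα r).inter_right (isClosed_le continuous_const continuous_zCoord)

/-- Averaging over the layers `ε ≤ z ≤ 2ε` converges to the integral over the thin space. -/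
theorem tendsto_integral_layer (hα : 0 ≤ α) {k : Space n → ℝ} {r : ℝ}
    (hk : ContinuousOn k {p | 0 ≤ zCoord p}) (hk0 : ∀ p, r < gauge α p → k p = 0) :
    Tendsto (fun ε : ℝ => ∫ p, deriv cutoff (zCoord p / ε) / ε * k p) (𝓝[>] 0)
      (𝓝 (∫ x : Horiz n, k (pt x 0))) := by
  obtain ⟨M, hM0, hM⟩ := HalfRegular.exists_bound (R := r + 1) hα
    (hk.mono fun p hp => hp.2) (lt_add_one r)
  have hM' (p : Space n) (hp : 0 ≤ zCoord p) : |k p| ≤ M := by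
    rcases le_or_gt (gauge α p) r with h | h
    · exact hM p h hp
    · rw [hk0 p h]; simpa using hM0
  set B : Set (Horiz n) := Metric.closedBall 0 (r ^ (α + 1)) with hB
  have hkB (x : Horiz n) (hx : x ∉ B) (z : ℝ) : k (pt x z) = 0 := by
    by_cases hr : r < gauge α (pt x z)
    · exact hk0 _ hr
    · exfalso
      refine hx ?_
      have h1 := norm_horiz_le_gauge hα (pt x z)
      have h2 : gauge α (pt x z) ^ (α + 1) ≤ r ^ (α + 1) :=
        Real.rpow_le_rpow (gauge_nonneg _) (not_lt.1 hr) (by positivity)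
      simp only [hB, Metric.mem_closedBall, dist_zero_right]
      rw [horiz_pt] at h1
      nlinarith [norm_nonneg x]
  have hbd (z : ℝ) (hz : 0 ≤ z) (x : Horiz n) : ‖k (pt x z)‖ ≤ B.indicator (fun _ => M) x := by
    by_cases hx : x ∈ B
    · rw [indicator_of_mem hx]; exact hM' _ (by simpa using hz)
    · rw [indicator_of_notMem hx, hkB x hx]; simp
  have hbi : Integrable (B.indicator fun _ => M) (volume : Measure (Horiz n)) :=
    (integrable_indicator_iff Metric.isClosed_closedBall.measurableSet).2
      (integrableOn_const (isCompact_closedBall _ _).measure_lt_top.ne)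
  have hmeas (z : ℝ) (hz : 0 ≤ z) :
      AEStronglyMeasurable (fun x : Horiz n => k (pt x z)) volume := by
    have : Continuous fun x : Horiz n => k (pt x z) := by
      refine hk.comp_continuous (continuous_pt.comp (by fun_prop : Continuous fun x : Horiz n =>
        (x, z))) fun x => ?_
      simpa using hz
    exact this.aestronglyMeasurable
  -- Integrals over the horizontal slices: a bounded function of `z ≥ 0` that is right-continuous at
  -- `0`. Here `κ` is not the frequency.
  set κ : ℝ → ℝ := fun z => ∫ x : Horiz n, k (pt x z) with hκ
  set C := ∫ x : Horiz n, B.indicator (fun _ => M) x with hC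
  have hκC (z : ℝ) (hz : 0 ≤ z) : |κ z| ≤ C := by
    rw [hκ, ← Real.norm_eq_abs]
    exact norm_integral_le_of_norm_le hbi (Eventually.of_forall (hbd z hz))
  have hκlim : Tendsto κ (𝓝[>] 0) (𝓝 (κ 0)) := by
    refine tendsto_integral_filter_of_dominated_convergence (B.indicator fun _ => M) ?_ ?_ hbi ?_
    · filter_upwards [self_mem_nhdsWithin] with z hz using hmeas z (le_of_lt hz)
    · filter_upwards [self_mem_nhdsWithin] with z hz
      exact Eventually.of_forall (hbd z (le_of_lt hz))
    · refine Eventually.of_forall fun x => ?_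
      have h1 : ContinuousWithinAt k {p | 0 ≤ zCoord p} (pt x 0) := hk _ (by simp)
      refine h1.tendsto.comp (tendsto_nhdsWithin_iff.2 ⟨?_, ?_⟩)
      · exact ((continuous_pt.comp (by fun_prop : Continuous fun z : ℝ => (x, z))).tendsto
          0).mono_left nhdsWithin_le_nhds
      · filter_upwards [self_mem_nhdsWithin] with z hz
        simpa using le_of_lt hz
  have hmain (ε : ℝ) (hε : 0 < ε) :
      AEStronglyMeasurable (fun s => deriv cutoff s * κ (ε * s)) volume ∧
      ∫ p, deriv cutoff (zCoord p / ε) / ε * k p = ∫ s, deriv cutoff s * κ (ε * s) := by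
    have hint : Integrable fun p : Space n => deriv cutoff (zCoord p / ε) / ε * k p := by
      refine integrable_of_continuousOn_compact (isCompact_gauge_le_inter hα r ε) ?_ ?_
      · refine ContinuousOn.mul (Continuous.continuousOn ?_) (hk.mono fun p hp => hε.le.trans hp.2)
        exact (continuous_deriv_cutoff.comp (continuous_zCoord.div_const ε)).div_const ε
      · intro p hp
        by_cases h1 : r < gauge α p
        · rw [hk0 p h1, mul_zero]
        · have : zCoord p < ε := lt_of_not_ge fun h => hp ⟨not_lt.1 h1, h⟩
          rw [deriv_cutoff_div_eq_zero hε this]; simp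
    have hemb : MeasurableEmbedding fun q : Horiz n × ℝ => pt q.1 q.2 := by
      have hinj : Function.Injective fun q : Horiz n × ℝ => (pt q.1 q.2 : Space n) := fun q q' h =>
        Prod.ext (by simpa using congrArg horiz h) (by simpa using congrArg zCoord h)
      exact continuous_pt.measurableEmbedding hinj
    have hint2 := (measurePreserving_pt (n := n)).integrable_comp_of_integrable hint
    simp only [Function.comp_def, zCoord_pt] at hint2
    have e1 : ∫ p, deriv cutoff (zCoord p / ε) / ε * k p =
        ∫ z : ℝ, deriv cutoff (z / ε) / ε * κ z := by
      rw [← (measurePreserving_pt (n := n)).integral_comp hemb]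
      simp only [zCoord_pt]
      rw [integral_prod_symm _ hint2]
      simp only [integral_const_mul, hκ]
    have h3 : Integrable fun z : ℝ => deriv cutoff (z / ε) / ε * κ z := by
      have := hint2.integral_prod_right
      simpa only [integral_const_mul] using this
    have h4 := h3.comp_mul_left' hε.ne'
    have e2 : (fun s => deriv cutoff (ε * s / ε) / ε * κ (ε * s)) =
        fun s => ε⁻¹ * (deriv cutoff s * κ (ε * s)) := by
      funext s
      rw [mul_div_cancel_left₀ _ hε.ne']; ring
    rw [e2] at h4
    constructor
    · have := (h4.const_mul ε).aestronglyMeasurable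
      refine this.congr (Eventually.of_forall fun s => ?_)
      change ε * (ε⁻¹ * (deriv cutoff s * κ (ε * s))) = deriv cutoff s * κ (ε * s)
      rw [← mul_assoc, mul_inv_cancel₀ hε.ne', one_mul]
    · rw [e1]
      have h5 := Measure.integral_comp_mul_left (fun z : ℝ => deriv cutoff (z / ε) / ε * κ z) ε
      rw [show (fun s => deriv cutoff (ε * s / ε) / ε * κ (ε * s)) =
        fun s => ε⁻¹ * (deriv cutoff s * κ (ε * s)) from e2, integral_const_mul,
        abs_of_pos (inv_pos.2 hε), smul_eq_mul] at h5
      exact (mul_left_cancel₀ (inv_ne_zero hε.ne') h5).symm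
  -- After `z = ε s` the kernel no longer depends on `ε`. It lives on `1 ≤ s ≤ 2` and has integral
  -- `1`, so the limit is the slice integral at height `0`.
  have hlim : Tendsto (fun ε : ℝ => ∫ s, deriv cutoff s * κ (ε * s)) (𝓝[>] 0)
      (𝓝 (∫ s, deriv cutoff s * κ 0)) := by
    refine tendsto_integral_filter_of_dominated_convergence (fun s => |deriv cutoff s| * C) ?_ ?_
      ?_ ?_
    · filter_upwards [self_mem_nhdsWithin] with ε hε using (hmain ε hε).1
    · filter_upwards [self_mem_nhdsWithin] with ε hε
      refine Eventually.of_forall fun s => ?_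
      rw [norm_mul, Real.norm_eq_abs, Real.norm_eq_abs]
      rcases lt_or_ge s 1 with hs | hs
      · rw [deriv_cutoff_eq_zero (Or.inl hs)]; simp
      · have hε' : 0 < ε := hε
        exact mul_le_mul_of_nonneg_left (hκC _ (by positivity)) (abs_nonneg _)
    · exact (continuous_deriv_cutoff.abs.integrable_of_hasCompactSupport
        hasCompactSupport_deriv_cutoff.abs).mul_const C
    · refine Eventually.of_forall fun s => ?_
      rcases lt_or_ge s 1 with hs | hs
      · rw [deriv_cutoff_eq_zero (Or.inl hs)]; simp
      · refine Tendsto.const_mul _ (hκlim.comp (tendsto_nhdsWithin_iff.2 ⟨?_, ?_⟩))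
        · have : Tendsto (fun ε : ℝ => ε * s) (𝓝 0) (𝓝 (0 * s)) :=
            (continuous_mul_const s).tendsto 0
          rw [zero_mul] at this
          exact this.mono_left nhdsWithin_le_nhds
        · filter_upwards [self_mem_nhdsWithin] with ε hε
          have hε' : 0 < ε := hε
          have hs' : 0 < s := by linarith
          exact mul_pos hε' hs'
  rw [integral_mul_const, integral_deriv_cutoff, one_mul] at hlim
  refine hlim.congr' ?_
  filter_upwards [self_mem_nhdsWithin] with ε hε using (hmain ε hε).2.symm

/-! ### The weak formulation -/

/-- The primitive of `φ` that vanishes at infinity, with the opposite sign. -/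
def tailInt (φ : ℝ → ℝ) (s : ℝ) : ℝ := ∫ σ in Ioi s, φ σ

section tail

variable {φ : ℝ → ℝ} {a r₁ : ℝ}

lemma integrable_of_eq_zero (hφ : Continuous φ) (h0 : ∀ s ∉ Icc a r₁, φ s = 0) : Integrable φ :=
  hφ.integrable_of_hasCompactSupport (HasCompactSupport.intro isCompact_Icc h0)

lemma hasDerivAt_tailInt (hφ : Continuous φ) (h0 : ∀ s ∉ Icc a r₁, φ s = 0) (s : ℝ) :
    HasDerivAt (tailInt φ) (-φ s) s := by
  have hi := integrable_of_eq_zero hφ h0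
  have h : tailInt φ = fun s => tailInt φ 0 - ∫ σ in (0 : ℝ)..s, φ σ := by
    funext s
    have := intervalIntegral.integral_interval_add_Ioi (a := 0) (b := s) hi.integrableOn
      hi.integrableOn
    simp only [tailInt]
    linarith
  rw [h]
  exact (intervalIntegral.integral_hasDerivAt_right (hφ.intervalIntegrable _ _)
    (hφ.stronglyMeasurableAtFilter _ _) hφ.continuousAt).const_sub _

lemma tailInt_eq_zero (h0 : ∀ s ∉ Icc a r₁, φ s = 0) {s : ℝ} (hs : r₁ ≤ s) : tailInt φ s = 0 := by
  refine setIntegral_eq_zero_of_forall_eq_zero fun σ hσ => h0 σ fun h => ?_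
  have : s < σ := hσ
  linarith [h.2]

end tail

/-- The test function is `f · η(ρ) · cutoff(z / ε)` with `η = tailInt φ`, hence `η' = -φ`. As `ε →
0` the derivative of the cutoff concentrates on the thin ball and produces the trace of `D_z v`.
Keeping `φ` arbitrary allows localization to single radii later. -/
theorem HalfSolution.weak_identity (hα : 0 ≤ α) {R : ℝ} {v f : Space n → ℝ}
    (hv : HalfSolution α R v) (hf : HalfRegular α R f) {φ : ℝ → ℝ} (hφ : Continuous φ) {a r₁ : ℝ}
    (hr₁ : r₁ < R) (h0 : ∀ s ∉ Icc a r₁, φ s = 0) :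
    IntegrableOn (fun p => tailInt φ (gauge α p) * gradPair α v f p) (upBall n α R) ∧
    IntegrableOn (fun p => φ (gauge α p) * f p * gradPair α v (gauge α) p) (upBall n α R) ∧
    (∫ p in upBall n α R, tailInt φ (gauge α p) * gradPair α v f p) -
      ∫ p in upBall n α R, φ (gauge α p) * f p * gradPair α v (gauge α) p =
      -∫ x : Horiz n, tailInt φ (gauge α (pt x 0)) * (dzTrace v (pt x 0) * f (pt x 0)) := by
  set η := tailInt φ with hη
  have hηd (s : ℝ) : HasDerivAt η (-φ s) s := hasDerivAt_tailInt hφ h0 s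
  have hηc : Continuous η := continuous_iff_continuousAt.2 fun s => (hηd s).continuousAt
  have hη0 (s : ℝ) (hs : r₁ ≤ s) : η s = 0 := tailInt_eq_zero h0 hs
  have hφ1 (s : ℝ) (hs : r₁ < s) : φ s = 0 := h0 s fun h => hs.not_ge h.2
  have hUo := isOpen_upBall (n := n) hα R
  have hUm := hUo.measurableSet
  have hρ := continuous_gauge (n := n) hα
  -- The weights vanish beyond `r₁`, so bounds up to `r₂ < R` suffice; nothing is assumed about the
  -- behaviour at radius `R` itself.
  obtain ⟨r₂, hr₁₂, hr₂⟩ := exists_between hr₁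
  obtain ⟨M, hM0, hM⟩ := HalfRegular.exists_bound hα hf.cont hr₂
  obtain ⟨Mη, hMη⟩ := (isCompact_Icc (a := (0 : ℝ)) (b := r₂)).exists_bound_of_continuousOn
    hηc.continuousOn
  obtain ⟨Mφ, hMφ⟩ := (isCompact_Icc (a := (0 : ℝ)) (b := r₂)).exists_bound_of_continuousOn
    hφ.continuousOn
  have hup : ∀ i, ContinuousOn (partialD i (gauge α)) (upBall n α R) := fun i =>
    (continuousOn_partialD_gauge hα i).mono fun p hp => hp.2
  have hgc := continuousOn_gradPair hα hv.contD hf.contD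
  have hgρ := continuousOn_gradPair hα hv.contD hup
  have hfU : ContinuousOn f (upBall n α R) := hf.cont.mono (upBall_subset_closed R)
  have hU2 : MeasurableSet (upBall n α r₂) := (isOpen_upBall hα r₂).measurableSet
  have hdiff : upBall n α R \ upBall n α r₂ ⊆ {p | r₂ ≤ gauge α p} := fun p hp =>
    not_lt.1 fun h => hp.2 ⟨h, hp.1.2⟩
  have hI1 : IntegrableOn (fun p => η (gauge α p) * gradPair α v f p) (upBall n α R) := by
    refine IntegrableOn.of_forall_sdiff_eq_zero (s := upBall n α r₂) ?_ hUm ?_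
    · refine Integrable.mono' ((hv.integrableOn_gradPair hα hf hr₂).norm.const_mul Mη)
        (((hηc.comp hρ).continuousOn.mul (hgc.mono (upBall_mono hr₂.le))).aestronglyMeasurable hU2)
        ?_
      filter_upwards [ae_restrict_mem hU2] with p hp
      rw [norm_mul]
      exact mul_le_mul_of_nonneg_right (hMη _ ⟨gauge_nonneg p, hp.1.le⟩) (norm_nonneg _)
    · intro p hp
      rw [hη0 _ (hr₁₂.le.trans (hdiff hp)), zero_mul]
  have hI2 : IntegrableOn (fun p => φ (gauge α p) * f p * gradPair α v (gauge α) p)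
      (upBall n α R) := by
    refine IntegrableOn.of_forall_sdiff_eq_zero (s := upBall n α r₂) ?_ hUm ?_
    · have hfin : volume (upBall n α r₂) ≠ ⊤ :=
        (measure_mono (fun p hp => hp.1.le)).trans_lt
          (isCompact_gauge_le (n := n) hα r₂).measure_lt_top |>.ne
      have hb : IntegrableOn (fun p => Mφ * M * (alphaGradSq α v p + 1)) (upBall n α r₂) :=
        ((hv.energy r₂ hr₂).add (integrableOn_const hfin)).const_mul _
      refine Integrable.mono' hb
        ((((hφ.comp hρ).continuousOn.mul hfU).mul hgρ).mono
          (upBall_mono hr₂.le) |>.aestronglyMeasurable hU2) ?_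
      filter_upwards [ae_restrict_mem hU2] with p hp
      have hb1 := hMφ _ ⟨gauge_nonneg p, hp.1.le⟩
      have hb2 := hM p hp.1.le hp.2.le
      have hb3 := two_mul_abs_gradPair_le (α := α) v (gauge α) p
      have hb4 : alphaGradSq α (gauge α) p ≤ 1 := psi_le_one hα hp.2.ne'
      have hb5 : |gradPair α v (gauge α) p| ≤ alphaGradSq α v p + 1 := by
        have := abs_nonneg (gradPair α v (gauge α) p)
        have := alphaGradSq_nonneg (α := α) v p
        linarith
      rw [norm_mul, norm_mul]
      refine mul_le_mul (mul_le_mul hb1 hb2 (abs_nonneg _) ((norm_nonneg _).trans hb1)) hb5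
        (abs_nonneg _) ?_
      exact mul_nonneg ((norm_nonneg _).trans hb1) hM0
    · intro p hp
      rw [hφ1 _ (hr₁₂.trans_le (hdiff hp)), zero_mul, zero_mul]
  refine ⟨hI1, hI2, ?_⟩
  set A : Space n → ℝ := (upBall n α R).indicator fun p =>
    η (gauge α p) * gradPair α v f p - φ (gauge α p) * f p * gradPair α v (gauge α) p with hA
  have hAi : Integrable A := (integrable_indicator_iff hUm).2 (hI1.sub hI2)
  set k : Space n → ℝ := fun p => η (gauge α p) * (dzTrace v p * f p) with hk
  have hk0 (p : Space n) (hp : r₁ < gauge α p) : k p = 0 := by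
    simp only [hk]; rw [hη0 _ hp.le, zero_mul]
  have hkc : ContinuousOn k {p | 0 ≤ zCoord p} := by
    intro p hp
    rcases lt_or_ge (gauge α p) R with h | h
    · have h1 : ContinuousOn k (upBallClosed n α R) :=
        (hηc.comp hρ).continuousOn.mul ((hv.continuousOn_dzTrace hα).mul hf.cont)
      refine (h1 p ⟨h, hp⟩).mono_of_mem_nhdsWithin ?_
      filter_upwards [self_mem_nhdsWithin, mem_nhdsWithin_of_mem_nhds
        ((isOpen_pseudoBall hα R).mem_nhds h)] with q h1 h2 using ⟨h2, h1⟩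
    · have h1 : k =ᶠ[𝓝 p] fun _ => 0 := by
        filter_upwards [(isOpen_lt continuous_const hρ).mem_nhds (hr₁.trans_le h)] with q hq
          using hk0 q hq
      exact (continuousAt_const.congr h1.symm).continuousWithinAt
  have hε (ε : ℝ) (hε : 0 < ε) : (∫ p, cutoff (zCoord p / ε) * A p) +
      ∫ p, deriv cutoff (zCoord p / ε) / ε * k p = 0 := by
    have hc1 (p : Space n) : HasDerivAt (fun z => cutoff (z / ε))
        (deriv cutoff (zCoord p / ε) / ε) (zCoord p) := by
      have := (hasDerivAt_cutoff (zCoord p / ε)).comp (zCoord p)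
        ((hasDerivAt_id (zCoord p)).div_const ε)
      simpa [div_eq_mul_inv, Function.comp_def] using this
    set w : Space n → ℝ := fun p => f p * (η (gauge α p) * cutoff (zCoord p / ε)) with hw
    have hd2 (p : Space n) (hp : 0 < zCoord p) :
        DifferentiableAt ℝ (fun q => η (gauge α q)) p :=
      (hηd _).differentiableAt.comp p (differentiableAt_gauge hα hp)
    have hd3 (p : Space n) : DifferentiableAt ℝ (fun q : Space n => cutoff (zCoord q / ε)) p :=
      (hc1 p).differentiableAt.comp p (differentiableAt_zCoord p)
    have hw0 (p : Space n) (hp : p ∉ {p : Space n | gauge α p ≤ r₁ ∧ ε ≤ zCoord p}) :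
        w p = 0 := by
      by_cases h : gauge α p ≤ r₁
      · have : zCoord p < ε := lt_of_not_ge fun h2 => hp ⟨h, h2⟩
        simp only [hw]
        rw [cutoff_eq_zero ((div_le_one hε).2 this.le), mul_zero, mul_zero]
      · simp only [hw]
        rw [hη0 _ (not_le.1 h).le, zero_mul, mul_zero]
    have hwc (i : Fin (n + 1)) : ContinuousOn (partialD i w) (upBall n α R) := by
      refine ContinuousOn.congr (f := fun p => f p * (η (gauge α p) *
        (deriv cutoff (zCoord p / ε) / ε * partialD i zCoord p) +
        cutoff (zCoord p / ε) * (-φ (gauge α p) * partialD i (gauge α) p)) +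
        (η (gauge α p) * cutoff (zCoord p / ε)) * partialD i f p) ?_ fun p hp => ?_
      · have c1 : Continuous fun p : Space n => η (gauge α p) := hηc.comp hρ
        have c2 : Continuous fun p : Space n => deriv cutoff (zCoord p / ε) / ε :=
          (continuous_deriv_cutoff.comp (continuous_zCoord.div_const ε)).div_const ε
        have c3 : Continuous fun p : Space n => cutoff (zCoord p / ε) :=
          contDiff_cutoff.continuous.comp (continuous_zCoord.div_const ε)
        have c4 : Continuous fun p : Space n => -φ (gauge α p) := (hφ.comp hρ).neg
        have c5 : Continuous fun p : Space n => partialD i zCoord p := by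
          simp only [partialD_zCoord]; exact continuous_const
        exact (hfU.mul ((c1.mul (c2.mul c5)).continuousOn.add
          (c3.continuousOn.mul (c4.continuousOn.mul (hup i))))).add
          ((c1.mul c3).continuousOn.mul (hf.contD i))
      · simp only [hw]
        rw [partialD_mul (hf.diff p hp) ((hd2 p hp.2).fun_mul (hd3 p)),
          partialD_mul (hd2 p hp.2) (hd3 p), partialD_comp (hc1 p) (differentiableAt_zCoord p),
          partialD_comp (hηd _) (differentiableAt_gauge hα hp.2)]
    have hzero := hv.integral_gradPair_eq_zero hα (isCompact_gauge_le_inter hα r₁ ε)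
      (fun p hp => ⟨hp.1.trans_lt hr₁, hε.trans_le hp.2⟩)
      (fun p hp => (hf.diff p hp).fun_mul ((hd2 p hp.2).fun_mul (hd3 p))) hwc hw0
    -- Product rule: derivatives of `f` and of the radial weight go into `A`, the derivative of the
    -- cutoff into the layer term with `k`.
    have hpt (p : Space n) : gradPair α v w p =
        cutoff (zCoord p / ε) * A p + deriv cutoff (zCoord p / ε) / ε * k p := by
      by_cases hp : p ∈ upBall n α R
      · simp only [hw, hA, hk, indicator_of_mem hp]
        rw [gradPair_mul v (hf.diff p hp) ((hd2 p hp.2).fun_mul (hd3 p)),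
          gradPair_mul v (hd2 p hp.2) (hd3 p),
          gradPair_comp v (hc1 p) (differentiableAt_zCoord p),
          gradPair_comp v (hηd _) (differentiableAt_gauge hα hp.2), gradPair_zCoord,
          hv.dzTrace_eq hα hp]
        ring
      · have hloc : w =ᶠ[𝓝 p] fun _ => 0 := by
          have hcl := (isCompact_gauge_le_inter (n := n) hα r₁ ε).isClosed
          have hp2 : p ∉ {p : Space n | gauge α p ≤ r₁ ∧ ε ≤ zCoord p} := fun h =>
            hp ⟨h.1.trans_lt hr₁, hε.trans_le h.2⟩
          filter_upwards [hcl.isOpen_compl.mem_nhds hp2] with q hq using hw0 q hq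
        have h1 : gradPair α v w p = 0 := by
          simp [gradPair, partialD, hloc.fderiv_eq]
        have h2 : deriv cutoff (zCoord p / ε) / ε * k p = 0 := by
          by_cases h : gauge α p < R
          · have hz : zCoord p < ε := (not_lt.1 fun h2 => hp ⟨h, h2⟩).trans_lt hε
            rw [deriv_cutoff_div_eq_zero hε hz]; simp
          · rw [hk0 p (hr₁.trans_le (not_lt.1 h)), mul_zero]
        rw [h1, h2, hA, indicator_of_notMem hp]
        simp
    have hi1 : Integrable fun p => cutoff (zCoord p / ε) * A p := by
      refine hAi.bdd_mul (c := 1) ?_ (Eventually.of_forall fun p => abs_cutoff_le _)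
      exact (contDiff_cutoff.continuous.comp
        (continuous_zCoord.div_const ε)).aestronglyMeasurable
    have hi2 : Integrable fun p => deriv cutoff (zCoord p / ε) / ε * k p := by
      refine integrable_of_continuousOn_compact (isCompact_gauge_le_inter hα r₁ ε) ?_ ?_
      · refine ContinuousOn.mul (Continuous.continuousOn ?_) (hkc.mono fun p hp => hε.le.trans hp.2)
        exact (continuous_deriv_cutoff.comp (continuous_zCoord.div_const ε)).div_const ε
      · intro p hp
        by_cases h1 : r₁ < gauge α p
        · rw [hk0 p h1, mul_zero]
        · have : zCoord p < ε := lt_of_not_ge fun h => hp ⟨not_lt.1 h1, h⟩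
          rw [deriv_cutoff_div_eq_zero hε this]; simp
    rw [← integral_add hi1 hi2, ← hzero]
    exact integral_congr_ae (Eventually.of_forall fun p => (hpt p).symm)
  have hlim1 : Tendsto (fun ε : ℝ => ∫ p, cutoff (zCoord p / ε) * A p) (𝓝[>] 0)
      (𝓝 (∫ p, A p)) := by
    refine tendsto_integral_filter_of_dominated_convergence (fun p => ‖A p‖) ?_ ?_ hAi.norm ?_
    · refine Eventually.of_forall fun ε => ?_
      exact (contDiff_cutoff.continuous.comp
        (continuous_zCoord.div_const ε)).aestronglyMeasurable.mul hAi.aestronglyMeasurable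
    · refine Eventually.of_forall fun ε => Eventually.of_forall fun p => ?_
      rw [norm_mul]
      exact mul_le_of_le_one_left (norm_nonneg _) (abs_cutoff_le _)
    · refine Eventually.of_forall fun p => ?_
      by_cases hp : p ∈ upBall n α R
      · refine tendsto_const_nhds.congr' ?_
        have hz : 0 < zCoord p / 2 := half_pos hp.2
        filter_upwards [Ioo_mem_nhdsGT hz] with ε hε
        rw [cutoff_eq_one, one_mul]
        rw [le_div_iff₀ hε.1]
        linarith [hε.2]
      · simp only [hA, indicator_of_notMem hp, mul_zero]
        exact tendsto_const_nhds
  have hlim2 := tendsto_integral_layer hα hkc hk0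
  have hsum := tendsto_nhds_unique_of_eventuallyEq (hlim1.add hlim2) tendsto_const_nhds
    (by filter_upwards [self_mem_nhdsWithin] with ε h using hε ε h)
  rw [hA, integral_indicator hUm, integral_sub hI1 hI2] at hsum
  linarith

end

end BaouendiGrushin

namespace BaouendiGrushin

noncomputable section

variable {n : ℕ} {α : ℝ}

/-! ### Integrals over sublevel sets -/

/-- The layer-cake formula for the weight `∫_{g}^∞ φ`. -/
lemma integral_tailInt_mul {Y : Type*} [MeasurableSpace Y] {μ : Measure Y} [SFinite μ]
    {g e : Y → ℝ} (hg : Measurable g) {φ : ℝ → ℝ} (hφ : Continuous φ) {a r : ℝ}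
    (h0 : ∀ s ∉ Icc a r, φ s = 0) (he : IntegrableOn e {y | g y < r} μ) :
    Integrable (fun s => φ s * ∫ y in {y | g y < s}, e y ∂μ) ∧
    ∫ y, tailInt φ (g y) * e y ∂μ = ∫ s, φ s * ∫ y in {y | g y < s}, e y ∂μ := by
  have hlt (s : ℝ) : MeasurableSet {y | g y < s} := hg measurableSet_Iio
  set S : Set (Y × ℝ) := {q | g q.1 < q.2} with hS
  have hSm : MeasurableSet S := measurableSet_lt (hg.comp measurable_fst) measurable_snd
  set e' : Y → ℝ := {y | g y < r}.indicator e with he'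
  have hei : Integrable e' μ := (integrable_indicator_iff (hlt r)).2 he
  have hi : Integrable (fun q : Y × ℝ => S.indicator (fun q => e' q.1 * φ q.2) q)
      (μ.prod volume) :=
    (hei.mul_prod (integrable_of_eq_zero hφ h0)).indicator hSm
  have hφr (s : ℝ) (hs : r < s) : φ s = 0 := h0 s fun h => hs.not_ge h.2
  have h1 (y : Y) : ∫ s, S.indicator (fun q => e' q.1 * φ q.2) (y, s) = tailInt φ (g y) * e y := by
    have h2 (s : ℝ) : S.indicator (fun q => e' q.1 * φ q.2) (y, s) =
        e' y * (Ioi (g y)).indicator φ s := by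
      by_cases h : g y < s
      · rw [indicator_of_mem (show (y, s) ∈ S from h), indicator_of_mem (show s ∈ Ioi (g y) from h)]
      · rw [indicator_of_notMem (show (y, s) ∉ S from h),
          indicator_of_notMem (show s ∉ Ioi (g y) from h), mul_zero]
    simp only [h2]
    rw [integral_const_mul, integral_indicator measurableSet_Ioi, mul_comm]
    by_cases h : g y < r
    · rw [he', indicator_of_mem (show y ∈ {y | g y < r} from h)]; rfl
    · have h3 := tailInt_eq_zero h0 (not_lt.1 h)
      rw [h3, zero_mul]
      rw [tailInt] at h3
      rw [h3, zero_mul]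
  have h2 (s : ℝ) : ∫ y, S.indicator (fun q => e' q.1 * φ q.2) (y, s) ∂μ =
      φ s * ∫ y in {y | g y < s}, e y ∂μ := by
    rw [← integral_indicator (hlt s), ← integral_const_mul]
    refine integral_congr_ae (Eventually.of_forall fun y => ?_)
    by_cases h : g y < s
    · simp only [indicator_of_mem (show (y, s) ∈ S from h),
        indicator_of_mem (show y ∈ {y | g y < s} from h)]
      by_cases h' : g y < r
      · rw [he', indicator_of_mem (show y ∈ {y | g y < r} from h'), mul_comm]
      · rw [hφr s (lt_of_le_of_lt (not_lt.1 h') h)]; ring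
    · simp only [indicator_of_notMem (show (y, s) ∉ S from h),
        indicator_of_notMem (show y ∉ {y | g y < s} from h), mul_zero]
  refine ⟨?_, ?_⟩
  · have := hi.integral_prod_right
    simpa only [h2] using this
  · have := integral_integral_swap (f := fun y s => S.indicator (fun q => e' q.1 * φ q.2) (y, s)) hi
    simpa only [h1, h2] using this

/-- Dominated convergence: the indicator of the sublevel set jumps at `s` only on the level set,
which is null. -/
lemma continuousOn_integral_sublevel {Y : Type*} [MeasurableSpace Y] {μ : Measure Y}
    {g e : Y → ℝ} (hg : Measurable g) {R : ℝ} (he : ∀ r < R, IntegrableOn e {y | g y < r} μ)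
    (h0 : ∀ s, 0 < s → μ {y | g y = s} = 0) :
    ContinuousOn (fun s => ∫ y in {y | g y < s}, e y ∂μ) (Ioo 0 R) := by
  have hlt (s : ℝ) : MeasurableSet {y | g y < s} := hg measurableSet_Iio
  intro s hs
  refine ContinuousAt.continuousWithinAt ?_
  obtain ⟨r, hsr, hr⟩ := exists_between hs.2
  simp only [← integral_indicator (hlt _)]
  have hb : Integrable ({y | g y < r}.indicator e) μ :=
    (integrable_indicator_iff (hlt r)).2 (he r hr)
  refine continuousAt_of_dominated (bound := fun y => ‖{y | g y < r}.indicator e y‖) ?_ ?_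
    hb.norm ?_
  · filter_upwards [Iio_mem_nhds hsr] with s' hs'
    exact ((integrable_indicator_iff (hlt s')).2 (he s' (lt_trans hs' hr))).aestronglyMeasurable
  · filter_upwards [Iio_mem_nhds hsr] with s' hs'
    refine Eventually.of_forall fun y => ?_
    have hs'' : s' < r := hs'
    exact norm_indicator_le_of_subset (fun y hy => lt_trans hy hs'') _ _
  · have hae : ∀ᵐ y ∂μ, g y ≠ s := by
      rw [ae_iff]; simpa using h0 s hs.1
    filter_upwards [hae] with y hy
    rcases lt_or_gt_of_ne hy with h | h
    · refine (continuousAt_const (y := e y)).congr ?_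
      filter_upwards [Ioi_mem_nhds h] with s' hs'
      exact (indicator_of_mem (show y ∈ {y | g y < s'} from hs') e).symm
    · refine (continuousAt_const (y := (0 : ℝ))).congr ?_
      filter_upwards [Iio_mem_nhds h] with s' hs'
      have hs'' : s' < g y := hs'
      exact (indicator_of_notMem (s := {y | g y < s'}) (fun h => lt_asymm hs'' h) e).symm

/-- Each vertical half-line meets a level set of the gauge in at most one point. -/
lemma volume_upper_gauge_eq (hα : 0 ≤ α) (s : ℝ) :
    (volume.restrict {p : Space n | 0 < zCoord p}) {p | gauge α p = s} = 0 := by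
  have hm : MeasurableSet {p : Space n | gauge α p = s} :=
    (isClosed_eq (continuous_gauge hα) continuous_const).measurableSet
  rw [Measure.restrict_apply hm]
  have hm2 := hm.inter (isOpen_zCoord_pos (n := n)).measurableSet
  rw [← (measurePreserving_pt (n := n)).measure_preimage hm2.nullMeasurableSet,
    Measure.measure_prod_null ((measurePreserving_pt (n := n)).measurable hm2)]
  refine Eventually.of_forall fun x => ?_
  refine measure_mono_null (t := {prof α s x}) ?_ (by simp)
  rintro z ⟨h1, h2⟩
  simp only [mem_ofPred_eq, zCoord_pt] at h1 h2
  rw [mem_singleton_iff, ← h1, prof_gauge hα x h2]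

lemma gauge_pt_zero (hα : 0 ≤ α) (x : Horiz n) :
    gauge α (pt x 0) ^ (α + 1) = (α + 1) * ‖x‖ := by
  have h := gauge_rpow_succ_sq hα (pt x 0)
  rw [zCoord_pt, horiz_pt, abs_zero, Real.zero_rpow (by positivity), add_zero, ← mul_pow] at h
  exact (pow_left_inj₀ (Real.rpow_nonneg (gauge_nonneg _) _) (by positivity) two_ne_zero).1 h

lemma volume_thin_gauge_eq (hα : 0 ≤ α) {s : ℝ} (hs : 0 < s) :
    volume {x : Horiz n | gauge α (pt x 0) = s} = 0 := by
  have hc : s ^ (α + 1) / (α + 1) ≠ 0 :=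
    (div_pos (Real.rpow_pos_of_pos hs _) (by positivity)).ne'
  refine measure_mono_null (fun x hx => ?_)
    (Measure.addHaar_sphere_of_ne_zero volume (0 : Horiz n) hc)
  have h := gauge_pt_zero hα x
  rw [show gauge α (pt x 0) = s from hx] at h
  rw [mem_sphere_iff_norm, sub_zero, h]
  field_simp

/-! ### The slice identity -/

/-- The bilinear energy over the upper half-ball. -/
def upEnergy (α : ℝ) (v f : Space n → ℝ) (s : ℝ) : ℝ := ∫ p in upBall n α s, gradPair α v f p

/-- The pairing of `f` with the trace of `D_z v` over the thin ball. -/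
def thinPair (α : ℝ) (v f : Space n → ℝ) (s : ℝ) : ℝ :=
  ∫ x in {x : Horiz n | gauge α (pt x 0) < s}, dzTrace v (pt x 0) * f (pt x 0)

/-- The pairing of `f` with `Z_α v` over the pseudo-sphere of radius `e^t`. -/
def sphPair (α : ℝ) (v f : Space n → ℝ) (t : ℝ) : ℝ :=
  ∫ y, f (polar α (y, t)) * Zfield α v (polar α (y, t)) ∂sphMeas n α

lemma restrict_upper_restrict (hα : 0 ≤ α) (s : ℝ) :
    (volume.restrict {p : Space n | 0 < zCoord p}).restrict {p | gauge α p < s} =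
      volume.restrict (upBall n α s) :=
  Measure.restrict_restrict (isOpen_pseudoBall hα s).measurableSet

lemma continuousOn_upEnergy (hα : 0 ≤ α) {R : ℝ} {v f : Space n → ℝ} (hv : HalfRegular α R v)
    (hf : HalfRegular α R f) : ContinuousOn (upEnergy α v f) (Ioo 0 R) := by
  have h := continuousOn_integral_sublevel (μ := volume.restrict {p : Space n | 0 < zCoord p})
    (e := gradPair α v f) (continuous_gauge hα).measurable (R := R)
    (fun r hr => by
      rw [IntegrableOn, restrict_upper_restrict hα]
      exact hv.integrableOn_gradPair hα hf hr)
    (fun s _ => volume_upper_gauge_eq hα s)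
  simp only [restrict_upper_restrict hα] at h
  exact h

lemma isOpen_thin (hα : 0 ≤ α) (s : ℝ) : IsOpen {x : Horiz n | gauge α (pt x 0) < s} :=
  (isOpen_pseudoBall hα s).preimage
    (continuous_pt.comp (by fun_prop : Continuous fun x : Horiz n => (x, (0 : ℝ))))

lemma continuousOn_thin {R : ℝ} {k : Space n → ℝ} (hk : ContinuousOn k (upBallClosed n α R)) :
    ContinuousOn (fun x : Horiz n => k (pt x 0)) {x : Horiz n | gauge α (pt x 0) < R} :=
  hk.comp (continuous_pt.comp
    (by fun_prop : Continuous fun x : Horiz n => (x, (0 : ℝ)))).continuousOn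
    fun x hx => ⟨hx, by simp⟩

lemma integrableOn_thin (hα : 0 ≤ α) {R : ℝ} {k : Space n → ℝ}
    (hk : ContinuousOn k (upBallClosed n α R)) {r : ℝ} (hr : r < R) :
    IntegrableOn (fun x : Horiz n => k (pt x 0)) {x : Horiz n | gauge α (pt x 0) < r} := by
  obtain ⟨M, hM0, hM⟩ := HalfRegular.exists_bound hα hk hr
  have hsub : {x : Horiz n | gauge α (pt x 0) < r} ⊆ Metric.closedBall 0 (r ^ (α + 1)) := by
    intro x hx
    have hx' : gauge α (pt x 0) < r := hx
    have h1 := gauge_pt_zero hα x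
    have h2 := Real.rpow_le_rpow (gauge_nonneg _) hx'.le (by positivity : 0 ≤ α + 1)
    rw [mem_closedBall_zero_iff]
    nlinarith [norm_nonneg x]
  have hfin : volume {x : Horiz n | gauge α (pt x 0) < r} < ⊤ := (measure_mono hsub).trans_lt
    (isCompact_closedBall (0 : Horiz n) (r ^ (α + 1))).measure_lt_top
  have hm := (isOpen_thin (n := n) hα r).measurableSet
  refine Integrable.mono' (integrableOn_const (C := M) hfin.ne)
    (((continuousOn_thin hk).mono fun x hx => lt_trans hx hr).aestronglyMeasurable hm) ?_
  filter_upwards [ae_restrict_mem hm] with x hx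
  exact hM _ (le_of_lt hx) (by simp)

lemma continuousOn_thinPair (hα : 0 ≤ α) {R : ℝ} {v f : Space n → ℝ} (hv : HalfSolution α R v)
    (hf : HalfRegular α R f) : ContinuousOn (thinPair α v f) (Ioo 0 R) :=
  continuousOn_integral_sublevel (μ := (volume : Measure (Horiz n)))
    (g := fun x => gauge α (pt x 0)) (e := fun x => dzTrace v (pt x 0) * f (pt x 0))
    ((continuous_gauge hα).comp (continuous_pt.comp
      (by fun_prop : Continuous fun x : Horiz n => (x, (0 : ℝ))))).measurable
    (fun _ hr => integrableOn_thin hα ((hv.continuousOn_dzTrace hα).mul hf.cont) hr)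
    (fun _ hs => volume_thin_gauge_eq hα hs)

/-- Polar coordinates with respect to the Lebesgue measure in the logarithmic radius. -/
theorem setIntegral_upper_polar_volume (hα : 0 ≤ α) {F : Space n → ℝ}
    (hF : IntegrableOn (fun p => psi α p * F p) {p | 0 < zCoord p})
    (hFm : AEStronglyMeasurable F (volume.restrict {p | 0 < zCoord p})) :
    Integrable (fun q : Horiz n × ℝ => Real.exp (homDim n α * q.2) * F (polar α q))
      ((sphMeas n α).prod volume) ∧
    ∫ p in {p | 0 < zCoord p}, psi α p * F p =
      ∫ q, Real.exp (homDim n α * q.2) * F (polar α q) ∂((sphMeas n α).prod volume) := by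
  obtain ⟨h1, h2⟩ := setIntegral_upper_polar hα hF hFm
  have hm : Measurable fun q : Horiz n × ℝ => ENNReal.ofReal (Real.exp (homDim n α * q.2)) := by
    fun_prop
  rw [radMeas, prod_withDensity_right (by fun_prop)] at h1 h2
  rw [integrable_withDensity_iff_integrable_smul' hm (by simp)] at h1
  rw [integral_withDensity_eq_integral_toReal_smul hm (by simp)] at h2
  simp only [ENNReal.toReal_ofReal (Real.exp_pos _).le, smul_eq_mul] at h1 h2
  exact ⟨h1, h2⟩

lemma polar_mem (hα : 0 ≤ α) {y : Horiz n} (hy : y ∈ profDom n α 1) (t : ℝ) :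
    gauge α (polar α (y, t)) = Real.exp t ∧ 0 < zCoord (polar α (y, t)) := by
  refine ⟨gauge_dil_sphPt hα (Real.exp_pos t).le hy, ?_⟩
  rw [polar, zCoord_dil]
  exact mul_pos (Real.exp_pos t) (zCoord_sphPt_pos hα hy)

lemma ae_sphMeas_mem : ∀ᵐ y ∂sphMeas n α, y ∈ profDom n α 1 :=
  (withDensity_absolutelyContinuous _ _).ae_le (ae_restrict_mem (isOpen_profDom 1).measurableSet)

lemma integral_comp_exp (X : ℝ → ℝ) (h0 : ∀ s ≤ 0, X s = 0) :
    (Integrable X → Integrable fun t => Real.exp t * X (Real.exp t)) ∧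
    ∫ s, X s = ∫ t, Real.exp t * X (Real.exp t) := by
  have hd : ∀ t ∈ (univ : Set ℝ), HasDerivWithinAt Real.exp (Real.exp t) univ t :=
    fun t _ => (Real.hasDerivAt_exp t).hasDerivWithinAt
  have h := integral_image_eq_integral_abs_deriv_smul MeasurableSet.univ hd
    Real.exp_injective.injOn X
  have hi := integrableOn_image_iff_integrableOn_abs_deriv_smul MeasurableSet.univ hd
    Real.exp_injective.injOn X
  have h1 : ∫ s in Ioi 0, X s = ∫ s, X s :=
    setIntegral_eq_integral_of_forall_compl_eq_zero fun s hs => h0 s (not_lt.1 hs)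
  rw [image_univ, Real.range_exp] at h hi
  rw [h1] at h
  simp only [abs_of_pos (Real.exp_pos _), smul_eq_mul, Measure.restrict_univ,
    integrableOn_univ] at h hi
  exact ⟨fun hX => hi.1 hX.integrableOn, h⟩

lemma exists_subset_Icc_of_isCompact {L : ℝ} {k : Set ℝ} (hk : IsCompact k) (hkL : k ⊆ Iio L) :
    ∃ a b, b < L ∧ k ⊆ Icc a b := by
  rcases k.eq_empty_or_nonempty with rfl | hne
  · exact ⟨0, L - 1, by linarith, empty_subset _⟩
  · exact ⟨sInf k, sSup k, hkL (hk.sSup_mem hne), fun x hx =>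
      ⟨csInf_le hk.bddBelow hx, le_csSup hk.bddAbove hx⟩⟩

section slices

variable {R : ℝ} {v f : Space n → ℝ}

/-- The radial term of the weak identity in polar coordinates. The pairing with the gauge supplies
`ψ_α / ρ`, and dividing `e^{Qt}` by `ρ = e^t` leaves `e^{(Q-1)t}`. -/
lemma HalfSolution.integral_sphPair (hα : 0 ≤ α) (hv : HalfSolution α R v)
    (hf : HalfRegular α R f) {φ : ℝ → ℝ} (hφ : Continuous φ) {a r₁ : ℝ}
    (hr₁ : r₁ < R) (h0 : ∀ s ∉ Icc a r₁, φ s = 0) :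
    Integrable (fun q : Horiz n × ℝ => Real.exp ((homDim n α - 1) * q.2) * φ (Real.exp q.2) *
      (f (polar α q) * Zfield α v (polar α q))) ((sphMeas n α).prod volume) ∧
    ∫ p in upBall n α R, φ (gauge α p) * f p * gradPair α v (gauge α) p =
      ∫ t, Real.exp ((homDim n α - 1) * t) * φ (Real.exp t) * sphPair α v f t := by
  obtain ⟨-, hI, -⟩ := hv.weak_identity hα hf hφ hr₁ h0
  have hUm := (isOpen_upBall (n := n) hα R).measurableSet
  have hzm := (isOpen_zCoord_pos (n := n)).measurableSet
  have hfU : ContinuousOn f (upBall n α R) := hf.cont.mono (upBall_subset_closed R)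
  set F : Space n → ℝ := (upBall n α R).indicator
    fun p => φ (gauge α p) * f p * (Zfield α v p / gauge α p) with hF
  have hpsiF : EqOn (fun p => psi α p * F p) ((upBall n α R).indicator fun p =>
      φ (gauge α p) * f p * gradPair α v (gauge α) p) {p : Space n | 0 < zCoord p} := by
    intro p hp
    by_cases hpU : p ∈ upBall n α R
    · simp only [hF, indicator_of_mem hpU]
      rw [gradPair_gauge hα v hpU.2.ne']; ring
    · simp only [hF, indicator_of_notMem hpU, mul_zero]
  have hFi : IntegrableOn (fun p => psi α p * F p) {p : Space n | 0 < zCoord p} := by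
    refine (integrableOn_congr_fun hpsiF hzm).2 ?_
    exact ((integrable_indicator_iff hUm).2 hI).integrableOn
  have hFm : AEStronglyMeasurable F (volume.restrict {p : Space n | 0 < zCoord p}) := by
    refine AEStronglyMeasurable.restrict ?_
    refine (aestronglyMeasurable_indicator_iff hUm).2 (ContinuousOn.aestronglyMeasurable ?_ hUm)
    have hρ := continuous_gauge (n := n) hα
    refine ((hφ.comp hρ).continuousOn.mul hfU).mul ((continuousOn_Zfield hv.contD).div
      hρ.continuousOn fun p hp => (gauge_pos_of_zCoord_ne_zero hα hp.2.ne').ne')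
  obtain ⟨h1, h2⟩ := setIntegral_upper_polar_volume hα hFi hFm
  have hφR (s : ℝ) (hs : R ≤ s) : φ s = 0 := h0 s fun h => (hr₁.trans_le hs).not_ge h.2
  have hae : (fun q : Horiz n × ℝ => Real.exp (homDim n α * q.2) * F (polar α q)) =ᵐ[
      (sphMeas n α).prod volume] fun q => Real.exp ((homDim n α - 1) * q.2) * φ (Real.exp q.2) *
      (f (polar α q) * Zfield α v (polar α q)) := by
    have : ∀ᵐ q ∂((sphMeas n α).prod (volume : Measure ℝ)), q.1 ∈ profDom n α 1 :=
      Measure.quasiMeasurePreserving_fst.ae ae_sphMeas_mem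
    filter_upwards [this] with q hq
    obtain ⟨g1, g2⟩ := polar_mem hα hq q.2
    have e1 : Real.exp (homDim n α * q.2) = Real.exp ((homDim n α - 1) * q.2) * Real.exp q.2 := by
      rw [← Real.exp_add]; congr 1; ring
    by_cases hR : Real.exp q.2 < R
    · have hm : polar α q ∈ upBall n α R := ⟨by rw [g1]; exact hR, g2⟩
      simp only [hF, indicator_of_mem hm]
      rw [g1, e1]
      have := Real.exp_pos q.2
      field_simp
    · have hm : polar α q ∉ upBall n α R := fun h => hR (by rw [← g1]; exact h.1)
      simp only [hF, indicator_of_notMem hm]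
      rw [hφR _ (not_lt.1 hR)]
      ring
  have h3 := h1.congr hae
  refine ⟨h3, ?_⟩
  rw [integral_congr_ae hae, integral_prod_symm _ h3, setIntegral_congr_fun hzm hpsiF,
    setIntegral_indicator hUm] at h2
  rw [inter_eq_right.2 (fun p hp => hp.2)] at h2
  rw [h2]
  refine integral_congr_ae (Eventually.of_forall fun t => ?_)
  simp only [sphPair]
  rw [integral_const_mul]

/-- A weight `φ` equal to `1` on `[e^a, e^b]` is inserted in `integral_sphPair`, and the
exponential, bounded away from zero there, is divided out. -/
lemma HalfSolution.integrable_sphPair (hα : 0 ≤ α) (hv : HalfSolution α R v)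
    (hf : HalfRegular α R f) {a b : ℝ} (hb : Real.exp b < R) :
    Integrable (fun q : Horiz n × ℝ => f (polar α q) * Zfield α v (polar α q))
      ((sphMeas n α).prod (volume.restrict (Icc a b))) := by
  obtain ⟨r, hbr, hr⟩ := exists_between hb
  obtain ⟨φ, hφ0, hφ1, -⟩ := exists_continuous_zero_one_of_isClosed
    (s := (Ioo (Real.exp a / 2) r)ᶜ) (t := Icc (Real.exp a) (Real.exp b))
    isOpen_Ioo.isClosed_compl isClosed_Icc (by
      rw [Set.disjoint_left]
      intro s h1 h2
      exact h1 ⟨(half_lt_self (Real.exp_pos a)).trans_le h2.1, h2.2.trans_lt hbr⟩)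
  obtain ⟨h1, -⟩ := hv.integral_sphPair hα hf φ.continuous hr
    (a := Real.exp a / 2) (fun s hs => hφ0 fun h => hs ⟨h.1.le, h.2.le⟩)
  have hm : MeasurableSet {q : Horiz n × ℝ | q.2 ∈ Icc a b} := measurable_snd measurableSet_Icc
  have hres : (sphMeas n α).prod (volume.restrict (Icc a b)) =
      ((sphMeas n α).prod volume).restrict {q : Horiz n × ℝ | q.2 ∈ Icc a b} := by
    have : {q : Horiz n × ℝ | q.2 ∈ Icc a b} = univ ×ˢ Icc a b := by ext q; simp
    rw [this, ← Measure.prod_restrict, Measure.restrict_univ]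
  rw [hres]
  have h2 := h1.integrableOn (s := {q : Horiz n × ℝ | q.2 ∈ Icc a b})
  have hcont : Continuous fun t : ℝ => Real.exp (-(homDim n α - 1) * t) := by fun_prop
  obtain ⟨C, hC⟩ := (isCompact_Icc (a := a) (b := b)).exists_bound_of_continuousOn
    hcont.continuousOn
  have h3 := Integrable.bdd_mul (c := C) h2
    (f := fun q : Horiz n × ℝ => Real.exp (-(homDim n α - 1) * q.2))
    (hcont.comp continuous_snd).aestronglyMeasurable
    (by filter_upwards [ae_restrict_mem hm] with q hq using hC _ hq)
  refine h3.congr ?_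
  filter_upwards [ae_restrict_mem hm] with q hq
  have e1 : φ (Real.exp q.2) = 1 := hφ1 ⟨Real.exp_le_exp.2 hq.1, Real.exp_le_exp.2 hq.2⟩
  rw [e1, mul_one, ← mul_assoc, ← Real.exp_add]
  ring_nf
  simp

/-- The first variation identity on almost every pseudo-sphere. -/
theorem HalfSolution.slice_identity (hα : 0 ≤ α) (hR : 0 < R) (hv : HalfSolution α R v)
    (hf : HalfRegular α R f) :
    ∀ᵐ t : ℝ, t < Real.log R → upEnergy α v f (Real.exp t) + thinPair α v f (Real.exp t) =
      Real.exp ((homDim n α - 2) * t) * sphPair α v f t := by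
  have hexp (t : ℝ) (ht : t < Real.log R) : Real.exp t < R := by
    rwa [← Real.lt_log_iff_exp_lt hR]
  set X : ℝ → ℝ := fun t => upEnergy α v f (Real.exp t) + thinPair α v f (Real.exp t) -
      Real.exp ((homDim n α - 2) * t) * sphPair α v f t with hX
  have hmaps : MapsTo Real.exp (Iio (Real.log R)) (Ioo 0 R) := fun t ht =>
    ⟨Real.exp_pos t, hexp t ht⟩
  have hE := (continuousOn_upEnergy hα hv.toHalfRegular hf).comp
    Real.continuous_exp.continuousOn hmaps
  have hT := (continuousOn_thinPair hα hv hf).comp Real.continuous_exp.continuousOn hmaps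
  have hJ (a b : ℝ) (hb : b < Real.log R) : IntegrableOn (sphPair α v f) (Icc a b) := by
    have := (hv.integrable_sphPair hα hf (a := a) (hexp b hb)).integral_prod_right
    exact this
  have hEJ : Continuous fun t : ℝ => Real.exp ((homDim n α - 2) * t) := by fun_prop
  have hXi : LocallyIntegrableOn X (Iio (Real.log R)) := by
    have h1 : LocallyIntegrableOn (fun t => upEnergy α v f (Real.exp t) +
        thinPair α v f (Real.exp t)) (Iio (Real.log R)) :=
      (hE.add hT).locallyIntegrableOn measurableSet_Iio
    refine h1.sub ?_
    refine (locallyIntegrableOn_iff isOpen_Iio.isLocallyClosed).2 fun k hk hkc => ?_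
    obtain ⟨a, b, hb, hkab⟩ := exists_subset_Icc_of_isCompact hkc hk
    exact ((hJ a b hb).continuousOn_mul hEJ.continuousOn isCompact_Icc).mono_set hkab
  -- Fundamental lemma of the calculus of variations: the defect `X` vanishes almost everywhere once
  -- its integral against every test function `θ` vanishes.
  have hkey := isOpen_Iio.ae_eq_zero_of_integral_contDiff_smul_eq_zero hXi
    (fun θ hθ hθc hθs => ?_)
  · filter_upwards [hkey] with t ht htR
    have := ht htR
    simp only [hX] at this
    linarith
  obtain ⟨a, b, hb, hab⟩ := exists_subset_Icc_of_isCompact hθc hθs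
  have hθ0 (t : ℝ) (ht : t ∉ Icc a b) : θ t = 0 :=
    image_eq_zero_of_notMem_tsupport fun h => ht (hab h)
  -- Chosen so that `e^t φ(e^t) = θ(t)`, which absorbs the Jacobian of `s = e^t`.
  set φ : ℝ → ℝ := fun s => if 0 < s then θ (Real.log s) / s else 0 with hφ
  have hφ0 (s : ℝ) (hs : s ∉ Icc (Real.exp a) (Real.exp b)) : φ s = 0 := by
    simp only [hφ]
    split_ifs with h
    · rw [hθ0 _ fun h' => hs ⟨(Real.le_log_iff_exp_le h).1 h'.1, (Real.log_le_iff_le_exp h).1 h'.2⟩,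
        zero_div]
    · rfl
  have hφc : Continuous φ := by
    refine continuous_iff_continuousAt.2 fun s => ?_
    rcases lt_or_ge 0 s with hs | hs
    · have h1 : ContinuousAt (fun s => θ (Real.log s) / s) s :=
        ((hθ.continuous.continuousAt).comp (Real.continuousAt_log hs.ne')).div continuousAt_id hs.ne'
      refine h1.congr ?_
      filter_upwards [Ioi_mem_nhds hs] with s' hs'
      exact (if_pos hs').symm
    · refine (continuousAt_const (y := (0 : ℝ))).congr ?_
      filter_upwards [Iio_mem_nhds (hs.trans_lt (Real.exp_pos a))] with s' hs'
      exact (hφ0 s' fun h => absurd h.1 (not_le.2 hs')).symm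
  have hφe (t : ℝ) : Real.exp t * φ (Real.exp t) = θ t := by
    simp only [hφ, if_pos (Real.exp_pos t), Real.log_exp]
    field_simp
  have hbR := hexp b hb
  obtain ⟨-, -, hW⟩ := hv.weak_identity hα hf hφc hbR hφ0
  have hzm := (isOpen_zCoord_pos (n := n)).measurableSet
  obtain ⟨e1, e2⟩ := integral_tailInt_mul (μ := volume.restrict {p : Space n | 0 < zCoord p})
    (e := gradPair α v f) (continuous_gauge hα).measurable hφc hφ0
    (by rw [IntegrableOn, restrict_upper_restrict hα]
        exact hv.toHalfRegular.integrableOn_gradPair hα hf hbR)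
  obtain ⟨t1, t2⟩ := integral_tailInt_mul (μ := (volume : Measure (Horiz n)))
    (g := fun x => gauge α (pt x 0)) (e := fun x => dzTrace v (pt x 0) * f (pt x 0))
    ((continuous_gauge hα).comp (continuous_pt.comp
      (by fun_prop : Continuous fun x : Horiz n => (x, (0 : ℝ))))).measurable hφc hφ0
    (integrableOn_thin hα ((hv.continuousOn_dzTrace hα).mul hf.cont) hbR)
  obtain ⟨s1, s2⟩ := hv.integral_sphPair hα hf hφc hbR hφ0
  simp only [restrict_upper_restrict hα] at e1 e2
  change Integrable (fun s => φ s * upEnergy α v f s) at e1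
  change _ = ∫ s, φ s * upEnergy α v f s at e2
  change Integrable (fun s => φ s * thinPair α v f s) at t1
  change _ = ∫ s, φ s * thinPair α v f s at t2
  have hup : ∫ p in upBall n α R, tailInt φ (gauge α p) * gradPair α v f p =
      ∫ p in {p : Space n | 0 < zCoord p}, tailInt φ (gauge α p) * gradPair α v f p := by
    refine (setIntegral_eq_of_subset_of_forall_sdiff_eq_zero hzm (fun p hp => hp.2)
      fun p hp => ?_).symm
    rw [tailInt_eq_zero hφ0, zero_mul]
    by_contra hlt
    exact hp.2 ⟨(not_le.1 hlt).trans hbR, hp.1⟩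
  rw [hup, e2, t2, s2] at hW
  obtain ⟨i1, i2⟩ := integral_comp_exp (fun s => φ s * upEnergy α v f s + φ s * thinPair α v f s)
    (fun s hs => by
      rw [hφ0 s fun h => absurd (hs.trans_lt (Real.exp_pos a)) (not_lt.2 h.1)]; ring)
  rw [integral_add e1 t1] at i2
  have i3 := i1 (e1.add t1)
  have i4 := s1.integral_prod_right
  simp only [integral_const_mul] at i4
  change Integrable (fun t => Real.exp ((homDim n α - 1) * t) * φ (Real.exp t) *
    sphPair α v f t) at i4
  have hsplit : (fun t => θ t • X t) = fun t => Real.exp t * (φ (Real.exp t) *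
      upEnergy α v f (Real.exp t) + φ (Real.exp t) * thinPair α v f (Real.exp t)) -
      Real.exp ((homDim n α - 1) * t) * φ (Real.exp t) * sphPair α v f t := by
    funext t
    have : Real.exp ((homDim n α - 1) * t) = Real.exp ((homDim n α - 2) * t) * Real.exp t := by
      rw [← Real.exp_add]; congr 1; ring
    rw [this, smul_eq_mul, ← hφe t]
    simp only [hX]
    ring
  rw [hsplit, integral_sub i3 i4, ← i2]
  linarith

end slices

end

end BaouendiGrushin

namespace BaouendiGrushin

noncomputable section

variable {n : ℕ} {α : ℝ}

/-! ### Weak directional derivatives -/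

/-- A continuous weak directional derivative of a continuous function is a classical one. -/
theorem hasLineDerivAt_of_weak {f g : Space n → ℝ} (hf : Continuous f) (hg : Continuous g)
    (e : Space n)
    (h : ∀ φ : Space n → ℝ, ContDiff ℝ (⊤ : ℕ∞) φ → HasCompactSupport φ →
      ∫ p, f p * fderiv ℝ φ p e = -∫ p, g p * φ p) (p : Space n) :
    HasLineDerivAt ℝ f (g p) p e := by
  let φ : ℕ → ContDiffBump (0 : Space n) := fun k =>
    { rIn := 1 / (k + 1)
      rOut := 2 / (k + 1)
      rIn_pos := by positivity
      rIn_lt_rOut := by gcongr; norm_num }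
  have hφ : Tendsto (fun k => (φ k).rOut) atTop (𝓝 0) := by
    have h1 := tendsto_one_div_add_atTop_nhds_zero_nat (𝕜 := ℝ)
    have h2 := h1.const_mul 2
    simpa [φ, div_eq_mul_inv] using h2
  set Φ : ℕ → Space n → ℝ := fun k => (φ k).normed volume with hΦ
  have hΦs (k : ℕ) : ContDiff ℝ (⊤ : ℕ∞) (Φ k) := (φ k).contDiff_normed
  have hΦc (k : ℕ) : HasCompactSupport (Φ k) := (φ k).hasCompactSupport_normed
  set F : (Space n → ℝ) → ℕ → Space n → ℝ := fun w k =>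
    convolution (Φ k) w (ContinuousLinearMap.lsmul ℝ ℝ) volume with hF
  have hlim {w : Space n → ℝ} (hw : Continuous w) (q : Space n) :
      Tendsto (fun k => F w k q) atTop (𝓝 (w q)) :=
    ContDiffBump.convolution_tendsto_right_of_continuous hφ hw q
  have hunif {w : Space n → ℝ} (hw : Continuous w) (q : Space n) :
      Tendsto (fun i : ℕ × Space n => F w i.1 i.2) (atTop ×ˢ 𝓝 q) (𝓝 (w q)) :=
    ContDiffBump.convolution_tendsto_right (φ := fun i : ℕ × Space n => φ i.1)
      (g := fun _ => w) (k := fun i => i.2) (hφ.comp tendsto_fst)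
      (Eventually.of_forall fun _ => hw.aestronglyMeasurable)
      ((hw.tendsto q).comp tendsto_snd) tendsto_snd
  -- The derivative of the mollified `f` falls on `Φ_k(q - ·)`, an admissible test function, so the
  -- weak hypothesis turns it into the mollified `g`.
  have hder (k : ℕ) (q : Space n) : HasLineDerivAt ℝ (F f k) (F g k q) q e := by
    have h1 := (hΦc k).hasFDerivAt_convolution_left (ContinuousLinearMap.lsmul ℝ ℝ)
      ((hΦs k).of_le (by norm_cast)) (hf.locallyIntegrable (μ := volume)) q
    have h2 := h1.hasLineDerivAt e
    refine h2.congr_deriv ?_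
    have hex : ConvolutionExistsAt (fderiv ℝ (Φ k)) f q
        ((ContinuousLinearMap.lsmul ℝ ℝ).precompL (Space n)) volume :=
      ((hΦc k).fderiv ℝ).convolutionExists_left _
        ((hΦs k).continuous_fderiv (by simp)) hf.locallyIntegrable q
    rw [convolution_def, ContinuousLinearMap.integral_apply hex]
    simp only [ContinuousLinearMap.precompL_apply, ContinuousLinearMap.lsmul_apply, smul_eq_mul]
    simp only [hF]
    rw [convolution_lsmul_swap]
    simp only [smul_eq_mul]
    have hψ : ContDiff ℝ (⊤ : ℕ∞) fun x => Φ k (q - x) := (hΦs k).comp (contDiff_const.sub contDiff_id)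
    have hψc : HasCompactSupport fun x => Φ k (q - x) :=
      (hΦc k).comp_homeomorph (Homeomorph.subLeft q)
    have h3 := h _ hψ hψc
    have h4 (x : Space n) : fderiv ℝ (fun x => Φ k (q - x)) x e = -(fderiv ℝ (Φ k) (q - x) e) := by
      have h5 : HasFDerivAt (Φ k) (fderiv ℝ (Φ k) (q - x)) (q - x) :=
        ((hΦs k).differentiable (by simp) _).hasFDerivAt
      have h6 := h5.comp x ((hasFDerivAt_id x).const_sub q)
      rw [show fderiv ℝ (fun x => Φ k (q - x)) x = _ from h6.fderiv]
      simp
    simp only [h4, mul_neg, integral_neg, neg_inj] at h3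
    rw [← integral_sub_left_eq_self (fun t => (fderiv ℝ (Φ k) t e) * f (q - t)) volume q]
    simp only [sub_sub_cancel]
    simp only [mul_comm] at h3 ⊢
    exact h3
  have hline : Continuous fun t : ℝ => p + t • e := by fun_prop
  have hp : Tendsto (fun t : ℝ => p + t • e) (𝓝 0) (𝓝 p) := by
    simpa using hline.tendsto 0
  -- The derivatives converge uniformly near `t = 0` because mollification of the continuous `g`
  -- converges jointly in the index and the point.
  have := hasDerivAt_of_tendstoUniformlyOnFilter (l := atTop) (x := (0 : ℝ))
    (f := fun k t => F f k (p + t • e)) (f' := fun k t => F g k (p + t • e))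
    (g := fun t => f (p + t • e)) (g' := fun t => g (p + t • e)) ?_ ?_ ?_
  · simpa [HasLineDerivAt] using this
  · rw [Metric.tendstoUniformlyOnFilter_iff]
    intro ε hε
    have h1 := ((hunif hg p).comp (tendsto_id.prodMap hp))
    have h2 : Tendsto (fun i : ℕ × ℝ => g (p + i.2 • e)) (atTop ×ˢ 𝓝 0) (𝓝 (g p)) :=
      ((hg.tendsto p).comp hp).comp tendsto_snd
    have h3 := h2.dist h1
    rw [dist_self] at h3
    exact h3.eventually (gt_mem_nhds hε)
  · refine Eventually.of_forall fun i => ?_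
    have h1 := hder i.1 (p + i.2 • e)
    rw [HasLineDerivAt] at h1
    have h2 := HasDerivAt.comp_sub_const (f := fun t => F f i.1 (p + i.2 • e + t • e)) i.2 i.2
      (by simpa using h1)
    convert h2 using 2 with t
    rw [add_assoc, ← add_smul]; simp
  · exact Eventually.of_forall fun t => hlim hf _

/-- The generator of the dilations is the derivative along their orbits. -/
lemma hasDerivAt_dil_exp {v : Space n → ℝ} {p : Space n} {t : ℝ}
    (hv : DifferentiableAt ℝ v (dil α (Real.exp t) p)) :
    HasDerivAt (fun s => v (dil α (Real.exp s) p)) (Zfield α v (dil α (Real.exp t) p)) t := by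
  set q := dil α (Real.exp t) p with hq
  have h1 : HasDerivAt (fun s => dil α (Real.exp s) p)
      (WithLp.toLp 2 fun i => weight α i * q i) t := by
    have h4 : HasDerivAt (fun s i => dil α (Real.exp s) p i) (fun i => weight α i * q i) t := by
      refine hasDerivAt_pi.2 fun i => ?_
      have h2 : HasDerivAt (fun s => Real.exp (weight α i * s) * p i)
          (Real.exp (weight α i * t) * (weight α i * 1) * p i) t :=
        (((hasDerivAt_id t).const_mul (weight α i)).exp).mul_const (p i)
      have h3 (s : ℝ) : dil α (Real.exp s) p i = Real.exp (weight α i * s) * p i := by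
        rw [dil_apply, ← Real.exp_mul, mul_comm s]
      simp only [h3, hq]
      refine h2.congr_deriv ?_
      ring
    exact ((PiLp.continuousLinearEquiv 2 ℝ fun _ : Fin (n + 1) => ℝ).symm.hasFDerivAt).comp_hasDerivAt
      t h4
  have h2 := hv.hasFDerivAt.comp_hasDerivAt t h1
  refine h2.congr_deriv ?_
  have h3 : (WithLp.toLp 2 fun i => weight α i * q i : Space n) =
      ∑ i, (weight α i * q i) • EuclideanSpace.single i (1 : ℝ) := by
    ext j
    simp [Finset.sum_apply, Pi.single_apply]
  rw [h3, map_sum, Zfield_eq_sum]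
  simp [partialD]

end

end BaouendiGrushin

namespace BaouendiGrushin

noncomputable section

variable {n : ℕ} {α : ℝ}

/-! ### Solid harmonics -/

lemma fieldCoeff_add_smul_single (i : Fin (n + 1)) (p : Space n) (t : ℝ) :
    fieldCoeff α i (p + t • EuclideanSpace.single i 1) = fieldCoeff α i p := by
  refine Fin.lastCases ?_ (fun i => ?_) i
  · simp only [fieldCoeff_last]
  · simp only [fieldCoeff_castSucc, zCoord_add_smul_single]

lemma fieldCoeff_ne_zero {p : Space n} (hp : zCoord p ≠ 0) (i : Fin (n + 1)) :
    fieldCoeff α i p ≠ 0 := by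
  refine Fin.lastCases ?_ (fun i => ?_) i
  · simp only [fieldCoeff_last]; exact one_ne_zero
  · rw [fieldCoeff_castSucc]; exact (Real.rpow_pos_of_pos (abs_pos.2 hp) _).ne'

/-- A continuous weak derivative along a field `X_i` is a classical one. -/
lemma IsWeakX.hasDerivAt (hα : 0 ≤ α) {i : Fin (n + 1)} {f g : Space n → ℝ}
    (h : IsWeakX α i f g) (hf : Continuous f) (hg : Continuous g) (p : Space n) :
    HasDerivAt (fun t : ℝ => fieldCoeff α i p * f (p + t • EuclideanSpace.single i 1)) (g p) 0 := by
  have h1 := hasLineDerivAt_of_weak (f := fun q => fieldCoeff α i q * f q)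
    ((continuous_fieldCoeff hα i).mul hf) hg
    (EuclideanSpace.single i 1) (fun φ hφ hφc => by
      rw [← h φ hφ hφc]
      refine integral_congr_ae (Eventually.of_forall fun q => ?_)
      simp only [partialD]; ring) p
  simpa only [HasLineDerivAt, fieldCoeff_add_smul_single] using h1

lemma IsWeakX.hasDerivAt_of_ne (hα : 0 ≤ α) {i : Fin (n + 1)} {f g : Space n → ℝ}
    (h : IsWeakX α i f g) (hf : Continuous f) (hg : Continuous g) {p : Space n}
    (hp : zCoord p ≠ 0) :
    HasDerivAt (fun t : ℝ => f (p + t • EuclideanSpace.single i 1)) (g p / fieldCoeff α i p) 0 := by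
  have hc := fieldCoeff_ne_zero (α := α) hp i
  have h1 := (h.hasDerivAt hα hf hg p).const_mul (fieldCoeff α i p)⁻¹
  simp only [inv_mul_cancel_left₀ hc] at h1
  rwa [inv_mul_eq_div] at h1

lemma IsWeakX.partialD_eq (hα : 0 ≤ α) {i : Fin (n + 1)} {f g : Space n → ℝ}
    (h : IsWeakX α i f g) (hf : Continuous f) (hg : Continuous g) {p : Space n}
    (hp : zCoord p ≠ 0) (hd : DifferentiableAt ℝ f p) :
    partialD i f p = g p / fieldCoeff α i p := by
  have h1 := hd.hasFDerivAt.hasLineDerivAt (EuclideanSpace.single i 1)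
  exact HasDerivAt.unique h1 (h.hasDerivAt_of_ne hα hf hg hp)

namespace IsSolidHarmonic

variable {κ : ℝ} {P : Space n → ℝ}

/-- Off `{z = 0}` the fields do not degenerate, so dividing the continuous weak derivatives by their
coefficients gives classical ones. The weak derivative `X_{n+1} P` is continuous across `{z = 0}`
and provides the trace. -/
theorem halfSolution (hα : 0 ≤ α) (hP : IsSolidHarmonic α κ P) (R : ℝ) : HalfSolution α R P := by
  obtain ⟨g, G, hgG, hsum⟩ := hP.equation
  have hpd (i : Fin (n + 1)) {p : Space n} (hp : zCoord p ≠ 0) :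
      partialD i P p = g i p / fieldCoeff α i p :=
    (hgG i).2.2.1.partialD_eq hα hP.continuous (hgG i).1 hp (hP.homogeneous p hp).1
  have hgc (i : Fin (n + 1)) : Continuous (g i) := (hgG i).1
  refine ⟨⟨hP.continuous.continuousOn, fun p hp => (hP.homogeneous p hp.2.ne').1, fun i => ?_,
    fun r _ => ?_⟩, ⟨fun i p => G i p / fieldCoeff α i p ^ 2, fun i => ?_, fun i p hp => ?_,
    fun p hp => ?_⟩, fun p _ _ => ⟨g (Fin.last n) p, ?_⟩⟩
  · refine ContinuousOn.congr ?_ fun p hp => hpd i hp.2.ne'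
    exact (hgc i).continuousOn.div (continuous_fieldCoeff hα i).continuousOn
      fun p hp => fieldCoeff_ne_zero hp.2.ne' i
  · have h1 : IntegrableOn (fun p => ∑ i, g i p ^ 2) (upBall n α r) := by
      have h2 : Continuous fun p => ∑ i, g i p ^ 2 := by fun_prop
      exact (h2.continuousOn.integrableOn_compact (isCompact_gauge_le hα r)).mono_set
        fun p hp => hp.1.le
    refine h1.congr_fun (fun p hp => ?_) (isOpen_upBall hα r).measurableSet
    rw [alphaGradSq_eq_sum]
    refine Finset.sum_congr rfl fun i _ => ?_
    rw [hpd i hp.2.ne', mul_div_cancel₀ _ (fieldCoeff_ne_zero hp.2.ne' i)]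
  · exact (hgG i).2.1.continuousOn.div ((continuous_fieldCoeff hα i).pow 2).continuousOn
      fun p hp => pow_ne_zero 2 (fieldCoeff_ne_zero hp.2.ne' i)
  · have h1 := ((hgG i).2.2.2.hasDerivAt_of_ne hα (hgc i) (hgG i).2.1 hp.2.ne').div_const
      (fieldCoeff α i p)
    rw [div_div, ← sq] at h1
    refine h1.congr_of_eventuallyEq ?_
    have hc : Continuous fun t : ℝ => zCoord (p + t • EuclideanSpace.single i (1 : ℝ)) :=
      continuous_zCoord.comp (by fun_prop)
    have := hc.continuousAt.eventually_ne (y := (0 : ℝ)) (x := 0) (by simpa using hp.2.ne')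
    filter_upwards [this] with t ht
    rw [hpd i ht, fieldCoeff_add_smul_single]
  · rw [← hsum p]
    refine Finset.sum_congr rfl fun i _ => ?_
    rw [mul_div_cancel₀ _ (pow_ne_zero 2 (fieldCoeff_ne_zero hp.2.ne' i))]
  · refine (((hgc _).tendsto p).mono_left nhdsWithin_le_nhds).congr' ?_
    filter_upwards [self_mem_nhdsWithin] with q hq
    have hq' : zCoord q ≠ 0 := ne_of_gt hq
    rw [Dz, hpd _ hq', fieldCoeff_last, div_one]

/-- Euler's relation is an ordinary differential equation along each orbit: `e^{-κs} P(δ_{e^s} p)`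
has zero derivative, and orbits never meet `{z = 0}`. -/
lemma dil_eq (hP : IsSolidHarmonic α κ P) {p : Space n} (hp : zCoord p ≠ 0) (t : ℝ) :
    P (dil α (Real.exp t) p) = Real.exp (κ * t) * P p := by
  have hz (s : ℝ) : zCoord (dil α (Real.exp s) p) ≠ 0 := by
    rw [zCoord_dil]; exact mul_ne_zero (Real.exp_pos s).ne' hp
  have hd (s : ℝ) : HasDerivAt (fun s => Real.exp (-(κ * s)) * P (dil α (Real.exp s) p)) 0 s := by
    have h1 := hasDerivAt_dil_exp (hP.homogeneous _ (hz s)).1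
    rw [(hP.homogeneous _ (hz s)).2] at h1
    have h2 : HasDerivAt (fun s => Real.exp (-(κ * s))) (Real.exp (-(κ * s)) * (-(κ * 1))) s :=
      (((hasDerivAt_id s).const_mul κ).neg).exp
    refine (h2.mul h1).congr_deriv ?_
    ring
  have h := is_const_of_deriv_eq_zero (fun s => (hd s).differentiableAt) (fun s => (hd s).deriv) t 0
  simp only [mul_zero, neg_zero, Real.exp_zero, one_mul, dil_one] at h
  rw [← h, ← mul_assoc, ← Real.exp_add]
  simp

end IsSolidHarmonic

lemma reflectZ_add_smul_single {p : Space n} (hp : zCoord p = 0) (t : ℝ) :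
    reflectZ (p + t • EuclideanSpace.single (Fin.last n) (1 : ℝ)) =
      p + (-t) • EuclideanSpace.single (Fin.last n) (1 : ℝ) := by
  have hp' : p (Fin.last n) = 0 := hp
  ext i
  refine Fin.lastCases ?_ (fun i => ?_) i
  · simp [reflectZ, hp']
  · simp [reflectZ, (Fin.castSucc_lt_last i).ne]

/-- Since `X_{n+1} P` is continuous on the whole space, `P` has a classical `z`-derivative at thin
points, equal to the trace. Evenness makes it equal to its own negative. -/
lemma IsPosSolidHarmonic.dzTrace_eq_zero (hα : 0 ≤ α) {κ : ℝ} {P : Space n → ℝ}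
    (hP : IsPosSolidHarmonic α κ P) {p : Space n} (hp : zCoord p = 0) : dzTrace P p = 0 := by
  have hS := hP.isSolidHarmonic
  obtain ⟨g, G, hgG, hsum⟩ := hS.equation
  have ht : Tendsto (Dz P) (𝓝[{q | 0 < zCoord q}] p) (𝓝 (g (Fin.last n) p)) := by
    refine (((hgG _).1.tendsto p).mono_left nhdsWithin_le_nhds).congr' ?_
    filter_upwards [self_mem_nhdsWithin] with q hq
    have hq' : zCoord q ≠ 0 := ne_of_gt hq
    rw [Dz, (hgG _).2.2.1.partialD_eq hα hS.continuous (hgG _).1 hq' (hS.homogeneous q hq').1,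
      fieldCoeff_last, div_one]
  rw [dzTrace_eq_of_tendsto hp ht]
  have h1 := (hgG (Fin.last n)).2.2.1.hasDerivAt hα hS.continuous (hgG _).1 p
  simp only [fieldCoeff_last, one_mul] at h1
  have h2 : HasDerivAt (fun t : ℝ => P (p + t • EuclideanSpace.single (Fin.last n) 1))
      (-(g (Fin.last n) p)) 0 := by
    have h3 := HasDerivAt.scomp (0 : ℝ) (by simpa using h1) (hasDerivAt_neg (0 : ℝ))
    refine (h3.congr_deriv (by simp)).congr_of_eventuallyEq (Eventually.of_forall fun t => ?_)
    change _ = P (p + (-t) • _)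
    rw [← reflectZ_add_smul_single hp, hP.even]
  linarith [h1.unique h2]

end

end BaouendiGrushin

namespace BaouendiGrushin

noncomputable section

variable {n : ℕ} {α : ℝ}

/-! ### Behaviour under dilations -/

lemma dil_inv_dil {l : ℝ} (hl : 0 < l) (p : Space n) : dil α l⁻¹ (dil α l p) = p := by
  rw [dil_dil (inv_pos.2 hl).le hl.le, inv_mul_cancel₀ hl.ne', dil_one]

/-- The dilations as homeomorphisms. -/
def dilHomeo (α : ℝ) {l : ℝ} (hl : 0 < l) : Space n ≃ₜ Space n where
  toFun := dil α l
  invFun := dil α l⁻¹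
  left_inv := dil_inv_dil hl
  right_inv p := by simpa using dil_inv_dil (α := α) (inv_pos.2 hl) p
  continuous_toFun := (dil α l).continuous
  continuous_invFun := (dil α l⁻¹).continuous

lemma det_dil {l : ℝ} (hl : 0 < l) :
    LinearMap.det ((dil α l : Space n →L[ℝ] Space n) : Space n →ₗ[ℝ] Space n) =
      l ^ homDim n α := by
  rw [← LinearMap.det_toMatrix (EuclideanSpace.basisFun (Fin (n + 1)) ℝ).toBasis]
  have h : LinearMap.toMatrix (EuclideanSpace.basisFun (Fin (n + 1)) ℝ).toBasis
      (EuclideanSpace.basisFun (Fin (n + 1)) ℝ).toBasis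
      ((dil α l : Space n →L[ℝ] Space n) : Space n →ₗ[ℝ] Space n) =
      Matrix.diagonal fun i => l ^ weight α i := by
    ext i j
    rw [LinearMap.toMatrix_apply]
    by_cases hij : i = j
    · subst hij; simp
    · simp [hij]
  rw [h, Matrix.det_diagonal, Fin.prod_univ_castSucc]
  simp only [weight_castSucc, weight_last, Finset.prod_const, Finset.card_univ, Fintype.card_fin]
  rw [← Real.rpow_natCast, ← Real.rpow_mul hl.le, ← Real.rpow_add hl, homDim]

lemma map_dil_volume {l : ℝ} (hl : 0 < l) :
    Measure.map (dil α l) (volume : Measure (Space n)) =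
      ENNReal.ofReal (l ^ (-homDim n α)) • volume := by
  have h := Measure.map_linearMap_addHaar_eq_smul_addHaar (volume : Measure (Space n))
    (f := ((dil α l : Space n →L[ℝ] Space n) : Space n →ₗ[ℝ] Space n))
    (by rw [det_dil hl]; exact (Real.rpow_pos_of_pos hl _).ne')
  rw [det_dil hl, abs_of_pos (inv_pos.2 (Real.rpow_pos_of_pos hl _)), ← Real.rpow_neg hl.le] at h
  exact h

lemma preimage_dil_upBall (hα : 0 ≤ α) {l : ℝ} (hl : 0 < l) (s : ℝ) :
    dil α l ⁻¹' upBall n α (l * s) = upBall n α s := by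
  ext p
  simp only [mem_preimage, upBall, mem_ofPred_eq, gauge_dil hα hl.le, zCoord_dil,
    mul_lt_mul_iff_right₀ hl, mul_pos_iff_of_pos_left hl]

lemma integral_upBall_comp_dil (hα : 0 ≤ α) {l : ℝ} (hl : 0 < l) (s : ℝ) (k : Space n → ℝ) :
    (IntegrableOn k (upBall n α (l * s)) →
      IntegrableOn (fun p => k (dil α l p)) (upBall n α s)) ∧
    ∫ p in upBall n α s, k (dil α l p) =
      l ^ (-homDim n α) * ∫ p in upBall n α (l * s), k p := by
  have he : MeasurableEmbedding (dil α l : Space n → Space n) :=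
    (dilHomeo α hl).measurableEmbedding
  rw [← preimage_dil_upBall hα hl s]
  constructor
  · intro hk
    refine (he.integrableOn_map_iff (f := k) (μ := volume)).1 ?_
    rw [map_dil_volume hl, IntegrableOn, Measure.restrict_smul]
    exact hk.smul_measure ENNReal.ofReal_ne_top
  · rw [← he.setIntegral_map, map_dil_volume hl, Measure.restrict_smul, integral_smul_measure,
      ENNReal.toReal_ofReal (Real.rpow_pos_of_pos hl _).le, smul_eq_mul]

lemma partialD_comp_dil {f : Space n → ℝ} {l : ℝ} {p : Space n}
    (hf : DifferentiableAt ℝ f (dil α l p)) (i : Fin (n + 1)) :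
    partialD i (fun q => f (dil α l q)) p = l ^ weight α i * partialD i f (dil α l p) := by
  have h := hf.hasFDerivAt.comp p (dil α l).hasFDerivAt
  have h2 : dil α l (EuclideanSpace.single i (1 : ℝ)) =
      l ^ weight α i • EuclideanSpace.single i (1 : ℝ) := by
    ext j
    by_cases hij : j = i
    · subst hij; simp
    · simp [hij]
  rw [partialD, show fderiv ℝ (fun q => f (dil α l q)) p = _ from h.fderiv]
  simp [h2, partialD]

/-- Every `X_i` is homogeneous of degree one under the dilations, whatever its direction, which is
why the squared gradient scales by a single factor `l²`. -/
lemma fieldCoeff_dil {l : ℝ} (hl : 0 < l) (p : Space n) (i : Fin (n + 1)) :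
    fieldCoeff α i p * l ^ weight α i = l * fieldCoeff α i (dil α l p) := by
  refine Fin.lastCases ?_ (fun i => ?_) i
  · simp [fieldCoeff_last]
  · rw [fieldCoeff_castSucc, fieldCoeff_castSucc, zCoord_dil, weight_castSucc, abs_mul,
      abs_of_pos hl, Real.mul_rpow hl.le (abs_nonneg _), Real.rpow_add hl, Real.rpow_one]
    ring

lemma alphaGradSq_comp_dil {f : Space n → ℝ} {l : ℝ} (hl : 0 < l) {p : Space n}
    (hf : DifferentiableAt ℝ f (dil α l p)) :
    alphaGradSq α (fun q => f (dil α l q)) p = l ^ 2 * alphaGradSq α f (dil α l p) := by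
  rw [alphaGradSq_eq_sum, alphaGradSq_eq_sum, Finset.mul_sum]
  refine Finset.sum_congr rfl fun i _ => ?_
  rw [partialD_comp_dil hf, ← mul_assoc, fieldCoeff_dil hl]
  ring

namespace HalfRegular

variable {R : ℝ} {f : Space n → ℝ}

lemma comp_dil (hα : 0 ≤ α) {l : ℝ} (hl : 0 < l) (hf : HalfRegular α (l * R) f) :
    HalfRegular α R fun p => f (dil α l p) := by
  have hm : MapsTo (dil α l) (upBall n α R) (upBall n α (l * R)) := fun p hp => by
    rw [← preimage_dil_upBall hα hl R] at hp; exact hp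
  refine ⟨?_, fun p hp => ?_, fun i => ?_, fun r hr => ?_⟩
  · refine hf.cont.comp (dil α l).continuous.continuousOn fun p hp => ⟨?_, ?_⟩
    · rw [gauge_dil hα hl.le]; exact (mul_lt_mul_iff_right₀ hl).2 hp.1
    · rw [zCoord_dil]; exact mul_nonneg hl.le hp.2
  · exact (hf.diff _ (hm hp)).comp p (dil α l).differentiableAt
  · refine ContinuousOn.congr (f := fun p => l ^ weight α i * partialD i f (dil α l p)) ?_
      fun p hp => partialD_comp_dil (hf.diff _ (hm hp)) i
    exact continuousOn_const.mul ((hf.contD i).comp (dil α l).continuous.continuousOn hm)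
  · have h1 := ((integral_upBall_comp_dil hα hl r (alphaGradSq α f)).1
      (hf.energy _ ((mul_lt_mul_iff_right₀ hl).2 hr))).const_mul (l ^ 2)
    refine IntegrableOn.congr_fun h1 (fun p hp => ?_) (isOpen_upBall hα r).measurableSet
    exact (alphaGradSq_comp_dil hl (hf.diff _ (hm (upBall_mono hr.le hp)))).symm

/-- The gradient contributes `l²` and the change of volume `l^{-Q}`. This is the scaling under which
`radEnergy` of a dilate is a shift in `t`. -/
lemma upEnergy_comp_dil (hα : 0 ≤ α) {l : ℝ} (hl : 0 < l) (hf : HalfRegular α (l * R) f) {s : ℝ}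
    (hs : s ≤ R) :
    upEnergy α (fun p => f (dil α l p)) (fun p => f (dil α l p)) s =
      l ^ (2 - homDim n α) * upEnergy α f f (l * s) := by
  simp only [upEnergy, gradPair_self]
  have h1 : ∫ p in upBall n α s, alphaGradSq α (fun p => f (dil α l p)) p =
      ∫ p in upBall n α s, l ^ 2 * alphaGradSq α f (dil α l p) := by
    refine setIntegral_congr_fun (isOpen_upBall hα s).measurableSet fun p hp => ?_
    refine alphaGradSq_comp_dil hl (hf.diff _ ?_)
    have := upBall_mono hs hp
    rw [← preimage_dil_upBall hα hl R] at this
    exact this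
  rw [h1, integral_const_mul, (integral_upBall_comp_dil hα hl s _).2, ← mul_assoc,
    sub_eq_add_neg, Real.rpow_add hl, Real.rpow_two]

lemma upEnergy_add_le (hα : 0 ≤ α) {v : Space n → ℝ} (hv : HalfRegular α R v)
    (hf : HalfRegular α R f) {s : ℝ} (hs : s < R) :
    2 * upEnergy α v f s ≤ upEnergy α v v s + upEnergy α f f s := by
  simp only [upEnergy]
  rw [← integral_const_mul, ← integral_add (hv.integrableOn_gradPair hα hv hs)
    (hf.integrableOn_gradPair hα hf hs)]
  refine integral_mono ((hv.integrableOn_gradPair hα hf hs).const_mul 2)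
    ((hv.integrableOn_gradPair hα hv hs).add (hf.integrableOn_gradPair hα hf hs)) fun p => ?_
  have h1 := two_mul_abs_gradPair_le (α := α) v f p
  have h2 := le_abs_self (gradPair α v f p)
  simp only [gradPair_self]
  linarith

end HalfRegular

lemma upEnergy_comm (v f : Space n → ℝ) (s : ℝ) : upEnergy α v f s = upEnergy α f v s := by
  simp only [upEnergy, gradPair_comm v f]

lemma upEnergy_self_nonneg (f : Space n → ℝ) (s : ℝ) : 0 ≤ upEnergy α f f s := by
  refine integral_nonneg fun p => ?_
  simp only [Pi.zero_apply, gradPair_self]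
  exact alphaGradSq_nonneg _ _

/-! ### Solutions of the thin obstacle problem -/

lemma volume_zCoord_eq_zero : volume {p : Space n | zCoord p = 0} = 0 := by
  have hm : MeasurableSet {p : Space n | zCoord p = 0} :=
    (isClosed_eq continuous_zCoord continuous_const).measurableSet
  rw [← (measurePreserving_pt (n := n)).measure_preimage hm.nullMeasurableSet]
  have h : (fun q : Horiz n × ℝ => pt q.1 q.2) ⁻¹' {p | zCoord p = 0} = univ ×ˢ {0} := by
    ext q; simp
  rw [h, Measure.prod_prod]
  simp

namespace IsThinObstacleSolution

variable {r₀ : ℝ} {u : Space n → ℝ}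

lemma isOpen_cut (hα : 0 ≤ α) : IsOpen (pseudoBall n α r₀ ∩ {p | zCoord p ≠ 0}) :=
  (isOpen_pseudoBall hα r₀).inter (isOpen_ne_fun continuous_zCoord continuous_const)

lemma differentiableAt (hα : 0 ≤ α) (hu : IsThinObstacleSolution α r₀ u) {p : Space n}
    (hp : gauge α p < r₀) (hz : zCoord p ≠ 0) : DifferentiableAt ℝ u p :=
  ((hu.contDiffOn.contDiffAt ((isOpen_cut hα).mem_nhds ⟨hp, hz⟩)).differentiableAt (by simp))

lemma contDiffOn_partialD (hα : 0 ≤ α) (hu : IsThinObstacleSolution α r₀ u) (i : Fin (n + 1)) :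
    ContDiffOn ℝ 1 (partialD i u) (pseudoBall n α r₀ ∩ {p | zCoord p ≠ 0}) :=
  (hu.contDiffOn.fderiv_of_isOpen (isOpen_cut hα) (by norm_num)).clm_apply contDiffOn_const

theorem halfSolution (hα : 0 ≤ α) (hu : IsThinObstacleSolution α r₀ u) :
    HalfSolution α r₀ u := by
  have hsub : upBall n α r₀ ⊆ pseudoBall n α r₀ ∩ {p | zCoord p ≠ 0} := fun p hp =>
    ⟨hp.1, hp.2.ne'⟩
  refine ⟨⟨hu.continuousOn.mono fun p hp => hp.1, fun p hp =>
    hu.differentiableAt hα hp.1 hp.2.ne', fun i => ?_, fun r hr => ?_⟩,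
    ⟨fun i => partialD i (partialD i u), fun i => ?_, fun i p hp => ?_, fun p hp => ?_⟩,
    fun p hp hz => ?_⟩
  · exact (hu.contDiffOn_partialD hα i).continuousOn.mono hsub
  · rcases lt_or_ge 0 r with h | h
    · exact (hu.energy r ⟨h, hr⟩).mono_set fun p hp => hp.1
    · have : upBall n α r = ∅ := by
        ext p; simp only [upBall, mem_ofPred_eq, mem_empty_iff_false, iff_false]
        exact fun hp => absurd (gauge_nonneg (α := α) p) (not_le.2 (hp.1.trans_le h))
      rw [this]; exact integrableOn_empty
  · have h1 := (hu.contDiffOn_partialD hα i).fderiv_of_isOpen (m := 0) (isOpen_cut hα) (by norm_num)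
    exact ((h1.clm_apply contDiffOn_const).continuousOn).mono hsub
  · have h1 := ((hu.contDiffOn_partialD hα i).contDiffAt
      ((isOpen_cut hα).mem_nhds (hsub hp))).differentiableAt (by simp)
    exact h1.hasFDerivAt.hasLineDerivAt _
  · rw [← baouendi_eq_sum]
    exact hu.equation p hp.1 hp.2.ne'
  · obtain ⟨a, b, h1, -⟩ := hu.signorini p hp hz
    exact ⟨a, h1⟩

lemma partialD_reflectZ (hα : 0 ≤ α) (hu : IsThinObstacleSolution α r₀ u) {p : Space n}
    (hp : gauge α p < r₀) (hz : zCoord p ≠ 0) :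
    Dz u (reflectZ p) = -Dz u p ∧
      ∀ i : Fin n, partialD i.castSucc u (reflectZ p) = partialD i.castSucc u p := by
  have hd : DifferentiableAt ℝ u (reflectZ p) :=
    hu.differentiableAt hα (by simpa using hp) (by simpa using hz)
  have h1 := hd.hasFDerivAt.comp p (reflIso n).toContinuousLinearEquiv.hasFDerivAt
  have h2 : (fun q => u (reflectZ q)) =ᶠ[𝓝 p] u := by
    filter_upwards [(isOpen_pseudoBall hα r₀).mem_nhds hp] with q hq using hu.even q hq
  have h3 (i : Fin (n + 1)) : partialD i u p =
      fderiv ℝ u (reflectZ p) (reflectZ (EuclideanSpace.single i 1)) := by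
    rw [partialD, ← h2.fderiv_eq, show fderiv ℝ (fun q => u (reflectZ q)) p = _ from h1.fderiv]
    rfl
  constructor
  · have h4 : reflectZ (EuclideanSpace.single (Fin.last n) (1 : ℝ)) =
        -EuclideanSpace.single (Fin.last n) (1 : ℝ) := by
      ext j
      by_cases hj : j = Fin.last n <;> simp [reflectZ, hj]
    rw [Dz, h3, h4, map_neg, neg_neg]; rfl
  · intro i
    have h4 : reflectZ (EuclideanSpace.single i.castSucc (1 : ℝ)) =
        EuclideanSpace.single i.castSucc (1 : ℝ) := by
      ext j
      by_cases hj : j = Fin.last n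
      · subst hj; simp [reflectZ, (Fin.castSucc_lt_last i).ne']
      · simp [reflectZ, hj]
    rw [h3, h4]; rfl

lemma alphaGradSq_reflectZ (hα : 0 ≤ α) (hu : IsThinObstacleSolution α r₀ u) {p : Space n}
    (hp : gauge α p < r₀) (hz : zCoord p ≠ 0) :
    alphaGradSq α u (reflectZ p) = alphaGradSq α u p := by
  obtain ⟨h1, h2⟩ := hu.partialD_reflectZ hα hp hz
  simp [alphaGradSq, h1, h2]

/-- The Signorini conditions for the trace of `D_z u`. -/
lemma dzTrace_sign (hα : 0 ≤ α) (hu : IsThinObstacleSolution α r₀ u) {p : Space n}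
    (hp : gauge α p < r₀) (hz : zCoord p = 0) : dzTrace u p ≤ 0 ∧ dzTrace u p * u p = 0 := by
  obtain ⟨a, b, h1, h2, h3, h4⟩ := hu.signorini p hp hz
  rw [dzTrace_eq_of_tendsto hz h1]
  have hrp : reflectZ p = p := by
    have hz' : p (Fin.last n) = 0 := hz
    ext j
    by_cases hj : j = Fin.last n <;> simp [reflectZ, hj, hz']
  have h5 : Tendsto (reflectZ : Space n → Space n) (𝓝[{q | 0 < zCoord q}] p)
      (𝓝[{q | zCoord q < 0}] p) := by
    refine tendsto_nhdsWithin_iff.2 ⟨?_, ?_⟩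
    · have := ((reflIso n).continuous.tendsto p).mono_left
        (nhdsWithin_le_nhds (s := {q | 0 < zCoord q}))
      rw [reflIso_apply, hrp] at this
      exact this
    · filter_upwards [self_mem_nhdsWithin] with q hq
      have hq' : 0 < zCoord q := hq
      simpa using hq'
  have h6 : Tendsto (fun q => -Dz u q) (𝓝[{q | 0 < zCoord q}] p) (𝓝 b) := by
    refine (h2.comp h5).congr' ?_
    filter_upwards [self_mem_nhdsWithin,
      mem_nhdsWithin_of_mem_nhds ((isOpen_pseudoBall hα r₀).mem_nhds hp)] with q hq hq2
    have hq' : 0 < zCoord q := hq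
    exact (hu.partialD_reflectZ hα hq2 hq'.ne').1
  have : (𝓝[{q : Space n | 0 < zCoord q}] p).NeBot :=
    mem_closure_iff_nhdsWithin_neBot.1 (mem_closure_zCoord_pos hz.ge)
  -- By evenness the trace from below is minus the one from above, so the Signorini conditions
  -- become one-sided.
  have h7 : b = -a := tendsto_nhds_unique h6 h1.neg
  subst h7
  constructor
  · linarith
  · linarith

lemma thinPair_self (hα : 0 ≤ α) (hu : IsThinObstacleSolution α r₀ u) {s : ℝ} (hs : s ≤ r₀) :
    thinPair α u u s = 0 := by
  refine setIntegral_eq_zero_of_forall_eq_zero fun x hx => ?_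
  exact (hu.dzTrace_sign hα (lt_of_lt_of_le hx hs) (zCoord_pt _ _)).2

lemma thinPair_nonpos (hα : 0 ≤ α) (hu : IsThinObstacleSolution α r₀ u) {f : Space n → ℝ} {s : ℝ}
    (hs : s ≤ r₀) (hf : ∀ x, gauge α (pt x 0) < s → 0 ≤ f (pt x 0)) : thinPair α u f s ≤ 0 := by
  refine setIntegral_nonpos (isOpen_thin hα s).measurableSet fun x hx => ?_
  exact mul_nonpos_of_nonpos_of_nonneg
    (hu.dzTrace_sign hα (lt_of_lt_of_le hx hs) (zCoord_pt _ _)).1 (hf x hx)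

/-- The lower half contributes as much as the upper one by evenness, and the thin set, where
`fderiv` may take default values, has measure zero. -/
lemma dirichlet_eq (hα : 0 ≤ α) (hu : IsThinObstacleSolution α r₀ u) {r : ℝ}
    (hr : r ∈ Ioo 0 r₀) : dirichlet α u r = 2 * upEnergy α u u r := by
  have hU := (isOpen_upBall (n := n) hα r).measurableSet
  have hme := (reflIso n).toHomeomorph.measurableEmbedding
  have hmp : MeasurePreserving (reflectZ : Space n → Space n) volume volume :=
    (reflIso n).measurePreserving
  have hL : MeasurableSet (reflectZ ⁻¹' upBall n α r : Set (Space n)) := hmp.measurable hU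
  have hlow : ∫ p in reflectZ ⁻¹' upBall n α r, alphaGradSq α u p =
      ∫ p in upBall n α r, alphaGradSq α u p := by
    rw [← hmp.setIntegral_preimage_emb hme (alphaGradSq α u) (upBall n α r)]
    refine setIntegral_congr_fun hL fun p hp => ?_
    have hp' : gauge α p < r ∧ 0 < zCoord (reflectZ p) := by simpa [upBall] using hp
    rw [zCoord_reflectZ] at hp'
    exact (hu.alphaGradSq_reflectZ hα (hp'.1.trans hr.2) (by linarith [hp'.2])).symm
  have hE := hu.energy r hr
  have hset : pseudoBall n α r =ᵐ[volume] (upBall n α r ∪ reflectZ ⁻¹' upBall n α r :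
      Set (Space n)) := by
    have h0 : ∀ᵐ p : Space n, zCoord p ≠ 0 := by
      rw [ae_iff]; simpa using volume_zCoord_eq_zero (n := n)
    filter_upwards [h0] with p hp
    apply propext
    change gauge α p < r ↔ (gauge α p < r ∧ 0 < zCoord p) ∨
      (gauge α (reflectZ p) < r ∧ 0 < zCoord (reflectZ p))
    rw [gauge_reflectZ, zCoord_reflectZ, ← and_or_left]
    refine ⟨fun h => ⟨h, ?_⟩, fun h => h.1⟩
    rcases lt_or_gt_of_ne hp with h | h
    · right; linarith
    · left; exact h
  rw [dirichlet, setIntegral_congr_set hset, setIntegral_union _ hL, hlow, upEnergy]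
  · simp only [gradPair_self]; ring
  · exact hE.mono_set fun p hp => hp.1
  · refine hE.mono_set fun p hp => ?_
    have := hp.1
    rwa [gauge_reflectZ] at this
  · rw [Set.disjoint_left]
    intro p h1 h2
    have h3 := h2.2
    rw [zCoord_reflectZ] at h3
    linarith [h1.2]

end IsThinObstacleSolution

end

end BaouendiGrushin

namespace BaouendiGrushin

noncomputable section

variable {n : ℕ} {α : ℝ}

/-! ### Integrals over spheres as functions of the logarithmic radius -/

/-- The integral of `v w` over the pseudo-sphere of radius `e^t`. -/
def sphProd (α : ℝ) (v w : Space n → ℝ) (t : ℝ) : ℝ :=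
  ∫ y, v (polar α (y, t)) * w (polar α (y, t)) ∂sphMeas n α

lemma exp_lt_of_lt_log {R t : ℝ} (hR : 0 < R) (ht : t < Real.log R) : Real.exp t < R := by
  rwa [← Real.lt_log_iff_exp_lt hR]

lemma polar_mem_upBall (hα : 0 ≤ α) {R : ℝ} (hR : 0 < R) {y : Horiz n} (hy : y ∈ profDom n α 1)
    {t : ℝ} (ht : t < Real.log R) : polar α (y, t) ∈ upBall n α R := by
  obtain ⟨h1, h2⟩ := polar_mem hα hy t
  exact ⟨by rw [h1]; exact exp_lt_of_lt_log hR ht, h2⟩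

lemma aestronglyMeasurable_polar (hα : 0 ≤ α) {R : ℝ} (hR : 0 < R) {k : Space n → ℝ}
    (hk : ContinuousOn k (upBall n α R)) {t : ℝ} (ht : t < Real.log R) :
    AEStronglyMeasurable (fun y => k (polar α (y, t))) (sphMeas n α) := by
  have h1 : ContinuousOn (fun y => k (polar α (y, t))) (profDom n α 1) :=
    hk.comp ((continuous_polar hα).comp (by fun_prop : Continuous fun y : Horiz n =>
      (y, t))).continuousOn fun y hy => polar_mem_upBall hα hR hy ht
  exact (h1.aestronglyMeasurable (isOpen_profDom 1).measurableSet).mono_ac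
    (withDensity_absolutelyContinuous _ _)

lemma exists_polar_bound (hα : 0 ≤ α) {R : ℝ} (hR : 0 < R) {k : Space n → ℝ}
    (hk : ContinuousOn k (upBallClosed n α R)) {b : ℝ} (hb : b < Real.log R) :
    ∃ M, 0 ≤ M ∧ ∀ t ≤ b, ∀ y ∈ profDom n α 1, |k (polar α (y, t))| ≤ M := by
  obtain ⟨M, hM0, hM⟩ := HalfRegular.exists_bound hα hk (exp_lt_of_lt_log hR hb)
  refine ⟨M, hM0, fun t ht y hy => ?_⟩
  obtain ⟨h1, h2⟩ := polar_mem hα hy t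
  exact hM _ (by rw [h1]; exact Real.exp_le_exp.2 ht) h2.le

lemma integrable_polar (hα : 0 ≤ α) {R : ℝ} (hR : 0 < R) {k : Space n → ℝ}
    (hk : ContinuousOn k (upBallClosed n α R)) {t : ℝ} (ht : t < Real.log R) :
    Integrable (fun y => k (polar α (y, t))) (sphMeas n α) := by
  have := isFiniteMeasure_sphMeas (n := n) hα
  obtain ⟨M, -, hM⟩ := exists_polar_bound hα hR hk ht
  refine Integrable.mono' (integrable_const M)
    (aestronglyMeasurable_polar hα hR (hk.mono (upBall_subset_closed R)) ht) ?_
  filter_upwards [ae_sphMeas_mem] with y hy using hM t le_rfl y hy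

lemma continuousOn_integral_mul_polar (hα : 0 ≤ α) {R : ℝ} (hR : 0 < R) {k : Space n → ℝ}
    (hk : ContinuousOn k (upBallClosed n α R)) {F : Horiz n → ℝ} (hF : Integrable F (sphMeas n α)) :
    ContinuousOn (fun t => ∫ y, F y * k (polar α (y, t)) ∂sphMeas n α) (Iio (Real.log R)) := by
  intro t ht
  refine ContinuousAt.continuousWithinAt ?_
  obtain ⟨b, htb, hb⟩ := exists_between (show t < Real.log R from ht)
  obtain ⟨M, hM0, hM⟩ := exists_polar_bound hα hR hk hb
  have hkU := hk.mono (upBall_subset_closed R)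
  refine continuousAt_of_dominated (bound := fun y => ‖F y‖ * M) ?_ ?_ (hF.norm.mul_const M) ?_
  · filter_upwards [Iio_mem_nhds htb] with s hs
    exact hF.aestronglyMeasurable.mul
      (aestronglyMeasurable_polar hα hR hkU (lt_trans hs hb))
  · filter_upwards [Iio_mem_nhds htb] with s hs
    filter_upwards [ae_sphMeas_mem] with y hy
    rw [norm_mul]
    exact mul_le_mul_of_nonneg_left (hM s (le_of_lt hs) y hy) (norm_nonneg _)
  · filter_upwards [ae_sphMeas_mem] with y hy
    refine continuousAt_const.mul ?_
    have h1 : ContinuousAt k (polar α (y, t)) :=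
      hkU.continuousAt ((isOpen_upBall hα R).mem_nhds (polar_mem_upBall hα hR hy ht))
    exact ContinuousAt.comp (f := fun t : ℝ => polar α (y, t)) h1
      ((continuous_polar hα).comp (by fun_prop : Continuous fun t : ℝ => (y, t))).continuousAt

/-- The fundamental theorem of calculus on each ray, then Fubini. Only joint integrability of the
derivative is needed; no domination uniform in `y` is available for `Z_α u`. -/
lemma integral_sub_eq_integral_deriv {Φ Φ' : Horiz n × ℝ → ℝ} {a b : ℝ} (hab : a ≤ b)
    (hd : ∀ y ∈ profDom n α 1, ∀ t ∈ Icc a b, HasDerivAt (fun s => Φ (y, s)) (Φ' (y, t)) t)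
    (hi : Integrable Φ' ((sphMeas n α).prod (volume.restrict (Icc a b))))
    (ha : Integrable (fun y => Φ (y, a)) (sphMeas n α))
    (hb : Integrable (fun y => Φ (y, b)) (sphMeas n α)) :
    (∫ y, Φ (y, b) ∂sphMeas n α) - ∫ y, Φ (y, a) ∂sphMeas n α =
      ∫ t in a..b, ∫ y, Φ' (y, t) ∂sphMeas n α := by
  rw [← integral_sub hb ha, intervalIntegral.integral_of_le hab, ← integral_Icc_eq_integral_Ioc,
    ← integral_integral_swap (f := fun y t => Φ' (y, t)) hi]
  refine integral_congr_ae ?_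
  filter_upwards [ae_sphMeas_mem, hi.prod_right_ae] with y hy hyi
  rw [integral_Icc_eq_integral_Ioc, ← intervalIntegral.integral_of_le hab]
  refine (intervalIntegral.integral_eq_sub_of_hasDerivAt (f := fun t => Φ (y, t))
    (f' := fun t => Φ' (y, t)) (fun t ht => ?_) ?_).symm
  · rw [uIcc_of_le hab] at ht
    exact hd y hy t ht
  · rw [intervalIntegrable_iff_integrableOn_Icc_of_le hab]
    exact hyi

lemma hasDerivAt_polar (hα : 0 ≤ α) {R : ℝ} (hR : 0 < R) {v : Space n → ℝ}
    (hv : HalfRegular α R v) {y : Horiz n} (hy : y ∈ profDom n α 1) {t : ℝ}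
    (ht : t < Real.log R) :
    HasDerivAt (fun s => v (polar α (y, s))) (Zfield α v (polar α (y, t))) t :=
  hasDerivAt_dil_exp (hv.diff _ (polar_mem_upBall hα hR hy ht))

/-- An identity for the derivative known only almost everywhere is enough inside the integral;
continuity of `G` then upgrades it to every point. -/
lemma hasDerivAt_of_forall_sub_eq_integral {H G : ℝ → ℝ} {L : ℝ} (hG : ContinuousOn G (Iio L))
    (h : ∀ a b, a ≤ b → b < L → H b - H a = ∫ t in a..b, G t) {t : ℝ} (ht : t < L) :
    HasDerivAt H (G t) t := by
  have hi : IntervalIntegrable G volume (t - 1) t :=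
    (hG.mono fun s hs => by
      rw [uIcc_of_le (by linarith)] at hs; exact lt_of_le_of_lt hs.2 ht).intervalIntegrable
  have hm : StronglyMeasurableAtFilter G (𝓝 t) volume :=
    hG.stronglyMeasurableAtFilter isOpen_Iio t ht
  have h1 := (intervalIntegral.integral_hasDerivAt_right hi hm
    (hG.continuousAt (isOpen_Iio.mem_nhds ht))).const_add (H (t - 1))
  refine h1.congr_of_eventuallyEq ?_
  filter_upwards [Ioo_mem_nhds (show t - 1 < t by linarith) ht] with s hs
  rw [← h (t - 1) s hs.1.le hs.2]
  ring

/-- Derivative of the product integral over spheres. -/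
theorem HalfSolution.hasDerivAt_sphProd (hα : 0 ≤ α) {R : ℝ} (hR : 0 < R) {v w : Space n → ℝ}
    (hv : HalfSolution α R v) (hw : HalfSolution α R w) {t : ℝ} (ht : t < Real.log R) :
    HasDerivAt (sphProd α v w) (Real.exp ((2 - homDim n α) * t) * (2 * upEnergy α v w (Real.exp t) +
      thinPair α v w (Real.exp t) + thinPair α w v (Real.exp t))) t := by
  have hmaps : MapsTo Real.exp (Iio (Real.log R)) (Ioo 0 R) := fun t ht =>
    ⟨Real.exp_pos t, exp_lt_of_lt_log hR ht⟩
  have hexp : ContinuousOn Real.exp (Iio (Real.log R)) := Real.continuous_exp.continuousOn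
  have hcv := hv.toHalfRegular
  have hcw := hw.toHalfRegular
  refine hasDerivAt_of_forall_sub_eq_integral (H := sphProd α v w)
    (G := fun t => Real.exp ((2 - homDim n α) * t) * (2 * upEnergy α v w (Real.exp t) +
      thinPair α v w (Real.exp t) + thinPair α w v (Real.exp t))) ?_ (fun a b hab hb => ?_) ht
  · have h0 : Continuous fun t : ℝ => Real.exp ((2 - homDim n α) * t) := by fun_prop
    have h1 := (continuousOn_upEnergy hα hcv hcw).comp hexp hmaps
    have h2 := (continuousOn_thinPair hα hv hcw).comp hexp hmaps
    have h3 := (continuousOn_thinPair hα hw hcv).comp hexp hmaps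
    exact h0.continuousOn.mul (((continuousOn_const.mul h1).add h2).add h3)
  · have hbR := exp_lt_of_lt_log hR hb
    have i1 := hv.integrable_sphPair hα hcw (a := a) hbR
    have i2 := hw.integrable_sphPair hα hcv (a := a) hbR
    have hmul := hcv.cont.mul hcw.cont
    have := integral_sub_eq_integral_deriv (α := α)
      (Φ := fun q => v (polar α q) * w (polar α q))
      (Φ' := fun q => w (polar α q) * Zfield α v (polar α q) +
        v (polar α q) * Zfield α w (polar α q)) hab ?_ (i1.add i2)
      (integrable_polar hα hR hmul (hab.trans_lt hb)) (integrable_polar hα hR hmul hb)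
    · rw [sphProd, sphProd, this]
      refine intervalIntegral.integral_congr_ae ?_
      have j1 := i1.prod_left_ae
      have j2 := i2.prod_left_ae
      rw [ae_restrict_iff' measurableSet_Icc] at j1 j2
      -- The slice identity is used twice with the roles exchanged, and the two energy pairings
      -- coincide by symmetry.
      filter_upwards [hv.slice_identity hα hR hcw, hw.slice_identity hα hR hcv, j1, j2]
        with t h1 h2 h3 h4 htm
      rw [uIoc_of_le hab] at htm
      have htm' : t ∈ Icc a b := ⟨htm.1.le, htm.2⟩
      have h5 := h1 (htm.2.trans_lt hb)
      have h6 := h2 (htm.2.trans_lt hb)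
      rw [integral_add (h3 htm') (h4 htm')]
      change sphPair α v w t + sphPair α w v t = _
      rw [upEnergy_comm w v] at h6
      have e1 : Real.exp ((2 - homDim n α) * t) * Real.exp ((homDim n α - 2) * t) = 1 := by
        rw [← Real.exp_add, ← Real.exp_zero]; congr 1; ring
      linear_combination (-(sphPair α v w t + sphPair α w v t)) * e1 -
        Real.exp ((2 - homDim n α) * t) * h5 - Real.exp ((2 - homDim n α) * t) * h6
    · intro y hy t ht
      have ht' : t < Real.log R := ht.2.trans_lt hb
      refine ((hasDerivAt_polar hα hR hcv hy ht').mul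
        (hasDerivAt_polar hα hR hcw hy ht')).congr_deriv ?_
      ring

/-- The constant `1` as test function gives integrability of `Z_α u` itself from
`integrable_sphPair`. -/
lemma halfRegular_const (R c : ℝ) : HalfRegular α R fun _ : Space n => c := by
  have h (i : Fin (n + 1)) (p : Space n) : partialD i (fun _ => c) p = 0 := by simp [partialD]
  refine ⟨continuousOn_const, fun _ _ => differentiableAt_const c, fun i => ?_, fun r _ => ?_⟩
  · exact (continuousOn_const (c := (0 : ℝ))).congr fun p _ => h i p
  · have : alphaGradSq α (fun _ : Space n => c) = fun _ => 0 := by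
      funext p; simp [alphaGradSq_eq_sum, h]
    rw [this]; exact integrableOn_zero

end

end BaouendiGrushin

namespace BaouendiGrushin

noncomputable section

variable {n : ℕ} {α : ℝ}

/-! ### A convexity criterion -/

/-- A function whose slope at the right end point of every interval dominates the secant slope up to
a cubic error is convex. -/
lemma monotoneOn_of_secant_le {F f : ℝ → ℝ} {L C : ℝ} (hC : 0 ≤ C)
    (hF : ∀ t < L, HasDerivAt F (f t) t) (hfc : ContinuousOn f (Iio L)) (hf0 : ∀ t < L, 0 ≤ f t)
    (h : ∀ s t, s < t → t < L → F t - F s - C * (F t - F s) ^ 3 ≤ (t - s) * f t) :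
    MonotoneOn f (Iio L) := by
  intro s₀ _ t₀ ht₀ hst
  have htL : t₀ < L := ht₀
  by_contra hlt
  rw [not_le] at hlt
  have hst' : s₀ < t₀ := lt_of_le_of_ne hst fun h => by rw [h] at hlt; exact lt_irrefl _ hlt
  have hsub : Icc s₀ t₀ ⊆ Iio L := fun x hx => lt_of_le_of_lt hx.2 htL
  obtain ⟨M, hM⟩ := isCompact_Icc.exists_bound_of_continuousOn (hfc.mono hsub)
  have hM0 : 0 ≤ M := (norm_nonneg _).trans (hM s₀ (left_mem_Icc.2 hst))
  -- The slope is half of what would restore equality, so `f + ε t` is still larger at `s₀` than at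
  -- `t₀` and its minimum `t₁` is not at `s₀`.
  set ε := (f s₀ - f t₀) / (2 * (t₀ - s₀)) with hε
  have hε0 : 0 < ε := div_pos (by linarith) (by linarith)
  have hεt : ε * (t₀ - s₀) = (f s₀ - f t₀) / 2 := by
    rw [hε]; have : t₀ - s₀ ≠ 0 := by linarith
    field_simp
  obtain ⟨t₁, ht₁, hmin⟩ := isCompact_Icc.exists_isMinOn (nonempty_Icc.2 hst)
    ((hfc.mono hsub).add (continuousOn_const.mul continuousOn_id : ContinuousOn
      (fun t => ε * id t) (Icc s₀ t₀)))
  replace hmin : ∀ x ∈ Icc s₀ t₀, f t₁ + ε * t₁ ≤ f x + ε * x := isMinOn_iff.1 hmin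
  have hne : s₀ < t₁ := by
    refine lt_of_le_of_ne ht₁.1 fun h => ?_
    have := hmin t₀ (right_mem_Icc.2 hst)
    rw [← h] at this
    nlinarith
  -- Minimality of `f + ε t` at `t₁`, integrated from `s` to `t₁`, gives `F t₁ - F s ≥ (t₁ - s) f t₁
  -- + (ε / 2) (t₁ - s)²`. The hypothesis allows only a cubic excess, at most `C (M (t₁ - s))³`.
  have key : ∀ s, s₀ ≤ s → s < t₁ → ε / 2 ≤ C * M ^ 3 * (t₁ - s) := by
    intro s hs hst1
    have hI (x : ℝ) (hx : x ∈ Icc s t₁) : x ∈ Icc s₀ t₀ := ⟨hs.trans hx.1, hx.2.trans ht₁.2⟩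
    have hcF : ContinuousOn F (Icc s t₁) := fun x hx =>
      (hF x (hsub (hI x hx))).continuousAt.continuousWithinAt
    obtain ⟨ξ, hξ, e1⟩ := exists_hasDerivAt_eq_slope F f hst1 hcF
      fun x hx => hF x (hsub (hI x (Ioo_subset_Icc_self hx)))
    have hG (x : ℝ) (hx : x ∈ Icc s t₁) :
        HasDerivAt (fun x => F x + ε / 2 * x ^ 2) (f x + ε * x) x := by
      refine ((hF x (hsub (hI x hx))).add ((hasDerivAt_pow 2 x).const_mul (ε / 2))).congr_deriv ?_
      norm_num; ring
    obtain ⟨η, hη, e2⟩ := exists_hasDerivAt_eq_slope (fun x => F x + ε / 2 * x ^ 2)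
      (fun x => f x + ε * x) hst1 (fun x hx => (hG x hx).continuousAt.continuousWithinAt)
      fun x hx => hG x (Ioo_subset_Icc_self hx)
    have hpos : 0 < t₁ - s := by linarith
    rw [eq_div_iff hpos.ne'] at e1 e2
    have h1 := hmin η (hI η (Ioo_subset_Icc_self hη))
    have h2 := h s t₁ hst1 (hsub ht₁)
    have hx0 : 0 ≤ F t₁ - F s := by
      rw [← e1]; exact mul_nonneg (hf0 _ (hsub (hI ξ (Ioo_subset_Icc_self hξ)))) hpos.le
    have hxM : F t₁ - F s ≤ M * (t₁ - s) := by
      rw [← e1]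
      exact mul_le_mul_of_nonneg_right
        ((le_abs_self _).trans (hM _ (hI ξ (Ioo_subset_Icc_self hξ)))) hpos.le
    have h3 : C * (F t₁ - F s) ^ 3 ≤ C * (M * (t₁ - s)) ^ 3 :=
      mul_le_mul_of_nonneg_left (pow_le_pow_left₀ hx0 hxM 3) hC
    have h4 : (f t₁ + ε * t₁) * (t₁ - s) ≤ F t₁ + ε / 2 * t₁ ^ 2 - (F s + ε / 2 * s ^ 2) := by
      rw [← e2]; exact mul_le_mul_of_nonneg_right h1 hpos.le
    have h5 : (t₁ - s) ^ 2 * (ε / 2) ≤ (t₁ - s) ^ 2 * (C * M ^ 3 * (t₁ - s)) := by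
      nlinarith
    exact le_of_mul_le_mul_left h5 (by positivity)
  set K := C * M ^ 3 with hK
  have hK0 : 0 ≤ K := by positivity
  -- So short a step makes `K η < ε / 2`, against `key`.
  set η := min (t₁ - s₀) (ε / (4 * (K + 1))) with hη
  have hη0 : 0 < η := lt_min (by linarith) (by positivity)
  have h1 := key (t₁ - η) (by linarith [min_le_left (t₁ - s₀) (ε / (4 * (K + 1)))]) (by linarith)
  have h2 : η ≤ ε / (4 * (K + 1)) := min_le_right _ _
  rw [le_div_iff₀ (by positivity)] at h2
  nlinarith

/-- The quadratic terms of `1 - e^{-x}` and `(1 - e^{-2x}) / 4` cancel. The upper Taylor bound of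
order two at `x` and the lower one of order three at `2x` leave exactly the error `2x³ / 3`. -/
lemma exp_neg_secant {x : ℝ} (hx : 0 ≤ x) :
    x - 2 / 3 * x ^ 3 ≤ 2 * (1 - Real.exp (-x) - (1 - Real.exp (-x) ^ 2) / 4) := by
  have h1 : ∀ y : ℝ, 0 ≤ y → 1 - y ≤ Real.exp (-y) := fun y _ => by
    linarith [Real.add_one_le_exp (-y)]
  have hd (c : ℝ) (y : ℝ) : HasDerivAt (fun y : ℝ => c * Real.exp (-y)) (-(c * Real.exp (-y))) y := by
    refine (((hasDerivAt_id y).neg.exp).const_mul c).congr_deriv ?_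
    simp
  have h2 : ∀ y : ℝ, 0 ≤ y → Real.exp (-y) ≤ 1 - y + y ^ 2 / 2 := by
    have hm : MonotoneOn (fun y : ℝ => 1 - y + y ^ 2 / 2 - 1 * Real.exp (-y)) (Ici 0) := by
      have hd' (y : ℝ) : HasDerivAt (fun y : ℝ => 1 - y + y ^ 2 / 2 - 1 * Real.exp (-y))
          (-1 + y + Real.exp (-y)) y := by
        refine ((((hasDerivAt_id y).const_sub 1).add ((hasDerivAt_pow 2 y).div_const 2)).sub
          (hd 1 y)).congr_deriv ?_
        norm_num
      refine monotoneOn_of_deriv_nonneg (convex_Ici 0)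
        (fun y _ => (hd' y).continuousAt.continuousWithinAt)
        (fun y _ => (hd' y).differentiableAt.differentiableWithinAt) fun y hy => ?_
      rw [interior_Ici] at hy
      rw [(hd' y).deriv]
      linarith [h1 y (le_of_lt hy)]
    intro y hy
    have := hm self_mem_Ici hy hy
    simp at this
    linarith
  have h3 : ∀ y : ℝ, 0 ≤ y → 1 - y + y ^ 2 / 2 - y ^ 3 / 6 ≤ Real.exp (-y) := by
    have hm : MonotoneOn (fun y : ℝ => 1 * Real.exp (-y) - (1 - y + y ^ 2 / 2 - y ^ 3 / 6))
        (Ici 0) := by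
      have hd' (y : ℝ) : HasDerivAt
          (fun y : ℝ => 1 * Real.exp (-y) - (1 - y + y ^ 2 / 2 - y ^ 3 / 6))
          (-Real.exp (-y) - (-1 + y - y ^ 2 / 2)) y := by
        refine ((hd 1 y).sub ((((hasDerivAt_id y).const_sub 1).add
          ((hasDerivAt_pow 2 y).div_const 2)).sub ((hasDerivAt_pow 3 y).div_const 6))).congr_deriv ?_
        norm_num; ring
      refine monotoneOn_of_deriv_nonneg (convex_Ici 0)
        (fun y _ => (hd' y).continuousAt.continuousWithinAt)
        (fun y _ => (hd' y).differentiableAt.differentiableWithinAt) fun y hy => ?_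
      rw [interior_Ici] at hy
      rw [(hd' y).deriv]
      linarith [h2 y (le_of_lt hy)]
    intro y hy
    have := hm self_mem_Ici hy hy
    simp at this
    linarith
  have h4 := h2 x hx
  have h5 := h3 (2 * x) (by linarith)
  have h6 : Real.exp (-(2 * x)) = Real.exp (-x) ^ 2 := by
    rw [← Real.exp_nat_mul]; congr 1; push_cast; ring
  rw [h6] at h5
  nlinarith

/-! ### Monotonicity of the frequency -/

/-- The normalized energy as a function of the logarithmic radius. -/
def radEnergy (α : ℝ) (u : Space n → ℝ) (t : ℝ) : ℝ :=
  Real.exp ((2 - homDim n α) * t) * upEnergy α u u (Real.exp t)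

lemma radEnergy_nonneg (u : Space n → ℝ) (t : ℝ) : 0 ≤ radEnergy α u t :=
  mul_nonneg (Real.exp_pos _).le (upEnergy_self_nonneg u _)

lemma HalfRegular.continuousOn_radEnergy (hα : 0 ≤ α) {R : ℝ} (hR : 0 < R) {u : Space n → ℝ}
    (hu : HalfRegular α R u) : ContinuousOn (radEnergy α u) (Iio (Real.log R)) := by
  have h0 : Continuous fun t : ℝ => Real.exp ((2 - homDim n α) * t) := by fun_prop
  exact h0.continuousOn.mul ((continuousOn_upEnergy hα hu hu).comp
    Real.continuous_exp.continuousOn fun t ht => ⟨Real.exp_pos t, exp_lt_of_lt_log hR ht⟩)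

lemma dil_polar (y : Horiz n) (s τ : ℝ) :
    dil α (Real.exp τ) (polar α (y, s)) = polar α (y, s + τ) := by
  change dil α (Real.exp τ) (dil α (Real.exp s) _) = dil α (Real.exp (s + τ)) _
  rw [dil_dil (Real.exp_pos _).le (Real.exp_pos _).le, ← Real.exp_add, add_comm τ s]

lemma measurable_indicator_of_continuousOn {Y : Type*} [TopologicalSpace Y] [MeasurableSpace Y]
    [BorelSpace Y] {f : Y → ℝ} {U : Set Y} (hU : IsOpen U) (hf : ContinuousOn f U) :
    Measurable (U.indicator f) := by
  classical
  have := hf.measurable_piecewise (continuousOn_const (c := (0 : ℝ))) hU.measurableSet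
  convert this using 1
  exact (piecewise_eq_indicator (f := f)).symm

namespace IsThinObstacleSolution

variable {R : ℝ} {u : Space n → ℝ}

lemma hasDerivAt_sphProd (hα : 0 ≤ α) (hR : 0 < R) (hu : IsThinObstacleSolution α R u) {t : ℝ}
    (ht : t < Real.log R) : HasDerivAt (sphProd α u u) (2 * radEnergy α u t) t := by
  have hs := hu.halfSolution hα
  refine (hs.hasDerivAt_sphProd hα hR hs ht).congr_deriv ?_
  rw [hu.thinPair_self hα (exp_lt_of_lt_log hR ht).le, radEnergy]
  ring

/-- The comparison of `u` with its dilate `f = u ∘ δ_{e^τ}` in the slice identity. The obstacle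
condition makes `f ≥ 0` on the thin ball, so the thin term can be dropped; the mixed energy is at
most the mean of the two energies, and the energy of `f` at `s` scales to that of `u` at `s + τ`. -/
lemma integral_mul_Zfield_le (hα : 0 ≤ α) (hR : 0 < R) (hu : IsThinObstacleSolution α R u) {τ : ℝ}
    (hτ : 0 ≤ τ) : ∀ᵐ s : ℝ, s + τ < Real.log R →
      ∫ y, u (polar α (y, s + τ)) * Zfield α u (polar α (y, s)) ∂sphMeas n α ≤
        (radEnergy α u s + radEnergy α u (s + τ)) / 2 := by
  have hl : 0 < Real.exp τ := Real.exp_pos τ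
  set R' := R / Real.exp τ with hR'
  have hR'0 : 0 < R' := by positivity
  have hlR : Real.exp τ * R' = R := by rw [hR']; field_simp
  have hR'R : R' ≤ R := div_le_self hR.le (Real.one_le_exp hτ)
  have hlog : Real.log R' = Real.log R - τ := by rw [hR', Real.log_div hR.ne' hl.ne', Real.log_exp]
  have hs := hu.halfSolution hα
  have hs' := hs.mono hR'R
  have hf : HalfRegular α R' fun p => u (dil α (Real.exp τ) p) :=
    HalfRegular.comp_dil hα hl (by rw [hlR]; exact hs.toHalfRegular)
  filter_upwards [hs'.slice_identity hα hR'0 hf] with s h1 hsτ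
  have hsR : s < Real.log R' := by rw [hlog]; linarith
  have hes : Real.exp s < R' := exp_lt_of_lt_log hR'0 hsR
  have h2 := h1 hsR
  have h3 : thinPair α u (fun p => u (dil α (Real.exp τ) p)) (Real.exp s) ≤ 0 := by
    refine hu.thinPair_nonpos hα (hes.le.trans hR'R) fun x hx => ?_
    refine hu.obstacle _ ?_ (by rw [zCoord_dil, zCoord_pt, mul_zero])
    change gauge α _ < R
    rw [gauge_dil hα hl.le, ← hlR]
    exact (mul_lt_mul_iff_right₀ hl).2 (hx.trans hes)
  have h4 := hs'.toHalfRegular.upEnergy_add_le hα hf hes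
  rw [HalfRegular.upEnergy_comp_dil hα hl (by rw [hlR]; exact hs.toHalfRegular) hes.le] at h4
  have h5 : sphPair α u (fun p => u (dil α (Real.exp τ) p)) s =
      ∫ y, u (polar α (y, s + τ)) * Zfield α u (polar α (y, s)) ∂sphMeas n α := by
    simp only [sphPair, dil_polar]
  rw [← h5]
  have h6 : Real.exp ((homDim n α - 2) * s) * sphPair α u (fun p => u (dil α (Real.exp τ) p)) s ≤
      (upEnergy α u u (Real.exp s) + Real.exp τ ^ (2 - homDim n α) *
        upEnergy α u u (Real.exp τ * Real.exp s)) / 2 := by linarith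
  have h7 := mul_le_mul_of_nonneg_left h6 (Real.exp_pos ((2 - homDim n α) * s)).le
  rw [← mul_assoc, ← Real.exp_add, show (2 - homDim n α) * s + (homDim n α - 2) * s = 0 by ring,
    Real.exp_zero, one_mul] at h7
  refine h7.trans_eq ?_
  rw [radEnergy, radEnergy, mul_add (2 - homDim n α) s τ, Real.exp_add, add_comm s τ,
    Real.exp_add τ s, ← Real.exp_mul, mul_comm τ]
  ring

/-- The exceptional set of `s` depends on `τ = t - s`. The bad pairs form a measurable set in the
plane, and the measure-preserving shear `(τ, s) ↦ (τ + s, s)` shows that it is null. -/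
lemma ae_ae_integral_mul_Zfield_le (hα : 0 ≤ α) (hR : 0 < R)
    (hu : IsThinObstacleSolution α R u) : ∀ᵐ t : ℝ, ∀ᵐ s : ℝ, s < t → t < Real.log R →
      ∫ y, u (polar α (y, t)) * Zfield α u (polar α (y, s)) ∂sphMeas n α ≤
        (radEnergy α u s + radEnergy α u t) / 2 := by
  have hs := hu.halfSolution hα
  set L := Real.log R with hL
  -- Truncation to the open sets of continuity makes the functions Borel everywhere, which
  -- measurability of the bad set requires.
  set ub := (upBall n α R).indicator u with hub
  set zb := (upBall n α R).indicator (Zfield α u) with hzb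
  set db := (Iio L).indicator (radEnergy α u) with hdb
  have hubm : Measurable ub :=
    measurable_indicator_of_continuousOn (isOpen_upBall hα R)
      (hs.cont.mono (upBall_subset_closed R))
  have hzbm : Measurable zb :=
    measurable_indicator_of_continuousOn (isOpen_upBall hα R) (continuousOn_Zfield hs.contD)
  have hdbm : Measurable db :=
    measurable_indicator_of_continuousOn isOpen_Iio
      (hs.toHalfRegular.continuousOn_radEnergy hα hR)
  set g : ℝ × ℝ → ℝ := fun q => ∫ y, ub (polar α (y, q.1)) * zb (polar α (y, q.2)) ∂sphMeas n α
    with hg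
  have hgm : Measurable g := by
    have hp := (continuous_polar (n := n) hα).measurable
    have h1 : Measurable fun x : (ℝ × ℝ) × Horiz n =>
        ub (polar α (x.2, x.1.1)) * zb (polar α (x.2, x.1.2)) :=
      (hubm.comp (hp.comp (by fun_prop))).mul (hzbm.comp (hp.comp (by fun_prop)))
    exact h1.stronglyMeasurable.integral_prod_right.measurable
  have hgeq {t s : ℝ} (ht : t < L) (hs : s < L) : g (t, s) =
      ∫ y, u (polar α (y, t)) * Zfield α u (polar α (y, s)) ∂sphMeas n α := by
    refine integral_congr_ae ?_
    filter_upwards [ae_sphMeas_mem] with y hy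
    simp only [hub, hzb, indicator_of_mem (polar_mem_upBall hα hR hy ht),
      indicator_of_mem (polar_mem_upBall hα hR hy hs)]
  set B : Set (ℝ × ℝ) := {q | q.2 < q.1 ∧ q.1 < L ∧ (db q.2 + db q.1) / 2 < g q} with hB
  have hBm : MeasurableSet B := by
    refine (measurableSet_lt measurable_snd measurable_fst).inter
      ((measurableSet_lt measurable_fst measurable_const).inter (measurableSet_lt ?_ hgm))
    exact ((hdbm.comp measurable_snd).add (hdbm.comp measurable_fst)).div_const 2
  have hB0 : (volume.prod volume : Measure (ℝ × ℝ)) B = 0 := by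
    rw [← (measurePreserving_add_prod (volume : Measure ℝ) (volume : Measure ℝ)).measure_preimage
      hBm.nullMeasurableSet,
      Measure.measure_prod_null ((measurePreserving_add_prod (volume : Measure ℝ) (volume : Measure ℝ)).measurable hBm)]
    refine Eventually.of_forall fun τ => ?_
    rcases le_or_gt τ 0 with hτ | hτ
    · refine measure_mono_null (t := ∅) (fun s hsB => ?_) measure_empty
      have : s < τ + s := hsB.1
      linarith
    · have h1 := hu.integral_mul_Zfield_le hα hR hτ.le
      rw [ae_iff] at h1
      refine measure_mono_null (fun s hsB => ?_) h1
      obtain ⟨b1, b2, b3⟩ := hsB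
      simp only at b1 b2 b3
      have hsL : s < L := b1.trans b2
      intro hc
      rw [hgeq b2 hsL, hdb, indicator_of_mem (show s ∈ Iio L from hsL),
        indicator_of_mem (show τ + s ∈ Iio L from b2), add_comm τ s] at b3
      rw [add_comm τ s] at b2
      exact absurd (hc b2) (not_le.2 b3)
  have h2 := Measure.ae_ae_of_ae_prod (p := fun q => q ∉ B)
    (show ∀ᵐ q ∂((volume : Measure ℝ).prod (volume : Measure ℝ)), q ∉ B from
      measure_eq_zero_iff_ae_notMem.1 hB0)
  filter_upwards [h2] with t ht
  filter_upwards [ht] with s hsB hst htL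
  by_contra hc
  rw [not_le, ← hgeq htL (hst.trans htL)] at hc
  refine hsB ⟨hst, htL, ?_⟩
  simp only [hdb, indicator_of_mem (show s ∈ Iio L from hst.trans htL),
    indicator_of_mem (show t ∈ Iio L from htL)]
  exact hc

end IsThinObstacleSolution

end

end BaouendiGrushin

/-! ### Positivity of the height and convexity of its logarithm. -/

namespace BaouendiGrushin

noncomputable section

variable {n : ℕ} {α : ℝ}

lemma exists_polar_eq (hα : 0 ≤ α) {p : Space n} (hp : 0 < zCoord p) :
    ∃ y ∈ profDom n α 1, polar α (y, Real.log (gauge α p)) = p := by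
  have hg := gauge_pos_of_zCoord_ne_zero hα hp.ne'
  set q := dil α (gauge α p)⁻¹ p with hq
  have hqz : 0 < zCoord q := by rw [zCoord_dil]; positivity
  have hqg : gauge α (pt (horiz q) (zCoord q)) = 1 := by
    rw [pt_horiz_zCoord, hq, gauge_dil hα (inv_pos.2 hg).le, inv_mul_cancel₀ hg.ne']
  refine ⟨horiz q, ?_, ?_⟩
  · have := mem_profDom_gauge hα (x := horiz q) hqz
    rwa [hqg] at this
  · have h1 := prof_gauge hα (horiz q) hqz
    rw [hqg] at h1
    change dil α (Real.exp (Real.log (gauge α p))) (pt (horiz q) (prof α 1 (horiz q))) = p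
    rw [h1, pt_horiz_zCoord, Real.exp_log hg, hq, dil_dil hg.le (inv_pos.2 hg).le,
      mul_inv_cancel₀ hg.ne', dil_one]

/-- The density is positive on `profDom`, so null sets of `sphMeas` are Lebesgue null there, and
continuity does the rest. -/
lemma eqOn_of_ae_sphMeas (hα : 0 ≤ α) {f g : Horiz n → ℝ} (h : f =ᵐ[sphMeas n α] g)
    (hf : ContinuousOn f (profDom n α 1)) (hg : ContinuousOn g (profDom n α 1)) :
    EqOn f g (profDom n α 1) := by
  refine Measure.eqOn_open_of_ae_eq (μ := volume) ?_ (isOpen_profDom 1) hf hg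
  have hm : AEMeasurable (fun y => ENNReal.ofReal (1 / prof α 1 y))
      (volume.restrict (profDom n α 1)) := by
    have := measurable_prof (n := n) hα 1
    fun_prop
  refine (withDensity_absolutelyContinuous' hm ?_).ae_le h
  filter_upwards [ae_restrict_mem (isOpen_profDom 1).measurableSet] with y hy
  simpa using prof_pos hα zero_le_one hy

lemma integrable_polar_mul_polar (hα : 0 ≤ α) {R : ℝ} (hR : 0 < R) {k j : Space n → ℝ}
    (hk : ContinuousOn k (upBallClosed n α R)) (hj : ContinuousOn j (upBallClosed n α R)) {s t : ℝ}
    (hs : s < Real.log R) (ht : t < Real.log R) :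
    Integrable (fun y => k (polar α (y, s)) * j (polar α (y, t))) (sphMeas n α) := by
  obtain ⟨M, -, hM⟩ := exists_polar_bound hα hR hk hs
  refine (integrable_polar hα hR hj ht).bdd_mul (c := M)
    (aestronglyMeasurable_polar hα hR (hk.mono (upBall_subset_closed R)) hs) ?_
  filter_upwards [ae_sphMeas_mem] with y hy using hM s le_rfl y hy

namespace IsThinObstacleSolution

variable {R : ℝ} {u : Space n → ℝ}

lemma sphProd_nonneg (t : ℝ) : 0 ≤ sphProd α u u t :=
  integral_nonneg fun _ => mul_self_nonneg _

/-- The comparison inequality integrated over the smaller radius from `s` to `t`. On the left `Z_α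
u` integrates along the rays to `u(t) - u(s)`; on the right `h' = 2E` evaluates the integral of `E`.
-/
lemma integral_mul_polar_add_integral_ge (hα : 0 ≤ α) (hR : 0 < R)
    (hu : IsThinObstacleSolution α R u) {s t : ℝ} (hst : s < t) (ht : t < Real.log R) :
    sphProd α u u t - ∫ y, u (polar α (y, s)) * u (polar α (y, t)) ∂sphMeas n α ≤
      (sphProd α u u t - sphProd α u u s) / 4 + (t - s) * radEnergy α u t / 2 := by
  have hs := hu.halfSolution hα
  have hr := hs.toHalfRegular
  set L := Real.log R with hL
  have hdc := hr.continuousOn_radEnergy hα hR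
  have hhd (x : ℝ) (hx : x < L) := hu.hasDerivAt_sphProd hα hR hx
  have hae : ∀ᵐ t : ℝ, s < t → t < L →
      sphProd α u u t - ∫ y, u (polar α (y, s)) * u (polar α (y, t)) ∂sphMeas n α ≤
      (sphProd α u u t - sphProd α u u s) / 4 + (t - s) * radEnergy α u t / 2 := by
    filter_upwards [hu.ae_ae_integral_mul_Zfield_le hα hR] with t h1 hst ht
    have hsL : s < L := hst.trans ht
    obtain ⟨M, hM0, hM⟩ := exists_polar_bound hα hR hr.cont ht
    have hi : Integrable (fun q : Horiz n × ℝ => u (polar α (q.1, t)) * Zfield α u (polar α q))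
        ((sphMeas n α).prod (volume.restrict (Icc s t))) := by
      have hZ := hs.integrable_sphPair hα (halfRegular_const R 1) (a := s)
        (exp_lt_of_lt_log hR ht)
      simp only [one_mul] at hZ
      refine hZ.bdd_mul (c := M) ?_ ?_
      · exact (aestronglyMeasurable_polar hα hR (hr.cont.mono (upBall_subset_closed R)) ht).comp_fst
      · filter_upwards [Measure.quasiMeasurePreserving_fst.ae ae_sphMeas_mem] with q hq
        exact hM t le_rfl q.1 hq
    have h2 := integral_sub_eq_integral_deriv (α := α)
      (Φ := fun q => u (polar α (q.1, t)) * u (polar α q))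
      (Φ' := fun q => u (polar α (q.1, t)) * Zfield α u (polar α q)) hst.le
      (fun y hy x hx => (hasDerivAt_polar hα hR hr hy (hx.2.trans_lt ht)).const_mul (u (polar α (y, t)))) hi ?_
      (integrable_polar hα hR (hr.cont.mul hr.cont) ht)
    · have h3 : ∫ y, u (polar α (y, s)) * u (polar α (y, t)) ∂sphMeas n α =
          ∫ y, u (polar α (y, t)) * u (polar α (y, s)) ∂sphMeas n α := by
        simp only [mul_comm]
      rw [h3, sphProd, h2]
      have hsub : uIcc s t ⊆ Iio L := by
        rw [uIcc_of_le hst.le]; exact fun x hx => lt_of_le_of_lt hx.2 ht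
      have hdi : IntervalIntegrable (radEnergy α u) volume s t := (hdc.mono hsub).intervalIntegrable
      have h4 : ∫ x in s..t, 2 * radEnergy α u x = sphProd α u u t - sphProd α u u s :=
        intervalIntegral.integral_eq_sub_of_hasDerivAt (fun x hx => hhd x (hsub hx))
          (hdi.const_mul 2)
      rw [intervalIntegral.integral_const_mul] at h4
      have h5 : ∫ x in s..t, (radEnergy α u x + radEnergy α u t) / 2 =
          (sphProd α u u t - sphProd α u u s) / 4 + (t - s) * radEnergy α u t / 2 := by
        rw [intervalIntegral.integral_div, intervalIntegral.integral_add hdi (by simp),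
          intervalIntegral.integral_const, smul_eq_mul]
        linarith
      change _ ≤ (sphProd α u u t - sphProd α u u s) / 4 + _
      rw [← h5]
      refine intervalIntegral.integral_mono_ae_restrict hst.le ?_ ?_ ?_
      · rw [intervalIntegrable_iff_integrableOn_Icc_of_le hst.le]
        exact hi.integral_prod_right
      · exact (hdi.add (by simp)).div_const 2
      · have h6 : ∀ᵐ x : ℝ, x ≠ t := by simp [ae_iff]
        rw [EventuallyLE, ae_restrict_iff' measurableSet_Icc]
        filter_upwards [h1, h6] with x hx hxt hxm
        exact hx (lt_of_le_of_ne hxm.2 hxt) ht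
    · exact integrable_polar_mul_polar hα hR hr.cont hr.cont ht hsL
  set D : ℝ → ℝ := fun t => (sphProd α u u t - sphProd α u u s) / 4 +
    (t - s) * radEnergy α u t / 2 - (sphProd α u u t -
      ∫ y, u (polar α (y, s)) * u (polar α (y, t)) ∂sphMeas n α) with hD
  have hDc : ContinuousOn D (Ioo s L) := by
    have c1 : ContinuousOn (sphProd α u u) (Iio L) := fun x hx =>
      (hhd x hx).continuousAt.continuousWithinAt
    have c2 := continuousOn_integral_mul_polar hα hR hr.cont
      (integrable_polar hα hR hr.cont (hst.trans ht))
    have c3 : ContinuousOn D (Iio L) := by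
      refine ((((c1.sub continuousOn_const).div_const 4).add
        (((continuousOn_id.sub continuousOn_const).mul hdc).div_const 2)).sub (c1.sub c2))
    exact c3.mono fun x hx => hx.2
  -- The inequality is known for almost every `t`. By continuity of the defect `D` the set where it
  -- fails is open, and a nonempty open set is not null.
  by_contra hc
  have hopen : IsOpen (Ioo s L ∩ D ⁻¹' Iio 0) := hDc.isOpen_inter_preimage isOpen_Ioo isOpen_Iio
  have hnull : volume (Ioo s L ∩ D ⁻¹' Iio 0) = 0 := by
    rw [ae_iff] at hae
    refine measure_mono_null (fun x hx => ?_) hae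
    intro hc
    have h1 := hc hx.1.1 hx.1.2
    have h2 : D x < 0 := hx.2
    simp only [hD] at h2
    linarith
  have hmem : t ∈ Ioo s L ∩ D ⁻¹' Iio 0 := by
    refine ⟨⟨hst, ht⟩, ?_⟩
    change D t < 0
    simp only [hD]
    linarith [not_le.1 hc]
  exact (hopen.measure_pos volume ⟨t, hmem⟩).ne' hnull

lemma monotoneOn_sphProd (hα : 0 ≤ α) (hR : 0 < R) (hu : IsThinObstacleSolution α R u) :
    MonotoneOn (sphProd α u u) (Iio (Real.log R)) := by
  refine monotoneOn_of_deriv_nonneg (convex_Iio _)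
    (fun t ht => (hu.hasDerivAt_sphProd hα hR ht).continuousAt.continuousWithinAt)
    (fun t ht => ?_) fun t ht => ?_
  · rw [interior_Iio] at ht
    exact (hu.hasDerivAt_sphProd hα hR ht).differentiableAt.differentiableWithinAt
  · rw [interior_Iio] at ht
    rw [(hu.hasDerivAt_sphProd hα hR ht).deriv]
    exact mul_nonneg two_pos.le (radEnergy_nonneg u t)

/-- Since `h` is nondecreasing and nonnegative, one zero forces zeros at all smaller radii, so `u`
vanishes on a half-ball and, by continuity and evenness, on a whole ball. No unique continuation is
involved. -/
lemma sphProd_pos (hα : 0 ≤ α) (hR : 0 < R) (hu : IsThinObstacleSolution α R u)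
    (hne : ∀ r ∈ Ioo 0 R, ∃ p ∈ pseudoBall n α r, u p ≠ 0) {t : ℝ} (ht : t < Real.log R) :
    0 < sphProd α u u t := by
  have hs := hu.halfSolution hα
  refine lt_of_le_of_ne (sphProd_nonneg t) fun h0 => ?_
  have hetR := exp_lt_of_lt_log hR ht
  have hzero : ∀ p ∈ upBall n α (Real.exp t), u p = 0 := by
    intro p hp
    obtain ⟨y, hy, hyp⟩ := exists_polar_eq hα hp.2
    set s := Real.log (gauge α p) with hsdef
    have hst : s < t := by
      rw [hsdef, Real.log_lt_iff_lt_exp (gauge_pos_of_zCoord_ne_zero hα hp.2.ne')]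
      exact hp.1
    have hsR : s < Real.log R := hst.trans ht
    have h1 : sphProd α u u s = 0 :=
      le_antisymm (by rw [h0]; exact hu.monotoneOn_sphProd hα hR hsR ht hst.le) (sphProd_nonneg s)
    rw [sphProd, integral_eq_zero_iff_of_nonneg (fun _ => mul_self_nonneg _)
      (integrable_polar hα hR (hs.cont.mul hs.cont) hsR)] at h1
    have hc : ContinuousOn (fun y => u (polar α (y, s))) (profDom n α 1) :=
      (hs.cont.mono (upBall_subset_closed R)).comp ((continuous_polar hα).comp
        (by fun_prop : Continuous fun y : Horiz n => (y, s))).continuousOn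
        fun y hy => polar_mem_upBall hα hR hy hsR
    have h2 := eqOn_of_ae_sphMeas hα h1 (hc.mul hc) continuousOn_const hy
    simp only [Pi.zero_apply, mul_self_eq_zero] at h2
    rwa [hyp] at h2
  have hzero' : ∀ p, gauge α p < Real.exp t → 0 ≤ zCoord p → u p = 0 := by
    intro p hp hz
    rcases hz.eq_or_lt with hz | hz
    · have : (𝓝[{q : Space n | 0 < zCoord q}] p).NeBot :=
        mem_closure_iff_nhdsWithin_neBot.1 (mem_closure_zCoord_pos hz.le)
      have hc : ContinuousAt u p := hu.continuousOn.continuousAt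
        ((isOpen_pseudoBall hα R).mem_nhds (hp.trans hetR))
      refine tendsto_nhds_unique (hc.tendsto.mono_left
        (nhdsWithin_le_nhds (s := {q : Space n | 0 < zCoord q})))
        ((tendsto_const_nhds (x := (0 : ℝ))).congr' ?_)
      filter_upwards [self_mem_nhdsWithin, mem_nhdsWithin_of_mem_nhds
        ((isOpen_pseudoBall hα (Real.exp t)).mem_nhds hp)] with q hq hq2
      exact (hzero q ⟨hq2, hq⟩).symm
    · exact hzero p ⟨hp, hz⟩
  obtain ⟨p, hp, hup⟩ := hne (Real.exp t) ⟨Real.exp_pos t, hetR⟩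
  have hpg : gauge α p < Real.exp t := hp
  rcases le_total 0 (zCoord p) with hz | hz
  · exact hup (hzero' p hpg hz)
  · refine hup ?_
    rw [← hu.even p (hpg.trans hetR)]
    exact hzero' _ (by simpa using hpg) (by simpa using hz)

/-- Monotonicity of the frequency in logarithmic coordinates. -/
theorem monotoneOn_radEnergy_div (hα : 0 ≤ α) (hR : 0 < R) (hu : IsThinObstacleSolution α R u)
    (hne : ∀ r ∈ Ioo 0 R, ∃ p ∈ pseudoBall n α r, u p ≠ 0) :
    MonotoneOn (fun t => radEnergy α u t / sphProd α u u t) (Iio (Real.log R)) := by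
  have hr := (hu.halfSolution hα).toHalfRegular
  have hpos (t : ℝ) (ht : t < Real.log R) := hu.sphProd_pos hα hR hne ht
  have hd (t : ℝ) (ht : t < Real.log R) := hu.hasDerivAt_sphProd hα hR ht
  have hc : ContinuousOn (sphProd α u u) (Iio (Real.log R)) := fun t ht =>
    (hd t ht).continuousAt.continuousWithinAt
  -- From `h' = 2E`, the derivative of `(log h) / 2` is the frequency `E / h`.
  refine monotoneOn_of_secant_le (F := fun t => Real.log (sphProd α u u t) / 2) (C := 2 / 3)
    (by norm_num) (fun t ht => ?_) ((hr.continuousOn_radEnergy hα hR).div hc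
      fun t ht => (hpos t ht).ne')
    (fun t ht => div_nonneg (radEnergy_nonneg u t) (hpos t ht).le) fun s t hst ht => ?_
  · refine (((hd t ht).log (hpos t ht).ne').div_const 2).congr_deriv ?_
    have := (hpos t ht).ne'
    field_simp
  · have hsL := hst.trans ht
    have ps := hpos s hsL
    have pt' := hpos t ht
    have key := hu.integral_mul_polar_add_integral_ge hα hR hst ht
    set a := sphProd α u u s with ha
    set b := sphProd α u u t with hb
    set x := Real.log b / 2 - Real.log a / 2 with hx
    have hab : a ≤ b := hu.monotoneOn_sphProd hα hR hsL ht hst.le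
    have hx0 : 0 ≤ x := by
      have := Real.log_le_log ps hab
      rw [hx]; linarith
    -- Thus `q = √(a / b)`, and `q b` is the Cauchy-Schwarz bound `√(ab)`; it is proved below by
    -- Young's inequality with the weight `q`.
    set q := Real.exp (-x) with hq
    have hq0 : 0 < q := Real.exp_pos _
    have hqab : q ^ 2 * b = a := by
      rw [hq, ← Real.exp_nat_mul, hx]
      have : ((2 : ℕ) : ℝ) * -(Real.log b / 2 - Real.log a / 2) = Real.log a - Real.log b := by
        push_cast; ring
      rw [this, Real.exp_sub, Real.exp_log ps, Real.exp_log pt']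
      field_simp
    have iuu (τ : ℝ) (hτ : τ < Real.log R) : Integrable
        (fun y => u (polar α (y, τ)) * u (polar α (y, τ))) (sphMeas n α) :=
      integrable_polar hα hR (hr.cont.mul hr.cont) hτ
    have hCS : ∫ y, u (polar α (y, s)) * u (polar α (y, t)) ∂sphMeas n α ≤ q * b := by
      have h1 : ∫ y, u (polar α (y, s)) * u (polar α (y, t)) ∂sphMeas n α ≤
          ∫ y, (q / 2 * (u (polar α (y, t)) * u (polar α (y, t))) +
            q⁻¹ / 2 * (u (polar α (y, s)) * u (polar α (y, s)))) ∂sphMeas n α := by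
        refine integral_mono (integrable_polar_mul_polar hα hR hr.cont hr.cont hsL ht)
          (((iuu t ht).const_mul _).add ((iuu s hsL).const_mul _)) fun y => ?_
        set A := u (polar α (y, t))
        set B := u (polar α (y, s))
        have h3 : q / 2 * (A * A) + q⁻¹ / 2 * (B * B) - B * A = q⁻¹ / 2 * (q * A - B) ^ 2 := by
          field_simp; ring
        have h4 : 0 ≤ q⁻¹ / 2 * (q * A - B) ^ 2 := by positivity
        change B * A ≤ q / 2 * (A * A) + q⁻¹ / 2 * (B * B)
        linarith
      refine h1.trans_eq ?_
      rw [integral_add ((iuu t ht).const_mul _) ((iuu s hsL).const_mul _), integral_const_mul,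
        integral_const_mul]
      change q / 2 * b + q⁻¹ / 2 * a = q * b
      rw [← hqab]; field_simp; ring
    -- Dividing the integrated comparison by `b` bounds `2 (1 - q - (1 - q²) / 4)` by `(t - s) E(t)
    -- / b`.
    have h2 := exp_neg_secant hx0
    rw [← hq] at h2
    change x - 2 / 3 * x ^ 3 ≤ (t - s) * (radEnergy α u t / b)
    refine h2.trans ?_
    rw [← mul_div_assoc, le_div_iff₀ pt']
    rw [← hqab] at key
    nlinarith

end IsThinObstacleSolution

end

end BaouendiGrushin

/-! ### Return to the radius `r`, and the derivative of the Monneau functional. -/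

namespace BaouendiGrushin

noncomputable section

variable {n : ℕ} {α : ℝ}

lemma exists_tendsto_atBot_of_monotoneOn {f : ℝ → ℝ} {L : ℝ} (hf : MonotoneOn f (Iio L))
    (h0 : ∀ t < L, 0 ≤ f t) : ∃ κ, Tendsto f atBot (𝓝 κ) ∧ ∀ t < L, κ ≤ f t := by
  -- Freezing the function beyond `L - 1` makes it monotone on the whole line without changing it
  -- near `-∞`.
  set g : ℝ → ℝ := fun t => f (min t (L - 1)) with hg
  have hlt (t : ℝ) : min t (L - 1) < L := (min_le_right _ _).trans_lt (by linarith)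
  have hm : Monotone g := fun s t hst => hf (hlt s) (hlt t) (min_le_min_right _ hst)
  have hb : BddBelow (range g) := ⟨0, by rintro _ ⟨t, rfl⟩; exact h0 _ (hlt t)⟩
  refine ⟨⨅ t, g t, (tendsto_atBot_ciInf hm hb).congr' ?_, fun t ht => ?_⟩
  · filter_upwards [Iic_mem_atBot (L - 1)] with t ht
    simp only [hg, min_eq_left (show t ≤ L - 1 from ht)]
  · refine (ciInf_le hb t).trans (hf (hlt t) ht (min_le_left _ _))

lemma polar_log (y : Horiz n) {r : ℝ} (hr : 0 < r) :
    polar α (y, Real.log r) = dil α r (sphPt α y) := by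
  change dil α (Real.exp (Real.log r)) _ = _
  rw [Real.exp_log hr]

lemma exp_mul_log {r : ℝ} (hr : 0 < r) (a : ℝ) : Real.exp (a * Real.log r) = r ^ a := by
  rw [Real.rpow_def_of_pos hr, mul_comm]

namespace IsThinObstacleSolution

variable {r₀ : ℝ} {u : Space n → ℝ}

lemma height_eq (hα : 0 ≤ α) (hu : IsThinObstacleSolution α r₀ u) {r : ℝ} (hr : r ∈ Ioo 0 r₀) :
    height α u r = r ^ (homDim n α - 1) * (2 * sphProd α u u (Real.log r)) := by
  rw [height, setIntegral_pseudoSphere hα hr.1 (F := fun p => u p ^ 2) fun p hp => by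
    simp only [hu.even p (show gauge α p < r₀ by rw [hp]; exact hr.2)]]
  simp only [sphProd, polar_log _ hr.1, sq]

lemma frequency_eq (hα : 0 ≤ α) (hu : IsThinObstacleSolution α r₀ u) {r : ℝ}
    (hr : r ∈ Ioo 0 r₀) :
    frequency α u r = radEnergy α u (Real.log r) / sphProd α u u (Real.log r) := by
  rw [frequency, hu.height_eq hα hr, hu.dirichlet_eq hα hr, radEnergy, exp_mul_log hr.1,
    Real.exp_log hr.1]
  have h1 : r ^ (2 - homDim n α) * r ^ (homDim n α - 1) = r := by
    rw [← Real.rpow_add hr.1]; ring_nf; exact Real.rpow_one r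
  have h2 : 0 < r ^ (homDim n α - 1) := Real.rpow_pos_of_pos hr.1 _
  rw [← mul_assoc (r ^ (homDim n α - 1)) 2, show r * (2 * upEnergy α u u r) =
    r ^ (homDim n α - 1) * 2 * (r ^ (2 - homDim n α) * upEnergy α u u r) by
      linear_combination (-2 * upEnergy α u u r) * h1, mul_div_mul_left _ _ (by positivity)]

lemma weiss_eq (hα : 0 ≤ α) (hu : IsThinObstacleSolution α r₀ u) (κ : ℝ) {r : ℝ}
    (hr : r ∈ Ioo 0 r₀) :
    weiss α κ u r = 2 * r ^ (-(2 * κ)) *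
      (radEnergy α u (Real.log r) - κ * sphProd α u u (Real.log r)) := by
  rw [weiss, hu.height_eq hα hr, hu.dirichlet_eq hα hr, radEnergy, exp_mul_log hr.1,
    Real.exp_log hr.1, one_div, ← Real.rpow_neg hr.1.le, div_eq_mul_inv κ, ← Real.rpow_neg hr.1.le]
  have h1 : r ^ (-(homDim n α - 2 + 2 * κ)) = r ^ (-(2 * κ)) * r ^ (2 - homDim n α) := by
    rw [← Real.rpow_add hr.1]; ring_nf
  have h2 : r ^ (-(homDim n α - 1 + 2 * κ)) * r ^ (homDim n α - 1) = r ^ (-(2 * κ)) := by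
    rw [← Real.rpow_add hr.1]; ring_nf
  linear_combination 2 * upEnergy α u u r * h1 - 2 * κ * sphProd α u u (Real.log r) * h2

lemma monneau_eq (hα : 0 ≤ α) (hr₀ : 0 < r₀) (hu : IsThinObstacleSolution α r₀ u) {κ : ℝ}
    {P : Space n → ℝ} (hP : IsPosSolidHarmonic α κ P) {r : ℝ} (hr : r ∈ Ioo 0 r₀) :
    monneau α κ u P r = 2 * r ^ (-(2 * κ)) * (sphProd α u u (Real.log r) -
      2 * sphProd α u P (Real.log r) + sphProd α P P (Real.log r)) := by
  have hlog : Real.log r < Real.log r₀ := Real.log_lt_log hr.1 hr.2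
  have cu := (hu.halfSolution hα).cont
  have cP := (hP.isSolidHarmonic.halfSolution hα r₀).cont
  have i1 := integrable_polar_mul_polar hα hr₀ cu cu hlog hlog
  have i2 := integrable_polar_mul_polar hα hr₀ cu cP hlog hlog
  have i3 := integrable_polar_mul_polar hα hr₀ cP cP hlog hlog
  have h1 : ∫ y, (u (dil α r (sphPt α y)) - P (dil α r (sphPt α y))) ^ 2 ∂sphMeas n α =
      sphProd α u u (Real.log r) - 2 * sphProd α u P (Real.log r) +
        sphProd α P P (Real.log r) := by
    simp only [sphProd]
    have i4 : Integrable (fun y => u (polar α (y, Real.log r)) * u (polar α (y, Real.log r)) -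
      2 * (u (polar α (y, Real.log r)) * P (polar α (y, Real.log r)))) (sphMeas n α) :=
      i1.sub (i2.const_mul 2)
    rw [← integral_const_mul, ← integral_sub i1 (i2.const_mul 2), ← integral_add i4 i3]
    refine integral_congr_ae (Eventually.of_forall fun y => ?_)
    simp only [polar_log _ hr.1]
    ring
  rw [monneau, setIntegral_pseudoSphere hα hr.1 (F := fun p => (u p - P p) ^ 2) fun p hp => by
    simp only [hu.even p (show gauge α p < r₀ by rw [hp]; exact hr.2), hP.even p], h1,
    ← mul_assoc, one_div, ← Real.rpow_neg hr.1.le, ← Real.rpow_add hr.1]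
  ring_nf

end IsThinObstacleSolution

lemma IsSolidHarmonic.sphProd_self (hα : 0 ≤ α) {κ : ℝ} {P : Space n → ℝ}
    (hP : IsSolidHarmonic α κ P) (t : ℝ) :
    sphProd α P P t = Real.exp (2 * κ * t) * ∫ y, P (sphPt α y) ^ 2 ∂sphMeas n α := by
  rw [sphProd, ← integral_const_mul]
  refine integral_congr_ae ?_
  filter_upwards [ae_sphMeas_mem] with y hy
  have h := hP.dil_eq (zCoord_sphPt_pos hα hy).ne' t
  change P (dil α (Real.exp t) (sphPt α y)) * P (dil α (Real.exp t) (sphPt α y)) = _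
  rw [h, show 2 * κ * t = κ * t + κ * t by ring, Real.exp_add]
  ring

namespace IsPosSolidHarmonic

variable {κ r₀ : ℝ} {u P : Space n → ℝ}

lemma thinPair_eq_zero (hα : 0 ≤ α) (hP : IsPosSolidHarmonic α κ P) (f : Space n → ℝ) (s : ℝ) :
    thinPair α P f s = 0 := by
  simp [thinPair, hP.dzTrace_eq_zero hα (zCoord_pt _ _)]

/-- Euler's relation for `P` turns its energy pairing into a multiple of the product over spheres. -/
lemma upEnergy_eq (hα : 0 ≤ α) (hr₀ : 0 < r₀) (hu : HalfSolution α r₀ u)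
    (hP : IsPosSolidHarmonic α κ P) {t : ℝ} (ht : t < Real.log r₀) :
    Real.exp ((2 - homDim n α) * t) * upEnergy α u P (Real.exp t) = κ * sphProd α u P t := by
  have hPs := hP.isSolidHarmonic.halfSolution hα r₀
  have hc1 : ContinuousOn (fun t => Real.exp ((2 - homDim n α) * t) *
      upEnergy α u P (Real.exp t)) (Iio (Real.log r₀)) := by
    have h0 : Continuous fun t : ℝ => Real.exp ((2 - homDim n α) * t) := by fun_prop
    exact h0.continuousOn.mul ((continuousOn_upEnergy hα hu.toHalfRegular hPs.toHalfRegular).comp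
      Real.continuous_exp.continuousOn fun t ht => ⟨Real.exp_pos t, exp_lt_of_lt_log hr₀ ht⟩)
  have hc2 : ContinuousOn (fun t => κ * sphProd α u P t) (Iio (Real.log r₀)) :=
    continuousOn_const.mul fun t ht =>
      (hu.hasDerivAt_sphProd hα hr₀ hPs ht).continuousAt.continuousWithinAt
  -- The slice identity for `P` tested with `u` holds almost everywhere; both sides are continuous
  -- in `t`, so it holds everywhere.
  refine Measure.eqOn_open_of_ae_eq (μ := volume) ?_ isOpen_Iio hc1 hc2 ht
  rw [EventuallyEq, ae_restrict_iff' measurableSet_Iio]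
  filter_upwards [hPs.slice_identity hα hr₀ hu.toHalfRegular] with t h htR
  have h1 := h htR
  have h2 : sphPair α P u t = κ * sphProd α u P t := by
    rw [sphPair, sphProd, ← integral_const_mul]
    refine integral_congr_ae ?_
    filter_upwards [ae_sphMeas_mem] with y hy
    rw [(hP.isSolidHarmonic.homogeneous _ (polar_mem hα hy t).2.ne').2]
    ring
  rw [hP.thinPair_eq_zero hα, add_zero, h2, upEnergy_comm] at h1
  rw [h1, ← mul_assoc, ← Real.exp_add, show (2 - homDim n α) * t + (homDim n α - 2) * t = 0 by ring,
    Real.exp_zero, one_mul]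

/-- The factor `e^{-2κt}` contributes `-2κ⟨u, P⟩`, which cancels twice the mixed energy by
`upEnergy_eq`. Only the thin pairing with the trace of `D_z u` survives. -/
lemma hasDerivAt_sphProd (hα : 0 ≤ α) (hr₀ : 0 < r₀) (hu : HalfSolution α r₀ u)
    (hP : IsPosSolidHarmonic α κ P) {t : ℝ} (ht : t < Real.log r₀) :
    HasDerivAt (fun t => Real.exp (-(2 * κ) * t) * sphProd α u P t)
      (Real.exp (-(2 * κ) * t) * (Real.exp ((2 - homDim n α) * t) *
        thinPair α u P (Real.exp t))) t := by
  have hPs := hP.isSolidHarmonic.halfSolution hα r₀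
  have h1 : HasDerivAt (fun t => Real.exp (-(2 * κ) * t))
      (Real.exp (-(2 * κ) * t) * (-(2 * κ) * 1)) t :=
    ((hasDerivAt_id t).const_mul (-(2 * κ))).exp
  refine (h1.mul (hu.hasDerivAt_sphProd hα hr₀ hPs ht)).congr_deriv ?_
  rw [hP.thinPair_eq_zero hα]
  linear_combination 2 * Real.exp (-(2 * κ) * t) * hP.upEnergy_eq hα hr₀ hu ht

/-- The derivative of the Monneau functional. -/
theorem hasDerivAt_monneau (hα : 0 ≤ α) (hr₀ : 0 < r₀) (hu : IsThinObstacleSolution α r₀ u)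
    (hP : IsPosSolidHarmonic α κ P) {r : ℝ} (hr : r ∈ Ioo 0 r₀) :
    HasDerivAt (monneau α κ u P) (2 / r * weiss α κ u r -
      4 / r * (r ^ (-(2 * κ)) * (r ^ (2 - homDim n α) * thinPair α u P r))) r := by
  set L := Real.log r₀ with hL
  have hs := hu.halfSolution hα
  have ht : Real.log r < L := Real.log_lt_log hr.1 hr.2
  set p₀ := ∫ y, P (sphPt α y) ^ 2 ∂sphMeas n α with hp₀
  -- By homogeneity `e^{-2κt}⟨P, P⟩` is the constant `p₀`.
  set m : ℝ → ℝ := fun t => 2 * (Real.exp (-(2 * κ) * t) * sphProd α u u t -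
    2 * (Real.exp (-(2 * κ) * t) * sphProd α u P t) + p₀) with hm
  have hmr : monneau α κ u P =ᶠ[𝓝 r] fun r => m (Real.log r) := by
    filter_upwards [Ioo_mem_nhds hr.1 hr.2] with s hs'
    have e1 : Real.exp (-(2 * κ) * Real.log s) * Real.exp (2 * κ * Real.log s) = 1 := by
      rw [← Real.exp_add, ← Real.exp_zero]; congr 1; ring
    rw [hu.monneau_eq hα hr₀ hP hs', hP.isSolidHarmonic.sphProd_self hα, ← hp₀,
      ← exp_mul_log hs'.1 (-(2 * κ))]
    simp only [hm]
    linear_combination 2 * p₀ * e1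
  have h1 : HasDerivAt (fun t => Real.exp (-(2 * κ) * t))
      (Real.exp (-(2 * κ) * Real.log r) * (-(2 * κ) * 1)) (Real.log r) :=
    ((hasDerivAt_id _).const_mul (-(2 * κ))).exp
  have h2 := ((((h1.mul (hu.hasDerivAt_sphProd hα hr₀ ht)).sub
    ((hP.hasDerivAt_sphProd hα hr₀ hs ht).const_mul 2)).add_const p₀).const_mul 2).comp r
    (Real.hasDerivAt_log hr.1.ne')
  refine (h2.congr_of_eventuallyEq hmr).congr_deriv ?_
  rw [hu.weiss_eq hα κ hr]
  simp only [exp_mul_log hr.1, Real.exp_log hr.1]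
  have := hr.1.ne'
  field_simp
  ring

end IsPosSolidHarmonic

end

end BaouendiGrushin

/-! ### Assembly of the theorem. -/

theorem mainTheorem4 {n : ℕ} (hn : 1 ≤ n) {α r₀ : ℝ} (hα : 0 ≤ α) (hr₀ : 0 < r₀)
    (u : BaouendiGrushin.Space n → ℝ)
    (hu : BaouendiGrushin.IsThinObstacleSolution α r₀ u)
    (hne : ∀ r ∈ Ioo 0 r₀, ∃ p ∈ BaouendiGrushin.pseudoBall n α r, u p ≠ 0) :
    (∀ r ∈ Ioo 0 r₀, 0 < BaouendiGrushin.height α u r) ∧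
    ∃ κ : ℝ, Tendsto (BaouendiGrushin.frequency α u) (𝓝[>] 0) (𝓝 κ) ∧
      (∀ r ∈ Ioo 0 r₀, 0 ≤ BaouendiGrushin.weiss α κ u r) ∧
      ∀ P : BaouendiGrushin.Space n → ℝ, BaouendiGrushin.IsPosSolidHarmonic α κ P →
        (∀ r ∈ Ioo 0 r₀,
          DifferentiableAt ℝ (BaouendiGrushin.monneau α κ u P) r ∧
          2 / r * BaouendiGrushin.weiss α κ u r ≤
            deriv (BaouendiGrushin.monneau α κ u P) r) ∧
        MonotoneOn (BaouendiGrushin.monneau α κ u P) (Ioo 0 r₀) := by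
  have hlog {r : ℝ} (hr : r ∈ Ioo 0 r₀) : Real.log r < Real.log r₀ := Real.log_lt_log hr.1 hr.2
  have hpos {t : ℝ} (ht : t < Real.log r₀) := hu.sphProd_pos hα hr₀ hne ht
  obtain ⟨κ, hκ, hκle⟩ := BaouendiGrushin.exists_tendsto_atBot_of_monotoneOn
    (hu.monotoneOn_radEnergy_div hα hr₀ hne) fun t ht =>
      div_nonneg (BaouendiGrushin.radEnergy_nonneg u t) (hpos ht).le
  -- The limit of a nondecreasing frequency lies below all its values, and `κ h ≤ E` is
  -- nonnegativity of the Weiss functional.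
  have hW : ∀ r ∈ Ioo 0 r₀, 0 ≤ BaouendiGrushin.weiss α κ u r := by
    intro r hr
    have h1 := hκle _ (hlog hr)
    rw [le_div_iff₀ (hpos (hlog hr))] at h1
    rw [hu.weiss_eq hα κ hr]
    exact mul_nonneg (mul_nonneg two_pos.le (Real.rpow_nonneg hr.1.le _)) (sub_nonneg.2 h1)
  refine ⟨fun r hr => ?_, κ, ?_, hW, fun P hP => ?_⟩
  · rw [hu.height_eq hα hr]
    exact mul_pos (Real.rpow_pos_of_pos hr.1 _) (mul_pos two_pos (hpos (hlog hr)))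
  · refine (hκ.comp Real.tendsto_log_nhdsGT_zero).congr' ?_
    filter_upwards [Ioo_mem_nhdsGT hr₀] with r hr using (hu.frequency_eq hα hr).symm
  · have hd (r : ℝ) (hr : r ∈ Ioo 0 r₀) := hP.hasDerivAt_monneau hα hr₀ hu hr
    have hle : ∀ r ∈ Ioo 0 r₀, 2 / r * BaouendiGrushin.weiss α κ u r ≤
        deriv (BaouendiGrushin.monneau α κ u P) r := by
      intro r hr
      rw [(hd r hr).deriv]
      have h1 : BaouendiGrushin.thinPair α u P r ≤ 0 :=
        hu.thinPair_nonpos hα hr.2.le fun x _ => hP.nonneg _ (BaouendiGrushin.zCoord_pt _ _)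
      have h2 : 4 / r * (r ^ (-(2 * κ)) * (r ^ (2 - BaouendiGrushin.homDim n α) *
          BaouendiGrushin.thinPair α u P r)) ≤ 0 :=
        mul_nonpos_of_nonneg_of_nonpos (div_nonneg (by norm_num) hr.1.le)
          (mul_nonpos_of_nonneg_of_nonpos (Real.rpow_nonneg hr.1.le _)
            (mul_nonpos_of_nonneg_of_nonpos (Real.rpow_nonneg hr.1.le _) h1))
      linarith
    refine ⟨fun r hr => ⟨(hd r hr).differentiableAt, hle r hr⟩, ?_⟩
    refine monotoneOn_of_deriv_nonneg (convex_Ioo 0 r₀)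
      (fun r hr => (hd r hr).continuousAt.continuousWithinAt)
      (fun r hr => ?_) fun r hr => ?_
    · rw [interior_Ioo] at hr
      exact (hd r hr).differentiableAt.differentiableWithinAt
    · rw [interior_Ioo] at hr
      exact (mul_nonneg (div_nonneg two_pos.le hr.1.le) (hW r hr)).trans (hle r hr)
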